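/- Let $n\ge 2$, $N=n(n-1)/2$, write $x_{ij}=x_i-x_j$, $z_{ij}=z_i-z_j$, $\partial_i=\partial/\partial x_i$, and let $U_n\subset\mathbb{C}^n$ be the set of points with pairwise distinct coordinates. Put $\Delta=\sum_{i=1}^n\partial_i^2$, $\tilde\Delta=\Delta-\sum_{1\le i<j\le n}4x_{ij}^{-2}$ and $$\tilde{\mathcal H}=\sum_{i=1}^n(\partial_i^2-x_i)-\sum_{1\le i<j\le n}\frac{4}{(x_i-x_j)^2}.$$ There is exactly one partial differential operator $\mathcal D_n$ (the Chalykh–Veselov intertwiner) which is a polynomial in the $\partial_i-\partial_j$ with coefficients rational in the $x_i-x_j$, satisfies $\mathcal D_n\Delta=\tilde\Delta\mathcal D_n$, has the form $\prod_{i<j}(\partial_i-\partial_j)+(\text{terms of order}<N)$, and is homogeneous of degree $-N$ under dilations of $\vec x$. Let $$\psi(\vec x,\vec z)=\exp\Bigl(\frac1n\sum_{1\le i<j\le n}x_{ij}z_{ij}\Bigr)\,\mathrm{Ai}\Bigl(\bigl(\tfrac1n\bigr)^{1/3}\sum_{i=1}^n(x_i+z_i)\Bigr),\qquad p_n(\vec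 z)=\sum_{j=1}^n\Bigl(\Bigl(\frac1n\sum_{i=1}^n z_{ij}\Bigr)^2+z_j\Bigr),$$ where $\mathrm{Ai}$ is the Airy function. Then the function $$\tilde\psi(\vec x,\vec z)=\prod_{i<j}z_{ij}^{-1}\,\mathcal D_n[\psi]\qquad(\vec x,\vec z\in U_n),$$ with $\mathcal D_n$ acting in $\vec x$, is analytic in $\vec x\in U_n$ for every $\vec z\in U_n$, does not vanish identically in $\vec x$ for any $\vec z\in U_n$, and satisfies $$\tilde{\mathcal H}\tilde\psi(\vec x,\vec z)=p_n(\vec z)\,\tilde\psi(\vec x,\vec z)\qquad\text{and}\qquad\tilde\psi(\vec x,\vec z)=\tilde\psi(\vec z,\vec x)$$ for all $\vec x,\vec z\in U_n$. In particular $\tilde{\mathcal H}$ is trivially bispectral, i.e. it has a nonzero family of analytic eigenfunctions, with eigenvalue depending on $\vec z$ only, that is symmetric in $\vec x$ and $\vec z$. -/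

import Mathlib

noncomputable section

namespace CalogeroAiry

open Finset

/-- Configurations of `n` pairwise distinct points. All functions below are considered on this
open set, the complement of the hyperplanes `x i = x j`. -/
def regular (n : ℕ) : Set (Fin n → ℂ) := {x | Function.Injective x}

/-- The partial derivative `∂_i f`. -/
def partialD {n : ℕ} (i : Fin n) (f : (Fin n → ℂ) → ℂ) : (Fin n → ℂ) → ℂ :=
  fun x => lineDeriv ℂ f x (Pi.single i 1)

/-- The iterated partial derivative `∂_1 ^ α_1 ⋯ ∂_n ^ α_n f`. -/
def multiPartialD {n : ℕ} (α : Fin n →₀ ℕ) (f : (Fin n → ℂ) → ℂ) : (Fin n → ℂ) → ℂ :=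
  (List.finRange n).foldr (fun i g => (partialD i)^[α i] g) f

/-- The Laplacian `Δ = ∑ ∂_i²`. -/
def laplacian {n : ℕ} (f : (Fin n → ℂ) → ℂ) : (Fin n → ℂ) → ℂ :=
  fun x => ∑ i, partialD i (partialD i f) x

/-- The Calogero-Moser potential `∑_{i<j} 4 / (x_i - x_j)²`. -/
def potential {n : ℕ} (x : Fin n → ℂ) : ℂ :=
  ∑ i, ∑ j ∈ Ioi i, 4 / (x i - x j) ^ 2

/-- The Calogero-Moser operator `Δ - ∑_{i<j} 4 / (x_i - x_j)²`. -/
def laplacianTilde {n : ℕ} (f : (Fin n → ℂ) → ℂ) : (Fin n → ℂ) → ℂ :=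
  fun x => laplacian f x - potential x * f x

/-- The quantum Hamiltonian `∑ (∂_i² - x_i) - ∑_{i<j} 4 / (x_i - x_j)²`. -/
def hamiltonianTilde {n : ℕ} (f : (Fin n → ℂ) → ℂ) : (Fin n → ℂ) → ℂ :=
  fun x => (∑ i, (partialD i (partialD i f) x - x i * f x)) - potential x * f x

/-- The field `ℂ(x_1, …, x_n)`. -/
abbrev RatField (n : ℕ) : Type := FractionRing (MvPolynomial (Fin n) ℂ)

/-- The value at a point of a rational function, computed from its reduced fraction
(hence correct wherever the rational function is regular). -/
def evalRat {n : ℕ} (a : RatField n) (x : Fin n → ℂ) : ℂ :=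
  MvPolynomial.eval x (IsFractionRing.num (MvPolynomial (Fin n) ℂ) a) /
    MvPolynomial.eval x (IsFractionRing.den (MvPolynomial (Fin n) ℂ) a :
      MvPolynomial (Fin n) ℂ)

/-- A partial differential operator `∑ a_α(x) ∂^α` with rational coefficients, stored as its full
symbol `∑ a_α ξ^α` (coefficients to the left of the derivatives). -/
abbrev DiffOp (n : ℕ) : Type := MvPolynomial (Fin n) (RatField n)

/-- The action `f ↦ ∑ a_α(x) ∂^α f` of a partial differential operator on functions. -/
def DiffOp.act {n : ℕ} (D : DiffOp n) (f : (Fin n → ℂ) → ℂ) : (Fin n → ℂ) → ℂ :=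
  fun x => ∑ α ∈ D.support, evalRat (D.coeff α) x * multiPartialD α f x

/-- The value `∑ a_α(x) ξ^α` of the full symbol. -/
def DiffOp.symbol {n : ℕ} (D : DiffOp n) (x ξ : Fin n → ℂ) : ℂ :=
  ∑ α ∈ D.support, evalRat (D.coeff α) x * ∏ i, ξ i ^ α i

/-- The field `ℂ(x_i - x_j)` of rational functions of the differences. -/
def diffField (n : ℕ) : IntermediateField ℂ (RatField n) :=
  IntermediateField.adjoin ℂ
    {a | ∃ i j : Fin n, a = algebraMap (MvPolynomial (Fin n) ℂ) (RatField n)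
      (MvPolynomial.X i - MvPolynomial.X j)}

/-- The Chalykh-Veselov intertwiner: the operator `D` that
* is a polynomial in the `∂_i - ∂_j` with coefficients rational in the `x_i - x_j`;
* satisfies `D Δ = (Δ - ∑_{i<j} 4 / (x_i - x_j)²) D`;
* is normalized: its leading term is `∏_{i<j} (∂_i - ∂_j)`, and it is homogeneous of degree
  `- n (n - 1) / 2` under dilations of `x`. -/
structure IsChalykhVeselov {n : ℕ} (D : DiffOp n) : Prop where
  mem_adjoin : D ∈ Algebra.adjoin (diffField n)
    {P : DiffOp n | ∃ i j : Fin n, P = MvPolynomial.X i - MvPolynomial.X j}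
  intertwines : ∀ f : (Fin n → ℂ) → ℂ, AnalyticOnNhd ℂ f (regular n) →
    ∀ x ∈ regular n, D.act (laplacian f) x = laplacianTilde (D.act f) x
  leading : (D - ∏ i, ∏ j ∈ Ioi i, (MvPolynomial.X i - MvPolynomial.X j)).totalDegree
    < n.choose 2
  homogeneous : ∀ t : ℂ, t ≠ 0 → ∀ x ∈ regular n, ∀ ξ : Fin n → ℂ,
    D.symbol (t • x) (t⁻¹ • ξ) = (t ^ n.choose 2)⁻¹ * D.symbol x ξ

/-- The Airy function `Ai` on `ℂ`, by its everywhere convergent Maclaurin series: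
`Ai(s) = Ai(0) (1 + s³/3! + 1·4 s⁶/6! + ⋯) + Ai'(0) (s + 2 s⁴/4! + 2·5 s⁷/7! + ⋯)` with
`Ai(0) = 3^(-2/3) / Γ(2/3)` and `Ai'(0) = - 3^(-1/3) / Γ(1/3)`. -/
def airyAi (s : ℂ) : ℂ :=
  (((3 : ℝ) ^ (-(2 / 3) : ℝ) / Real.Gamma (2 / 3) : ℝ) : ℂ) *
      ∑' k : ℕ, (∏ j ∈ range k, (3 * (j : ℂ) + 1)) * s ^ (3 * k) / ((3 * k).factorial : ℂ) -
    (((3 : ℝ) ^ (-(1 / 3) : ℝ) / Real.Gamma (1 / 3) : ℝ) : ℂ) *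
      ∑' k : ℕ, (∏ j ∈ range k, (3 * (j : ℂ) + 2)) * s ^ (3 * k + 1) /
        ((3 * k + 1).factorial : ℂ)

/-- `ψ(x, z) = exp((1/n) ∑_{i<j} x_{ij} z_{ij}) Ai((1/n)^(1/3) ∑ (x_i + z_i))`. -/
def psi {n : ℕ} (x z : Fin n → ℂ) : ℂ :=
  Complex.exp (1 / (n : ℂ) * ∑ i, ∑ j ∈ Ioi i, (x i - x j) * (z i - z j)) *
    airyAi (((1 / (n : ℝ)) ^ (1 / 3 : ℝ) : ℝ) * ∑ i, (x i + z i))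

/-- `p_n(z) = ∑_j (((1/n) ∑_i (z_i - z_j))² + z_j)`. -/
def eigenvalue {n : ℕ} (z : Fin n → ℂ) : ℂ :=
  ∑ j, ((1 / (n : ℂ) * ∑ i, (z i - z j)) ^ 2 + z j)

/-- `ψ̃(x, z) = ∏_{i<j} (z_i - z_j)⁻¹ D[ψ(·, z)](x)`. -/
def psiTilde {n : ℕ} (D : DiffOp n) (x z : Fin n → ℂ) : ℂ :=
  (∏ i, ∏ j ∈ Ioi i, (z i - z j)⁻¹) * D.act (fun y => psi y z) x

/-- `L` is trivially bispectral: it has a nonzero family of (analytic) eigenfunctions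
`ψ(x, z)` that is symmetric in `x` and `z`. -/
def IsTriviallyBispectral {n : ℕ} (L : ((Fin n → ℂ) → ℂ) → (Fin n → ℂ) → ℂ) : Prop :=
  ∃ (Ψ : (Fin n → ℂ) → (Fin n → ℂ) → ℂ) (p : (Fin n → ℂ) → ℂ),
    (∃ x ∈ regular n, ∃ z ∈ regular n, Ψ x z ≠ 0) ∧
    (∀ z ∈ regular n, AnalyticOnNhd ℂ (fun x => Ψ x z) (regular n)) ∧
    (∀ x ∈ regular n, ∀ z ∈ regular n, L (fun y => Ψ y z) x = p z * Ψ x z) ∧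
    (∀ x ∈ regular n, ∀ z ∈ regular n, Ψ x z = Ψ z x)

end CalogeroAiry

end

/-! Put N = n(n-1)/2. The proof rests on the Baker-Akhiezer function B_x(ξ) exp(∑ x_k ξ_k): B_x is a
polynomial in ξ with leading part ∏_{i<j} ξ_ij, and the derivative of the function along e_i - e_j
in ξ vanishes on the wall ξ_i = ξ_j ("quasi-invariance"). The condition is rigid. When the x_i are
distinct, comparing top degrees on the walls shows that the leading form of a quasi-invariant
polynomial is divisible by every ξ_ij, so a quasi-invariant polynomial of degree < N is zero
(`QuasiInvariant.eq_zero`).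

Existence of B_x is Berest's formula. A gauge form of the Calogero-Moser operator preserves
quasi-invariance (`quasiInvariant_berest`). Shifted by the constant ∑ x_k² and applied N times to ∏
ξ_ij² it lowers the degree from 2N to N, and the leading term becomes a nonzero constant times ∏
x_ij ∏ ξ_ij (`exists_quasiInvariant`). Uniqueness then gives homogeneity and invariance under
translations in both x and ξ.

The intertwiner D is the operator with full symbol B_x(ξ). The symbol of Δ̃ D - D Δ is again
quasi-invariant in ξ, because ∑ ξ_k² has zero derivative along e_i - e_j on the wall. Its degree N
part vanishes because quasi-invariance also determines the degree N - 1 part of B_x. Rigidity makes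
it zero (`defect_eq_zero`). Uniqueness of D is a separate argument. In the difference of two
intertwiners, the leading form P_d(x, ξ), of order d < N, is constant in x along ξ and homogeneous
in x of negative degree d - N, hence zero (`coeff_eq_zero_of_defect_eq_zero`).

Symmetry is bispectral duality: ∏ x_ij · B_x(ξ) is symmetric in x and ξ (`vdm_mul_eval_ba_comm`).
The Calogero-Moser equation in x, conjugated by ∏ x_ij, makes this polynomial quasi-invariant in x,
and its degrees in x and ξ match, so rigidity applies once more.

Finally ψ is exp(∑ ζ_k x_k) h(∑ x_k) with ζ the centered z and h a rescaled Airy function. As D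
involves only the differences ∂_i - ∂_j, which do not see h, one gets D ψ = B_x(z) ψ, and D commutes
with multiplication by ∑ x_k on such functions. Airy's equation gives Δ ψ = (p_n(z) + ∑ x_k) ψ;
intertwining turns this into the eigenvalue equation, and duality gives the symmetry. -/

noncomputable section

namespace CalogeroAiry

open Finset MvPolynomial

/-! ### Difference products and sums over pairs -/

/-- The difference product `∏_{i<j} (v_i - v_j)`. -/
def vdm {n : ℕ} {R : Type*} [CommRing R] (v : Fin n → R) : R := ∏ i, ∏ j ∈ Ioi i, (v i - v j)

/-- The pairs `i < j`. -/
def pairs (n : ℕ) : Finset (Fin n × Fin n) := univ.filter fun p => p.1 < p.2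

/-- The difference product with the factor of index `p` removed. -/
def vdmErase {n : ℕ} {R : Type*} [CommRing R] (v : Fin n → R) (p : Fin n × Fin n) : R :=
  ∏ q ∈ (pairs n).erase p, (v q.1 - v q.2)

theorem mem_pairs {n : ℕ} {p : Fin n × Fin n} : p ∈ pairs n ↔ p.1 < p.2 := by
  simp [pairs]

theorem prod_Ioi_eq_prod_pairs {n : ℕ} {M : Type*} [CommMonoid M] (f : Fin n → Fin n → M) :
    ∏ i, ∏ j ∈ Ioi i, f i j = ∏ p ∈ pairs n, f p.1 p.2 := by
  rw [Finset.prod_sigma', pairs]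
  refine Finset.prod_bij' (fun s _ => (s.1, s.2)) (fun p _ => ⟨p.1, p.2⟩) ?_ ?_ ?_ ?_ ?_ <;> simp

theorem sum_Ioi_eq_sum_pairs {n : ℕ} {M : Type*} [AddCommMonoid M] (f : Fin n → Fin n → M) :
    ∑ i, ∑ j ∈ Ioi i, f i j = ∑ p ∈ pairs n, f p.1 p.2 := by
  rw [Finset.sum_sigma', pairs]
  refine Finset.sum_bij' (fun s _ => (s.1, s.2)) (fun p _ => ⟨p.1, p.2⟩) ?_ ?_ ?_ ?_ ?_ <;> simp

theorem vdm_eq {n : ℕ} {R : Type*} [CommRing R] (v : Fin n → R) :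
    vdm v = ∏ p ∈ pairs n, (v p.1 - v p.2) := prod_Ioi_eq_prod_pairs _

theorem mul_vdmErase {n : ℕ} {R : Type*} [CommRing R] (v : Fin n → R) {p : Fin n × Fin n}
    (hp : p ∈ pairs n) : (v p.1 - v p.2) * vdmErase v p = vdm v := by
  rw [vdm_eq, vdmErase, Finset.mul_prod_erase _ (fun q : Fin n × Fin n => v q.1 - v q.2) hp]

theorem card_pairs (n : ℕ) : (pairs n).card = n.choose 2 := by
  have h : (pairs n).card = ∑ i : Fin n, (n - 1 - (i : ℕ)) := by
    have := sum_Ioi_eq_sum_pairs (n := n) (fun _ _ => 1)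
    simp only [Finset.sum_const, smul_eq_mul, mul_one, Fin.card_Ioi] at this
    rw [← this]
  rw [h, Fin.sum_univ_eq_sum_range (fun i => n - 1 - i) n, Finset.sum_range_reflect (fun i => i) n,
    Finset.sum_range_id, Nat.choose_two_right]

theorem map_vdm {n : ℕ} {R S F : Type*} [CommRing R] [CommRing S] [FunLike F R S]
    [RingHomClass F R S] (φ : F) (v : Fin n → R) : φ (vdm v) = vdm (fun i => φ (v i)) := by
  simp [vdm, map_prod]

theorem vdm_ne_zero_iff {n : ℕ} {R : Type*} [CommRing R] [IsDomain R] (v : Fin n → R) :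
    vdm v ≠ 0 ↔ Function.Injective v := by
  rw [vdm_eq, Finset.prod_ne_zero_iff]
  constructor
  · intro h i j hij
    rcases lt_trichotomy i j with hl | hl | hl
    · exact absurd (sub_eq_zero.2 hij) (h (i, j) (mem_pairs.2 hl))
    · exact hl
    · exact absurd (sub_eq_zero.2 hij.symm) (h (j, i) (mem_pairs.2 hl))
  · intro h p hp h0
    exact (mem_pairs.1 hp).ne (h (sub_eq_zero.1 h0))

theorem sum_sum_eq_two_mul_sum_pairs {n : ℕ} {R : Type*} [CommRing R] (g : Fin n → Fin n → R)
    (hs : ∀ i j, g i j = g j i) (h0 : ∀ i, g i i = 0) :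
    ∑ i, ∑ j, g i j = 2 * ∑ p ∈ pairs n, g p.1 p.2 := by
  have h1 : ∀ i j, g i j = (if i < j then g i j else 0) + (if j < i then g j i else 0) := by
    intro i j
    rcases lt_trichotomy i j with h | h | h
    · simp [h, h.not_gt]
    · subst h; simp [h0]
    · simp [h, h.not_gt, hs i j]
  have h2 : ∑ i, ∑ j, (if i < j then g i j else 0) = ∑ p ∈ pairs n, g p.1 p.2 := by
    rw [pairs, Finset.sum_filter, ← Finset.univ_product_univ, Finset.sum_product]
  have h3 : ∑ i, ∑ j, (if j < i then g j i else 0) = ∑ p ∈ pairs n, g p.1 p.2 := by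
    rw [Finset.sum_comm]; exact h2
  calc _ = ∑ i, ∑ j, ((if i < j then g i j else 0) + (if j < i then g j i else 0)) :=
        Finset.sum_congr rfl fun i _ => Finset.sum_congr rfl fun j _ => h1 i j
    _ = _ := by simp only [Finset.sum_add_distrib, h2, h3]; ring

/-! ### Divisibility by X_i - X_j -/

section Wall
variable {n : ℕ} {A : Type*} [CommRing A]

/-- The substitution `X_i ↦ X_j`. -/
def wall (i j : Fin n) : MvPolynomial (Fin n) A →ₐ[A] MvPolynomial (Fin n) A :=
  rename (Function.update id i j)

theorem wall_X_left (i j : Fin n) : wall i j (X i : MvPolynomial (Fin n) A) = X j := by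
  simp [wall]

theorem wall_X_of_ne {i k : Fin n} (j : Fin n) (h : k ≠ i) :
    wall i j (X k : MvPolynomial (Fin n) A) = X k := by
  simp [wall, h]

theorem X_sub_X_dvd_sub_wall (i j : Fin n) (P : MvPolynomial (Fin n) A) :
    X i - X j ∣ P - wall i j P := by
  induction P using MvPolynomial.induction_on with
  | C a => simp [wall]
  | add p q hp hq =>
    rw [map_add, add_sub_add_comm]; exact dvd_add hp hq
  | mul_X p k hp =>
    have : X i - X j ∣ (X k - wall i j (X k) : MvPolynomial (Fin n) A) := by
      by_cases h : k = i
      · subst h; rw [wall_X_left]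
      · rw [wall_X_of_ne j h, sub_self]; exact dvd_zero _
    have e : p * X k - wall i j (p * X k) =
        (p - wall i j p) * X k + wall i j p * (X k - wall i j (X k)) := by
      rw [map_mul]; ring
    rw [e]
    exact dvd_add (hp.mul_right _) (this.mul_left _)

/-- This turns divisibility into vanishing under a ring homomorphism, the form in which all wall
conditions are computed. -/
theorem X_sub_X_dvd_iff (i j : Fin n) (P : MvPolynomial (Fin n) A) :
    X i - X j ∣ P ↔ wall i j P = 0 := by
  constructor
  · rintro ⟨q, rfl⟩
    by_cases h : j = i
    · subst h; simp
    · rw [map_mul, map_sub, wall_X_left, wall_X_of_ne j h, sub_self, zero_mul]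
  · intro h
    simpa [h] using X_sub_X_dvd_sub_wall i j P

variable [IsDomain A]

theorem X_sub_X_ne_zero {i j : Fin n} (h : i ≠ j) : (X i - X j : MvPolynomial (Fin n) A) ≠ 0 := by
  rw [sub_ne_zero]; exact fun e => h (X_injective e)

theorem prime_X_sub_X {i j : Fin n} (h : i ≠ j) : Prime (X i - X j : MvPolynomial (Fin n) A) := by
  refine ⟨X_sub_X_ne_zero h, ?_, ?_⟩
  · intro hu
    have h1 : (X i - X j : MvPolynomial (Fin n) A) ∣ 1 := hu.dvd
    rw [X_sub_X_dvd_iff, map_one] at h1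
    exact one_ne_zero h1
  · intro p q hpq
    rw [X_sub_X_dvd_iff, map_mul, mul_eq_zero] at hpq
    rwa [X_sub_X_dvd_iff, X_sub_X_dvd_iff]

/-- The substitution X_i ↦ X_j identifies X_k with X_l, k ≠ l, only when {k, l} = {i, j}; the
orderings i < j and k < l then force equal pairs. -/
theorem not_X_sub_X_dvd {p q : Fin n × Fin n} (hp : p ∈ pairs n) (hq : q ∈ pairs n) (h : p ≠ q) :
    ¬ (X p.1 - X p.2 ∣ (X q.1 - X q.2 : MvPolynomial (Fin n) A)) := by
  obtain ⟨i, j⟩ := p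
  obtain ⟨k, l⟩ := q
  rw [mem_pairs] at hp hq
  simp only at hp hq ⊢
  rw [X_sub_X_dvd_iff, map_sub, sub_eq_zero, wall, rename_X, rename_X]
  intro e
  have e := X_injective e
  simp only [Function.update_apply, id] at e
  apply h
  split_ifs at e with h1 h2 h2 <;> (simp_all; try omega)

/-- The factors are primes none of which divides another, so they can be split off one at a time;
unique factorization in the coefficient ring is not needed. -/
theorem prod_X_sub_X_dvd {P : MvPolynomial (Fin n) A} (s : Finset (Fin n × Fin n))
    (hs : s ⊆ pairs n) (h : ∀ p ∈ s, X p.1 - X p.2 ∣ P) :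
    ∏ p ∈ s, (X p.1 - X p.2) ∣ P := by
  induction s using Finset.induction_on with
  | empty => simp
  | insert p s hps ih =>
    obtain ⟨G, hG⟩ := ih (fun q hq => hs (Finset.mem_insert_of_mem hq))
      (fun q hq => h q (Finset.mem_insert_of_mem hq))
    have hp : p ∈ pairs n := hs (Finset.mem_insert_self _ _)
    have hpr := prime_X_sub_X (A := A) (mem_pairs.1 hp).ne
    have h1 := h p (Finset.mem_insert_self _ _)
    rw [hG] at h1
    rcases hpr.dvd_or_dvd h1 with h2 | h2
    · obtain ⟨q, hq, hd⟩ := (Prime.dvd_finsetProd_iff hpr _).1 h2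
      exact absurd hd (not_X_sub_X_dvd hp (hs (Finset.mem_insert_of_mem hq))
        (fun e => hps (e ▸ hq)))
    · rw [Finset.prod_insert hps, hG, mul_comm]
      exact mul_dvd_mul_left _ h2

theorem vdm_X_dvd {P : MvPolynomial (Fin n) A} (h : ∀ p ∈ pairs n, X p.1 - X p.2 ∣ P) :
    vdm X ∣ P := by
  rw [vdm_eq]; exact prod_X_sub_X_dvd _ subset_rfl h

theorem not_X_sub_X_dvd_vdmErase {p : Fin n × Fin n} (hp : p ∈ pairs n) :
    ¬ (X p.1 - X p.2 ∣ (vdmErase X p : MvPolynomial (Fin n) A)) := by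
  intro h
  obtain ⟨q, hq, hd⟩ := (Prime.dvd_finsetProd_iff
    (prime_X_sub_X (A := A) (mem_pairs.1 hp).ne) _).1 h
  rw [Finset.mem_erase] at hq
  exact not_X_sub_X_dvd hp hq.2 hq.1.symm hd

omit [IsDomain A] in
theorem X_sub_X_dvd_vdmErase {p q : Fin n × Fin n} (hp : p ∈ pairs n) (h : p ≠ q) :
    X p.1 - X p.2 ∣ (vdmErase X q : MvPolynomial (Fin n) A) :=
  Finset.dvd_prod_of_mem (fun r : Fin n × Fin n => (X r.1 - X r.2 : MvPolynomial (Fin n) A))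
    (Finset.mem_erase.2 ⟨h, hp⟩)

end Wall

/-! ### Degree bounds -/

section Degree
variable {n : ℕ} {A : Type*} [CommRing A]

theorem isHomogeneous_X_sub_X (i j : Fin n) :
    (X i - X j : MvPolynomial (Fin n) A).IsHomogeneous 1 :=
  (isHomogeneous_X _ _).sub (isHomogeneous_X _ _)

theorem isHomogeneous_vdm : (vdm X : MvPolynomial (Fin n) A).IsHomogeneous (n.choose 2) := by
  rw [vdm_eq, ← card_pairs, Finset.card_eq_sum_ones]
  exact IsHomogeneous.prod _ _ _ fun p _ => isHomogeneous_X_sub_X _ _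

theorem isHomogeneous_vdmErase {p : Fin n × Fin n} (hp : p ∈ pairs n) :
    (vdmErase X p : MvPolynomial (Fin n) A).IsHomogeneous (n.choose 2 - 1) := by
  rw [vdmErase, ← card_pairs, ← Finset.card_erase_of_mem hp, Finset.card_eq_sum_ones]
  exact IsHomogeneous.prod _ _ _ fun p _ => isHomogeneous_X_sub_X _ _

theorem vdm_X_ne_zero [IsDomain A] : (vdm X : MvPolynomial (Fin n) A) ≠ 0 :=
  (vdm_ne_zero_iff _).2 X_injective

theorem totalDegree_le_iff_coeff {d : ℕ} {P : MvPolynomial (Fin n) A} :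
    P.totalDegree ≤ d ↔ ∀ m : Fin n →₀ ℕ, d < m.degree → P.coeff m = 0 := by
  rw [MvPolynomial.totalDegree, Finset.sup_le_iff]
  constructor
  · intro h m hm
    by_contra h0
    exact absurd (h m (mem_support_iff.2 h0)) (not_le.2 hm)
  · intro h m hm
    by_contra h0
    exact mem_support_iff.1 hm (h m (not_le.1 h0))

theorem totalDegree_pderiv_le {d : ℕ} (i : Fin n) {P : MvPolynomial (Fin n) A}
    (h : P.totalDegree ≤ d + 1) : (pderiv i P).totalDegree ≤ d := by
  rw [totalDegree_le_iff_coeff] at h ⊢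
  intro m hm
  rw [coeff_pderiv, h _ (by simpa using hm), zero_mul]

theorem homogeneousComponent_pderiv_eq_zero {d : ℕ} (i : Fin n) {P : MvPolynomial (Fin n) A}
    (h : P.totalDegree ≤ d) : homogeneousComponent d (pderiv i P) = 0 := by
  rw [totalDegree_le_iff_coeff] at h
  ext m
  rw [coeff_homogeneousComponent]
  split_ifs with hm
  · rw [coeff_pderiv, h _ (by simp [hm]), zero_mul, coeff_zero]
  · rw [coeff_zero]

theorem totalDegree_sub_le {d : ℕ} {P Q : MvPolynomial (Fin n) A} (hP : P.totalDegree ≤ d)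
    (hQ : Q.totalDegree ≤ d) : (P - Q).totalDegree ≤ d :=
  (totalDegree_sub _ _).trans (max_le hP hQ)

theorem totalDegree_add_le {d : ℕ} {P Q : MvPolynomial (Fin n) A} (hP : P.totalDegree ≤ d)
    (hQ : Q.totalDegree ≤ d) : (P + Q).totalDegree ≤ d :=
  (totalDegree_add _ _).trans (max_le hP hQ)

theorem totalDegree_C_mul_le {d : ℕ} {P : MvPolynomial (Fin n) A} (c : A)
    (hP : P.totalDegree ≤ d) : (C c * P).totalDegree ≤ d := by
  refine (totalDegree_mul _ _).trans ?_
  rwa [totalDegree_C, zero_add]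

theorem totalDegree_sum_le {ι : Type*} {d : ℕ} {s : Finset ι} {f : ι → MvPolynomial (Fin n) A}
    (h : ∀ i ∈ s, (f i).totalDegree ≤ d) : (∑ i ∈ s, f i).totalDegree ≤ d :=
  (totalDegree_finsetSum _ _).trans (Finset.sup_le h)

theorem totalDegree_le_of_X_sub_X_mul [IsDomain A] {d : ℕ} {i j : Fin n} (hij : i ≠ j)
    {P : MvPolynomial (Fin n) A} (h : ((X i - X j) * P).totalDegree ≤ d + 1) :
    P.totalDegree ≤ d := by
  by_cases hP : P = 0
  · simp [hP]
  rw [totalDegree_mul_of_isDomain (X_sub_X_ne_zero hij) hP,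
    (isHomogeneous_X_sub_X i j).totalDegree (X_sub_X_ne_zero hij)] at h
  omega

end Degree

/-! ### Twisted derivatives and quasi-invariant polynomials -/

section Twist
variable {n : ℕ} {A : Type*} [CommRing A] (a : Fin n → A)

/-- The derivative `∂_i + a_i`, that is `∂_i` conjugated by `exp (∑ a_k X_k)`. -/
def twist (i : Fin n) : MvPolynomial (Fin n) A →ₗ[A] MvPolynomial (Fin n) A :=
  (pderiv i).toLinearMap + LinearMap.mulLeft A (C (a i))

theorem twist_apply (i : Fin n) (P : MvPolynomial (Fin n) A) :
    twist a i P = pderiv i P + C (a i) * P := rfl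

theorem pderiv_comm (i j : Fin n) (P : MvPolynomial (Fin n) A) :
    pderiv i (pderiv j P) = pderiv j (pderiv i P) := by
  ext m
  simp only [coeff_pderiv]
  rw [add_right_comm]
  by_cases h : i = j
  · subst h; rfl
  · simp [h, Ne.symm h]; ring

theorem twist_comm (i j : Fin n) (P : MvPolynomial (Fin n) A) :
    twist a i (twist a j P) = twist a j (twist a i P) := by
  simp only [twist_apply, map_add, Derivation.leibniz, pderiv_C, smul_eq_mul, pderiv_comm i j]
  ring

theorem twist_mul (i : Fin n) (f g : MvPolynomial (Fin n) A) :
    twist a i (f * g) = pderiv i f * g + f * twist a i g := by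
  simp only [twist_apply, Derivation.leibniz, smul_eq_mul]
  ring

/-- The twisted derivative along `e_i - e_j`. -/
def twistSub (i j : Fin n) : MvPolynomial (Fin n) A →ₗ[A] MvPolynomial (Fin n) A :=
  twist a i - twist a j

theorem twistSub_apply (i j : Fin n) (P : MvPolynomial (Fin n) A) :
    twistSub a i j P = twist a i P - twist a j P := rfl

theorem twistSub_eq (i j : Fin n) (P : MvPolynomial (Fin n) A) :
    twistSub a i j P = pderiv i P - pderiv j P + C (a i - a j) * P := by
  rw [twistSub_apply, twist_apply, twist_apply, map_sub]; ring

theorem twistSub_mul (i j : Fin n) (f g : MvPolynomial (Fin n) A) :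
    twistSub a i j (f * g) = (pderiv i f - pderiv j f) * g + f * twistSub a i j g := by
  rw [twistSub_apply, twistSub_apply, twist_mul, twist_mul]; ring

theorem twistSub_twist_comm (i j k : Fin n) (P : MvPolynomial (Fin n) A) :
    twistSub a i j (twist a k P) = twist a k (twistSub a i j P) := by
  rw [twistSub_apply, twistSub_apply, map_sub, twist_comm a i k, twist_comm a j k]

theorem twistSub_comm (i j k l : Fin n) (P : MvPolynomial (Fin n) A) :
    twistSub a i j (twistSub a k l P) = twistSub a k l (twistSub a i j P) := by
  rw [twistSub_apply a k l, map_sub, twistSub_twist_comm, twistSub_twist_comm, ← twistSub_apply]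

theorem twistSub_swap (i j : Fin n) (P : MvPolynomial (Fin n) A) :
    twistSub a j i P = - twistSub a i j P := by
  rw [twistSub_apply, twistSub_apply, neg_sub]

/-- `P` is quasi-invariant with spectral parameter `a` if the derivative of `P exp (∑ a_k X_k)`
along `e_i - e_j` vanishes on the hyperplane `X_i = X_j`. -/
def QuasiInvariant (P : MvPolynomial (Fin n) A) : Prop :=
  ∀ i j, X i - X j ∣ twistSub a i j P

variable {a}

theorem QuasiInvariant.sub {P Q : MvPolynomial (Fin n) A} (hP : QuasiInvariant a P)
    (hQ : QuasiInvariant a Q) : QuasiInvariant a (P - Q) := fun i j => by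
  rw [map_sub]; exact dvd_sub (hP i j) (hQ i j)

theorem QuasiInvariant.smul {P : MvPolynomial (Fin n) A} (hP : QuasiInvariant a P) (c : A) :
    QuasiInvariant a (c • P) := fun i j => by
  rw [map_smul, smul_eq_C_mul]; exact (hP i j).mul_left _

theorem QuasiInvariant.of_pairs {P : MvPolynomial (Fin n) A}
    (h : ∀ p ∈ pairs n, X p.1 - X p.2 ∣ twistSub a p.1 p.2 P) : QuasiInvariant a P := by
  intro i j
  rcases lt_trichotomy i j with hl | hl | hl
  · exact h (i, j) (mem_pairs.2 hl)
  · subst hl; simp [twistSub_apply]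
  · have := h (j, i) (mem_pairs.2 hl)
    rw [twistSub_swap, dvd_neg, ← neg_sub, neg_dvd]
    exact this

/-- A double zero on each wall kills the first derivative there, whatever the spectral parameter.
This is the seed of Berest's iteration. -/
theorem quasiInvariant_vdm_sq : QuasiInvariant a (vdm X ^ 2) := by
  refine .of_pairs fun p hp => ?_
  have hd : (X p.1 - X p.2 : MvPolynomial (Fin n) A) ∣ vdm X := ⟨_, (mul_vdmErase X hp).symm⟩
  rw [pow_two, twistSub_mul]
  refine dvd_add (hd.mul_left _) (hd.mul_right _)

variable [IsDomain A]

/-- Derivatives lower the degree, so the degree d part of `twistSub a i j P` is (a_i - a_j) times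
that of P. Restriction to the wall preserves degree, hence the degree d part of P vanishes on every
wall. -/
theorem QuasiInvariant.vdm_dvd_homogeneousComponent (ha : Function.Injective a)
    {P : MvPolynomial (Fin n) A} (hP : QuasiInvariant a P) {d : ℕ} (hd : P.totalDegree ≤ d) :
    vdm X ∣ homogeneousComponent d P := by
  refine vdm_X_dvd fun p hp => ?_
  have h := (X_sub_X_dvd_iff _ _ _).1 (hP p.1 p.2)
  have h2 := congrArg (homogeneousComponent d) h
  rw [wall, ← rename_homogeneousComponent, twistSub_eq, map_add, map_sub,
    homogeneousComponent_pderiv_eq_zero _ hd, homogeneousComponent_pderiv_eq_zero _ hd, sub_zero,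
    zero_add, homogeneousComponent_C_mul, map_mul, map_zero, rename_C, mul_eq_zero] at h2
  rw [X_sub_X_dvd_iff]
  refine h2.resolve_left ?_
  rw [C_eq_zero, sub_eq_zero]
  exact fun e => (mem_pairs.1 hp).ne (ha e)

/-- The leading form is a multiple of `vdm X`, so it is zero or of degree at least N. This is the
rigidity used for every later identity between Baker-Akhiezer functions. -/
theorem QuasiInvariant.eq_zero (ha : Function.Injective a)
    {P : MvPolynomial (Fin n) A} (hP : QuasiInvariant a P) (hd : P.totalDegree < n.choose 2) :
    P = 0 := by
  obtain ⟨Q, hQ⟩ := hP.vdm_dvd_homogeneousComponent ha le_rfl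
  have hH : homogeneousComponent P.totalDegree P = 0 := by
    by_contra h
    have hQ0 : Q ≠ 0 := by rintro rfl; simp at hQ; exact h hQ
    have h1 := (homogeneousComponent_isHomogeneous P.totalDegree P).totalDegree h
    rw [hQ, totalDegree_mul_of_isDomain vdm_X_ne_zero hQ0,
      isHomogeneous_vdm.totalDegree vdm_X_ne_zero] at h1
    omega
  by_contra h0
  obtain ⟨m, hm, hdeg⟩ := Finset.exists_mem_eq_sup P.support (by simpa using h0)
    (fun m => m.sum fun _ e => e)
  have := congrArg (coeff m) hH
  rw [coeff_homogeneousComponent, if_pos, coeff_zero] at this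
  · exact mem_support_iff.1 hm this
  · exact hdeg.symm

end Twist

/-! ### A Calogero-Moser operator preserving quasi-invariance -/

section Berest
variable {n : ℕ} {A : Type*} [CommRing A] [IsDomain A] {a : Fin n → A}

/-- The quotient is symmetric because numerator and denominator are both antisymmetric. Its diagonal
values are unconstrained (0 = 0) and are set to zero. -/
theorem QuasiInvariant.exists_quotient {P : MvPolynomial (Fin n) A} (hP : QuasiInvariant a P) :
    ∃ q : Fin n → Fin n → MvPolynomial (Fin n) A,
      (∀ i j, (X i - X j) * q i j = twistSub a i j P) ∧ (∀ i j, q i j = q j i) ∧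
      (∀ i, q i i = 0) := by
  choose q hq using fun i j => hP i j
  refine ⟨fun i j => if i = j then 0 else q i j, ?_, ?_, ?_⟩
  · intro i j
    by_cases h : i = j
    · subst h; simp [twistSub_apply]
    · simp [h, hq]
  · intro i j
    by_cases h : i = j
    · subst h; simp
    · simp only [h, Ne.symm h, if_false]
      apply mul_left_cancel₀ (X_sub_X_ne_zero (A := A) h)
      rw [← hq i j, ← neg_sub, neg_mul, ← hq j i, twistSub_swap a i j, neg_neg]
  · intro i; simp

omit [IsDomain A] in
theorem wall_eq_wall (i j : Fin n) : wall i j (X i : MvPolynomial (Fin n) A) = wall i j (X j) := by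
  have h := (X_sub_X_dvd_iff (A := A) i j (X i - X j)).1 dvd_rfl
  rwa [map_sub, sub_eq_zero] at h

/-- On P exp(∑ a_k X_k) this is the operator ∑ ∂_k² - ∑_{k<l} 2/(X_k - X_l) (∂_k - ∂_l) - c. Let T k
l be the restriction to the wall X_i = X_j of the twisted derivative, along e_i - e_j, of `q k l`.
The Laplacian contributes 2 T i j. In the sum over ordered pairs the terms disjoint from {i, j}
vanish, those sharing one index cancel in pairs, and 2 T i j is left, which cancels the Laplacian.
-/
theorem quasiInvariant_berest {P : MvPolynomial (Fin n) A}
    {q : Fin n → Fin n → MvPolynomial (Fin n) A}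
    (hq : ∀ i j, (X i - X j) * q i j = twistSub a i j P) (hsym : ∀ i j, q i j = q j i)
    (h0 : ∀ i, q i i = 0) (c : A) :
    QuasiInvariant a (∑ k, twist a k (twist a k P) - C c * P - ∑ k, ∑ l, q k l) := by
  classical
  intro i j
  by_cases hij : i = j
  · subst hij; simp [twistSub_apply]
  rw [X_sub_X_dvd_iff]
  set W : MvPolynomial (Fin n) A →ₐ[A] MvPolynomial (Fin n) A := wall i j with hW
  have hWX : W (X i) = W (X j) := wall_eq_wall i j
  have hWne : ∀ k l, k ≠ l → ({k, l} : Finset (Fin n)) ≠ {i, j} → W (X k - X l) ≠ 0 := by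
    intro k l hkl hs h
    rw [map_sub, sub_eq_zero, hW, wall, rename_X, rename_X] at h
    have e := X_injective h
    simp only [Function.update_apply, id] at e
    split_ifs at e with h1 h2 h2
    · exact hkl (h1.trans h2.symm)
    · subst h1; subst e; exact hs rfl
    · subst h2; subst e; exact hs (Finset.pair_comm _ _)
    · exact hkl e
  have hpd : ∀ k : Fin n, pderiv k (X i - X j : MvPolynomial (Fin n) A) =
      C (Pi.single (M := fun _ => A) i 1 k - Pi.single (M := fun _ => A) j 1 k) := by
    intro k
    rw [map_sub, pderiv_X, pderiv_X]
    simp only [Pi.single_apply, map_sub, apply_ite (C : A →+* MvPolynomial (Fin n) A), map_one,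
      map_zero]
    simp only [eq_comm]
  -- values on the wall
  have hP0 : W (twistSub a i j P) = 0 := by rw [← hq, map_mul, map_sub, hWX, sub_self, zero_mul]
  -- Both twisted derivatives commute past `twistSub a i j` and act on (X_i - X_j) q i j. On the
  -- wall only the two cross terms survive, where exactly one of them hits the linear factor.
  have hmain : ∀ k, W (twistSub a i j (twist a k (twist a k P))) =
      2 * C (Pi.single (M := fun _ => A) i 1 k - Pi.single (M := fun _ => A) j 1 k) *
        W (twist a k (q i j)) := by
    intro k
    rw [twistSub_twist_comm, twistSub_twist_comm, ← hq, twist_mul, map_add, hpd, twist_mul,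
      twist_mul, hpd, pderiv_C]
    simp only [map_add, map_mul, map_sub, hWX, sub_self, zero_mul, zero_add, add_zero]
    rw [hW]
    simp only [wall, rename_C]
    ring
  have hsum : ∑ k, W (twistSub a i j (twist a k (twist a k P))) =
      2 * W (twistSub a i j (q i j)) := by
    simp only [hmain, map_sub, mul_sub, sub_mul, Finset.sum_sub_distrib]
    simp only [Pi.single_apply, apply_ite (C : A →+* MvPolynomial (Fin n) A), map_one, map_zero,
      mul_ite, ite_mul, mul_one, mul_zero, zero_mul, Finset.sum_ite_eq', Finset.mem_univ, if_true]
    rw [twistSub_apply, map_sub]; ring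
  set T : Fin n → Fin n → MvPolynomial (Fin n) A := fun k l => W (twistSub a i j (q k l)) with hT
  have hTsym : ∀ k l, T k l = T l k := fun k l => by simp only [hT]; rw [hsym]
  have hT0 : ∀ k, T k k = 0 := fun k => by simp [hT, h0]
  have hpd2 : ∀ k l : Fin n, k ≠ i → k ≠ j → l ≠ i → l ≠ j →
      pderiv i (X k - X l : MvPolynomial (Fin n) A) = 0 ∧
      pderiv j (X k - X l : MvPolynomial (Fin n) A) = 0 := by
    intro k l h1 h2 h3 h4
    simp [pderiv_X_of_ne h1, pderiv_X_of_ne h2, pderiv_X_of_ne h3, pderiv_X_of_ne h4]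
  -- Commuting the two twisted differences gives (X_k - X_l) T k l = 0 on the wall, since the
  -- derivative along e_k - e_l does not see X_i - X_j.
  have hfar : ∀ k l, k ≠ i → k ≠ j → l ≠ i → l ≠ j → T k l = 0 := by
    intro k l h1 h2 h3 h4
    by_cases hkl : k = l
    · subst hkl; exact hT0 k
    have e : twistSub a i j ((X k - X l) * q k l) = twistSub a k l ((X i - X j) * q i j) := by
      rw [hq, hq, twistSub_comm]
    rw [twistSub_mul, twistSub_mul, (hpd2 k l h1 h2 h3 h4).1, (hpd2 k l h1 h2 h3 h4).2] at e
    have e1 : pderiv k (X i - X j : MvPolynomial (Fin n) A) = 0 := by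
      simp [pderiv_X_of_ne (Ne.symm h1), pderiv_X_of_ne (Ne.symm h2)]
    have e2 : pderiv l (X i - X j : MvPolynomial (Fin n) A) = 0 := by
      simp [pderiv_X_of_ne (Ne.symm h3), pderiv_X_of_ne (Ne.symm h4)]
    rw [e1, e2] at e
    have e3 := congrArg W e
    simp only [map_mul, map_sub, hWX, sub_self, zero_mul, zero_add] at e3
    rw [← map_sub] at e3
    refine (mul_eq_zero.1 e3).resolve_left (hWne k l hkl ?_)
    intro hs
    have : k ∈ ({i, j} : Finset (Fin n)) := hs ▸ Finset.mem_insert_self _ _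
    simp [h1, h2] at this
  have hnear : ∀ m, m ≠ i → m ≠ j → T i m + T j m = 0 := by
    intro m h1 h2
    have e1 : twistSub a i j ((X i - X m) * q i m) = twistSub a i m ((X i - X j) * q i j) := by
      rw [hq, hq, twistSub_comm]
    have e2 : twistSub a i j ((X j - X m) * q j m) = twistSub a j m ((X i - X j) * q i j) := by
      rw [hq, hq, twistSub_comm]
    -- The twisted differences satisfy D_im - D_jm = D_ij; restricted to the wall this gives q i m =
    -- q j m there.
    have e3 : (X i - X m) * q i m - (X j - X m) * q j m = (X i - X j) * q i j := by
      rw [hq, hq, hq]; simp only [twistSub_apply]; ring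
    rw [twistSub_mul, twistSub_mul] at e1 e2
    simp only [map_sub, pderiv_X_self, pderiv_X_of_ne hij, pderiv_X_of_ne (Ne.symm hij),
      pderiv_X_of_ne h1, pderiv_X_of_ne h2, pderiv_X_of_ne (Ne.symm h1),
      pderiv_X_of_ne (Ne.symm h2), sub_zero, zero_sub, one_mul] at e1 e2
    have f1 := congrArg W e1
    have f2 := congrArg W e2
    have f3 := congrArg W e3
    simp only [map_add, map_mul, map_sub, map_neg, hWX, sub_self, zero_mul, add_zero,
      one_mul, neg_mul] at f1 f2 f3
    have hne : W (X j) - W (X m) ≠ 0 := by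
      rw [← map_sub]
      refine hWne j m (Ne.symm h2) ?_
      intro hs
      have : i ∈ ({j, m} : Finset (Fin n)) := hs ▸ Finset.mem_insert_self _ _
      simp [hij, Ne.symm h1] at this
    apply (mul_eq_zero.1 (show (W (X j) - W (X m)) * _ = 0 from ?_)).resolve_left hne
    have f4 : W (q i m) - W (q j m) = 0 := by
      apply (mul_eq_zero.1 (show (W (X j) - W (X m)) * _ = 0 from ?_)).resolve_left hne
      linear_combination f3
    simp only [hT]
    linear_combination f1 + f2 - f4
  have hTT : ∑ k, ∑ l, T k l = 2 * T i j := by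
    have hrow : ∀ k, k ≠ i → k ≠ j → ∑ l, T k l = 0 := by
      intro k h1 h2
      rw [← Finset.add_sum_erase _ _ (Finset.mem_univ i),
        ← Finset.add_sum_erase _ _ (Finset.mem_erase.2 ⟨Ne.symm hij, Finset.mem_univ j⟩),
        ← add_assoc, hTsym k i, hTsym k j, hnear k h1 h2, zero_add]
      refine Finset.sum_eq_zero fun l hl => ?_
      simp only [Finset.mem_erase] at hl
      exact hfar k l h1 h2 hl.2.1 hl.1
    have hij2 : ∑ l, (T i l + T j l) = 2 * T i j := by
      rw [← Finset.add_sum_erase _ _ (Finset.mem_univ i),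
        ← Finset.add_sum_erase _ _ (Finset.mem_erase.2 ⟨Ne.symm hij, Finset.mem_univ j⟩),
        Finset.sum_eq_zero, hT0, hT0, hTsym j i]
      · ring
      · intro l hl
        simp only [Finset.mem_erase] at hl
        exact hnear l hl.2.1 hl.1
    rw [← Finset.add_sum_erase _ _ (Finset.mem_univ i),
        ← Finset.add_sum_erase _ _ (Finset.mem_erase.2 ⟨Ne.symm hij, Finset.mem_univ j⟩),
        ← add_assoc, ← Finset.sum_add_distrib, hij2, Finset.sum_eq_zero, add_zero]
    intro k hk
    simp only [Finset.mem_erase] at hk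
    exact hrow k hk.2.1 hk.1
  rw [map_sub, map_sub, map_sub, map_sub, map_sum, map_sum, hsum]
  have hc : W (twistSub a i j (C c * P)) = 0 := by
    rw [twistSub_mul]; simp [hP0]
  rw [hc]
  simp only [map_sum]
  rw [show ∑ k, ∑ l, W (twistSub a i j (q k l)) = 2 * T i j from hTT]
  simp [hT]

end Berest

/-! ### Iterated derivations of products of linear forms -/

section Iterate
variable {S R : Type*} [CommRing S] [CommRing R] [Algebra S R] (D : Derivation S R R)

theorem iterate_derivation_mul {f c : R} (hf : D f = c) (hc : D c = 0) (g : R) (m : ℕ) :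
    D^[m + 1] (f * g) = f * D^[m + 1] g + (m + 1) * (c * D^[m] g) := by
  induction m with
  | zero => simp [hf]; ring
  | succ m ih =>
    rw [Function.iterate_succ_apply', ih, map_add, D.leibniz, D.leibniz (m + 1 : R) _, D.leibniz c,
      hf, hc, ← Function.iterate_succ_apply' D, ← Function.iterate_succ_apply' D]
    have : D ((m : R) + 1) = 0 := by exact_mod_cast D.map_natCast (m + 1)
    rw [this]
    simp only [smul_eq_mul]
    push_cast
    ring

/-- Each factor is killed by two derivations, so with as many derivations as factors each factor is
hit exactly once, in any of the factorially many orders; one more derivation gives zero. -/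
theorem iterate_derivation_prod {ι : Type*} (s : Finset ι) (f c : ι → R) (hf : ∀ i, D (f i) = c i)
    (hc : ∀ i, D (c i) = 0) :
    D^[s.card] (∏ i ∈ s, f i) = s.card.factorial * ∏ i ∈ s, c i ∧
      D^[s.card + 1] (∏ i ∈ s, f i) = 0 := by
  classical
  induction s using Finset.induction_on with
  | empty => simp
  | insert i s hi ih =>
    rw [Finset.card_insert_of_notMem hi, Finset.prod_insert hi, Finset.prod_insert hi,
      iterate_derivation_mul D (hf i) (hc i), iterate_derivation_mul D (hf i) (hc i), ih.1, ih.2,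
      Function.iterate_succ_apply' D, ih.2, map_zero, Nat.factorial_succ]
    push_cast
    constructor <;> ring

theorem derivation_prod {ι : Type*} [DecidableEq ι] (s : Finset ι) (f : ι → R) :
    D (∏ i ∈ s, f i) = ∑ i ∈ s, D (f i) * ∏ j ∈ s.erase i, f j := by
  induction s using Finset.induction_on with
  | empty => simp
  | insert i s hi ih =>
    rw [Finset.prod_insert hi, Finset.sum_insert hi, D.leibniz, ih, Finset.erase_insert hi,
      smul_eq_mul, smul_eq_mul, add_comm, mul_comm, Finset.mul_sum]
    congr 1
    refine Finset.sum_congr rfl fun j hj => ?_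
    have hij : i ≠ j := fun h => hi (h ▸ hj)
    rw [Finset.erase_insert_of_ne hij, Finset.prod_insert (fun h => hi (Finset.mem_of_mem_erase h))]
    ring

end Iterate

/-! ### Berest's formula -/

section Berest
variable {n : ℕ} {A : Type*} [CommRing A] (a : Fin n → A)

/-- The directional derivative `∑ a_k ∂_k`. -/
def dirDeriv : Derivation A (MvPolynomial (Fin n) A) (MvPolynomial (Fin n) A) :=
  ∑ k, a k • pderiv k

theorem dirDeriv_apply (P : MvPolynomial (Fin n) A) :
    dirDeriv a P = ∑ k, C (a k) * pderiv k P := by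
  have h := congrFun (map_sum (Derivation.coeFnAddMonoidHom (R := A) (A := MvPolynomial (Fin n) A)
    (M := MvPolynomial (Fin n) A)) (fun k => a k • pderiv k) univ) P
  rw [Finset.sum_apply] at h
  refine h.trans (Finset.sum_congr rfl fun k _ => ?_)
  rw [← smul_eq_C_mul]; rfl

theorem dirDeriv_X (i : Fin n) : dirDeriv a (X i) = C (a i) := by
  classical
  rw [dirDeriv_apply]
  simp [pderiv_X, Pi.single_apply]

theorem dirDeriv_vdm : dirDeriv a (vdm X) =
    ∑ p ∈ pairs n, C (a p.1 - a p.2) * vdmErase X p := by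
  rw [vdm_eq, derivation_prod]
  refine Finset.sum_congr rfl fun p _ => ?_
  rw [map_sub, dirDeriv_X, dirDeriv_X, ← map_sub, vdmErase]

theorem iterate_dirDeriv_vdm :
    (dirDeriv a)^[n.choose 2] (vdm X) = C (((n.choose 2).factorial : A) * vdm a) := by
  have h := (iterate_derivation_prod (dirDeriv a) (pairs n)
    (fun p => (X p.1 - X p.2 : MvPolynomial (Fin n) A)) (fun p => C (a p.1 - a p.2))
    (fun p => by simp [dirDeriv_X]) (fun p => by
      have : ∀ x : A, dirDeriv a (C x) = 0 := fun x => (dirDeriv a).map_algebraMap x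
      exact this _)).1
  rw [card_pairs, ← vdm_eq] at h
  rw [h, vdm_eq, map_mul, map_prod, map_natCast]

theorem totalDegree_dirDeriv_le {d : ℕ} {P : MvPolynomial (Fin n) A}
    (h : P.totalDegree ≤ d + 1) : (dirDeriv a P).totalDegree ≤ d := by
  rw [dirDeriv_apply]
  exact totalDegree_sum_le fun k _ => totalDegree_C_mul_le _ (totalDegree_pderiv_le k h)

theorem totalDegree_iterate_dirDeriv_vdm {m e : ℕ} (h : m + e = n.choose 2) :
    ((dirDeriv a)^[m] (vdm X)).totalDegree ≤ e := by
  induction m generalizing e with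
  | zero =>
    rw [zero_add] at h
    exact h ▸ (isHomogeneous_vdm (A := A) (n := n)).totalDegree_le
  | succ m ih =>
    rw [Function.iterate_succ_apply']
    exact totalDegree_dirDeriv_le a (ih (by omega))

variable {a} [IsDomain A]

/-- One step of Berest's formula. -/
theorem exists_berest_step {P U : MvPolynomial (Fin n) A} {d : ℕ} (hP : QuasiInvariant a P)
    (hU : (vdm X * U).totalDegree ≤ d + 2) (hW : (P - vdm X * U).totalDegree ≤ d + 1) :
    ∃ P', QuasiInvariant a P' ∧ (P' - vdm X * (2 * dirDeriv a U)).totalDegree ≤ d := by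
  obtain ⟨q, hq, hsym, h0⟩ := hP.exists_quotient
  -- The constant ∑ a_k² removes the terms of degree d + 2, those where both twisted derivatives act
  -- as multiplication by a_k.
  refine ⟨_, quasiInvariant_berest hq hsym h0 (∑ k, a k ^ 2), ?_⟩
  set W := P - vdm X * U with hWdef
  have hPW : P = vdm X * U + W := by rw [hWdef]; ring
  have hPd : P.totalDegree ≤ d + 2 := by
    rw [hPW]; exact totalDegree_add_le hU (hW.trans (by omega))
  -- To leading order `twistSub` multiplies vdm · U by a_i - a_j, and dividing by X_i - X_j replaces
  -- vdm by `vdmErase`. The error is bounded after multiplying back by X_i - X_j.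
  have hr : ∀ p ∈ pairs n,
      (q p.1 p.2 - C (a p.1 - a p.2) * vdmErase X p * U).totalDegree ≤ d := by
    intro p hp
    apply totalDegree_le_of_X_sub_X_mul (mem_pairs.1 hp).ne
    have e : (X p.1 - X p.2) * (q p.1 p.2 - C (a p.1 - a p.2) * vdmErase X p * U) =
        pderiv p.1 P - pderiv p.2 P + C (a p.1 - a p.2) * W := by
      rw [mul_sub, hq, twistSub_eq, hWdef, ← mul_vdmErase X hp]; ring
    rw [e]
    exact totalDegree_add_le (totalDegree_sub_le (totalDegree_pderiv_le _ hPd)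
      (totalDegree_pderiv_le _ hPd)) (totalDegree_C_mul_le _ hW)
  have hk : ∑ k, twist a k (twist a k P) - C (∑ k, a k ^ 2) * P =
      ∑ k, pderiv k (pderiv k P) + 2 * dirDeriv a P := by
    rw [dirDeriv_apply, map_sum, Finset.sum_mul, Finset.mul_sum, ← Finset.sum_sub_distrib,
      ← Finset.sum_add_distrib]
    refine Finset.sum_congr rfl fun k _ => ?_
    simp only [twist_apply, map_add, Derivation.leibniz, pderiv_C, smul_eq_mul, map_pow]
    ring
  -- In degree d + 1 the term 2 U ∂_a(vdm) of 2 ∂_a(vdm · U) cancels against the sum of the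
  -- quotients, leaving 2 vdm · ∂_a U.
  have e : ∑ k, twist a k (twist a k P) - C (∑ k, a k ^ 2) * P - ∑ k, ∑ l, q k l -
      vdm X * (2 * dirDeriv a U) = ∑ k, pderiv k (pderiv k P) + C 2 * dirDeriv a W -
      C 2 * ∑ p ∈ pairs n, (q p.1 p.2 - C (a p.1 - a p.2) * vdmErase X p * U) := by
    rw [hk, sum_sum_eq_two_mul_sum_pairs q hsym h0, Finset.sum_sub_distrib, ← Finset.sum_mul,
      ← dirDeriv_vdm, hPW]
    simp only [map_add, Derivation.leibniz, smul_eq_mul, map_ofNat]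
    ring
  rw [e]
  refine totalDegree_sub_le (totalDegree_add_le ?_ ?_) ?_
  · exact totalDegree_sum_le fun k _ => totalDegree_pderiv_le _ (totalDegree_pderiv_le _ hPd)
  · exact totalDegree_C_mul_le _ (totalDegree_dirDeriv_le a hW)
  · exact totalDegree_C_mul_le _ (totalDegree_sum_le hr)

/-- Iteration from vdm², of degree 2N. With N = K + 1, after m steps the main term has degree at
most N + e = K + e + 1, and the remainder lies one degree lower. -/
theorem exists_berest {K : ℕ} (hK : n.choose 2 = K + 1) (m e : ℕ) (h : m + e = n.choose 2) :
    ∃ P, QuasiInvariant a P ∧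
      (P - vdm X * (2 ^ m * (dirDeriv a)^[m] (vdm X))).totalDegree ≤ K + e := by
  induction m generalizing e with
  | zero => exact ⟨_, quasiInvariant_vdm_sq, by simp [pow_two]⟩
  | succ m ih =>
    obtain ⟨P, hP, hd⟩ := ih (e + 1) (by omega)
    have hU : (vdm X * (2 ^ m * (dirDeriv a)^[m] (vdm X)) : MvPolynomial (Fin n) A).totalDegree
        ≤ K + e + 2 := by
      refine (totalDegree_mul _ _).trans ?_
      have h1 := (isHomogeneous_vdm (A := A) (n := n)).totalDegree_le
      have h2 : ((2 ^ m * (dirDeriv a)^[m] (vdm X) : MvPolynomial (Fin n) A)).totalDegree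
          ≤ e + 1 := by
        have := totalDegree_C_mul_le (2 ^ m : A)
          (totalDegree_iterate_dirDeriv_vdm a (m := m) (e := e + 1) (by omega))
        rwa [map_pow, map_ofNat] at this
      omega
    obtain ⟨P', hP', hd'⟩ := exists_berest_step (d := K + e) hP hU hd
    refine ⟨P', hP', ?_⟩
    have e1 : dirDeriv a (2 ^ m : MvPolynomial (Fin n) A) = 0 := by
      exact_mod_cast (dirDeriv a).map_natCast (2 ^ m)
    rw [Derivation.leibniz, e1, smul_zero, add_zero, smul_eq_mul, ← mul_assoc 2, ← pow_succ',
      ← Function.iterate_succ_apply' (dirDeriv a)] at hd'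
    exact hd'

/-- After N steps the directional derivative has reduced one copy of vdm to the constant N! · vdm a,
and the other copy remains as leading form. -/
theorem exists_quasiInvariant (hn : 2 ≤ n) :
    ∃ P, QuasiInvariant a P ∧
      (P - C (2 ^ n.choose 2 * (n.choose 2).factorial * vdm a) * vdm X).totalDegree
        < n.choose 2 := by
  have hpos : 0 < n.choose 2 := Nat.choose_pos hn
  obtain ⟨K, hK⟩ : ∃ K, n.choose 2 = K + 1 := ⟨n.choose 2 - 1, by omega⟩
  obtain ⟨P, hP, hd⟩ := exists_berest (a := a) hK (n.choose 2) 0 rfl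
  refine ⟨P, hP, ?_⟩
  rw [iterate_dirDeriv_vdm] at hd
  have e : (vdm X : MvPolynomial (Fin n) A) * (2 ^ n.choose 2 * C (((n.choose 2).factorial : A) * vdm a)) =
      C (2 ^ n.choose 2 * (n.choose 2).factorial * vdm a) * vdm X := by
    simp only [map_mul, map_pow, map_ofNat]; ring
  rw [e] at hd
  omega

end Berest

/-! ### Change of coefficients and affine substitutions -/

section Map
variable {n : ℕ} {A B : Type*} [CommRing A] [CommRing B]

theorem QuasiInvariant.map {a : Fin n → A} {P : MvPolynomial (Fin n) A} (hP : QuasiInvariant a P)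
    (φ : A →+* B) : QuasiInvariant (fun i => φ (a i)) (MvPolynomial.map φ P) := by
  intro i j
  have h := map_dvd (MvPolynomial.map φ) (hP i j)
  rw [twistSub_eq] at h ⊢
  simpa [pderiv_map] using h

theorem totalDegree_map_eval_le (φ : A →+* B) (P : MvPolynomial (Fin n) A) :
    (MvPolynomial.map φ P).totalDegree ≤ P.totalDegree := by
  rw [totalDegree_le_iff_coeff]
  intro m hm
  rw [coeff_map, totalDegree_le_iff_coeff.1 le_rfl m hm, map_zero]

/-- The substitution `X_k ↦ c X_k + d`. -/
def affineSubst (c d : A) : MvPolynomial (Fin n) A →ₐ[A] MvPolynomial (Fin n) A :=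
  aeval fun k => C c * X k + C d

theorem affineSubst_X (c d : A) (k : Fin n) : affineSubst c d (X k) = C c * X k + C d := by
  simp [affineSubst]

theorem affineSubst_C (c d b : A) : affineSubst c d (C b : MvPolynomial (Fin n) A) = C b := by
  simp [affineSubst]

theorem affineSubst_X_sub_X (c d : A) (i j : Fin n) :
    affineSubst c d (X i - X j) = C c * (X i - X j) := by
  rw [map_sub, affineSubst_X, affineSubst_X]; ring

theorem affineSubst_vdm (c d : A) : affineSubst c d (vdm X : MvPolynomial (Fin n) A) =
    C (c ^ n.choose 2) * vdm X := by
  rw [vdm_eq, map_prod]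
  simp only [affineSubst_X_sub_X]
  rw [Finset.prod_mul_distrib, Finset.prod_const, card_pairs, map_pow]

theorem pderiv_affineSubst (c d : A) (i : Fin n) (P : MvPolynomial (Fin n) A) :
    pderiv i (affineSubst c d P) = C c * affineSubst c d (pderiv i P) := by
  classical
  induction P using MvPolynomial.induction_on with
  | C b => simp
  | add p q hp hq => simp only [map_add, hp, hq, mul_add]
  | mul_X p k hp =>
    simp only [map_mul, Derivation.leibniz, hp, smul_eq_mul, affineSubst_X, map_add, pderiv_C,
      pderiv_X, Pi.single_apply]
    split_ifs <;> simp <;> ring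

theorem twistSub_affineSubst (c d : A) (a : Fin n → A) (i j : Fin n)
    (P : MvPolynomial (Fin n) A) :
    twistSub (c • a) i j (affineSubst c d P) = C c * affineSubst c d (twistSub a i j P) := by
  simp only [twistSub_eq, pderiv_affineSubst, map_add, map_sub, map_mul, affineSubst_C,
    Pi.smul_apply, smul_eq_mul]
  ring

theorem totalDegree_affineSubst_le (c d : A) (P : MvPolynomial (Fin n) A) :
    (affineSubst c d P).totalDegree ≤ P.totalDegree := by
  rw [affineSubst, aeval_def, eval₂_eq]
  refine totalDegree_sum_le fun m hm => ?_
  refine totalDegree_C_mul_le _ ((totalDegree_finsetProd _ _).trans ?_)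
  refine le_trans (Finset.sum_le_sum fun i _ => ?_) (le_totalDegree hm)
  refine (totalDegree_pow _ _).trans ?_
  have : (C c * X i + C d : MvPolynomial (Fin n) A).totalDegree ≤ 1 := by
    refine totalDegree_add_le (totalDegree_C_mul_le _ ?_) (by simp)
    exact (isHomogeneous_X A i).totalDegree_le
  simpa using Nat.mul_le_mul_left (m i) this

theorem coeff_affineSubst_zero (c : A) (P : MvPolynomial (Fin n) A) (m : Fin n →₀ ℕ) :
    coeff m (affineSubst c 0 P) = c ^ m.degree * coeff m P := by
  induction P using MvPolynomial.induction_on' with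
  | add p q hp hq => rw [map_add, coeff_add, coeff_add, hp, hq, mul_add]
  | monomial u b =>
    have : affineSubst c 0 (monomial u b) = C (c ^ u.degree) * monomial u b := by
      rw [monomial_eq, map_mul, affineSubst_C, Finsupp.prod_fintype _ _ (by simp), map_prod]
      simp only [map_pow, affineSubst_X, map_zero, add_zero, mul_pow, Finset.prod_mul_distrib]
      rw [Finset.prod_pow_eq_pow_sum, Finsupp.degree_eq_sum]
      ring
    rw [this, coeff_C_mul, coeff_monomial]
    split_ifs with h
    · rw [h]
    · simp

theorem eval_affineSubst (c d : A) (x : Fin n → A) (P : MvPolynomial (Fin n) A) :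
    eval x (affineSubst c d P) = eval (fun k => c * x k + d) P := by
  induction P using MvPolynomial.induction_on with
  | C b => simp
  | add p q hp hq => simp only [map_add, hp, hq]
  | mul_X p k hp => simp [map_mul, hp, affineSubst_X]

end Map

/-! ### The Baker-Akhiezer function -/

section BakerAkhiezer
variable {n : ℕ}

/-- `B exp (∑ a_k X_k)` is the monic Baker-Akhiezer function with spectral parameter `a`. -/
structure IsBakerAkhiezer {A : Type*} [CommRing A] (a : Fin n → A) (B : MvPolynomial (Fin n) A) :
    Prop where
  quasiInvariant : QuasiInvariant a B
  leading : (B - vdm X).totalDegree < n.choose 2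

theorem IsBakerAkhiezer.unique {A : Type*} [CommRing A] [IsDomain A] {a : Fin n → A}
    (ha : Function.Injective a) {B B' : MvPolynomial (Fin n) A} (h : IsBakerAkhiezer a B)
    (h' : IsBakerAkhiezer a B') : B = B' := by
  have e : B - B' = (B - vdm X) - (B' - vdm X) := by ring
  refine sub_eq_zero.1 ((h.quasiInvariant.sub h'.quasiInvariant).eq_zero ha ?_)
  rw [e]
  exact (totalDegree_sub _ _).trans_lt (max_lt h.leading h'.leading)

/-- Substituting cX + d in B exp(∑ a_k X_k) replaces a by c a, up to a constant factor due to d.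
With uniqueness, the case d = 0 yields homogeneity and c = 1 yields translation invariance. -/
theorem IsBakerAkhiezer.affineSubst {a : Fin n → ℂ} {B : MvPolynomial (Fin n) ℂ}
    (h : IsBakerAkhiezer a B) {c : ℂ} (hc : c ≠ 0) (d : ℂ) :
    IsBakerAkhiezer (c • a) (C ((c ^ n.choose 2)⁻¹) * affineSubst c d B) := by
  have hcN : c ^ n.choose 2 ≠ 0 := pow_ne_zero _ hc
  constructor
  · intro i j
    rw [← smul_eq_C_mul, map_smul, smul_eq_C_mul, twistSub_affineSubst]
    refine Dvd.dvd.mul_left ?_ _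
    have := map_dvd (CalogeroAiry.affineSubst c d) (h.quasiInvariant i j)
    rw [affineSubst_X_sub_X] at this
    exact dvd_mul_of_dvd_right ((dvd_mul_left _ _).trans this) _
  · have e : C ((c ^ n.choose 2)⁻¹) * CalogeroAiry.affineSubst c d B - vdm X =
        C ((c ^ n.choose 2)⁻¹) * CalogeroAiry.affineSubst c d (B - vdm X) := by
      rw [map_sub, affineSubst_vdm, mul_sub, ← mul_assoc (C _) (C _), ← map_mul,
        inv_mul_cancel₀ hcN, map_one, one_mul]
    rw [e]
    exact (totalDegree_C_mul_le _ (totalDegree_affineSubst_le _ _ _)).trans_lt h.leading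

theorem IsBakerAkhiezer.congr {A : Type*} [CommRing A] {a b : Fin n → A}
    {B : MvPolynomial (Fin n) A} (h : IsBakerAkhiezer a B) (hab : ∀ i j, a i - a j = b i - b j) :
    IsBakerAkhiezer b B := by
  refine ⟨fun i j => ?_, h.leading⟩
  have := h.quasiInvariant i j
  rwa [twistSub_eq, hab, ← twistSub_eq] at this

theorem eq_zero_of_eval_regular {F : MvPolynomial (Fin n) ℂ} (h : ∀ x ∈ regular n, eval x F = 0) :
    F = 0 := by
  have : vdm X * F = 0 := by
    apply MvPolynomial.funext
    intro x
    rw [map_mul, map_zero, map_vdm]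
    simp only [eval_X]
    by_cases hx : Function.Injective x
    · rw [h x hx, mul_zero]
    · rw [← vdm_ne_zero_iff, not_not] at hx
      rw [hx, zero_mul]
  exact (mul_eq_zero.1 this).resolve_left vdm_X_ne_zero

/-- Berest's construction is run with the generic spectral parameter a = X over ℂ[X], so that the
coefficients depend polynomially on x. The factor 2^N N! is inverted in ℂ, while vdm must stay as a
denominator. -/
theorem exists_bakerAkhiezer_numerator (hn : 2 ≤ n) :
    ∃ P : MvPolynomial (Fin n) (MvPolynomial (Fin n) ℂ), QuasiInvariant X P ∧
      (P - C (vdm (X : Fin n → MvPolynomial (Fin n) ℂ)) * vdm X).totalDegree < n.choose 2 := by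
  obtain ⟨P, hP, hd⟩ := exists_quasiInvariant (A := MvPolynomial (Fin n) ℂ) (a := X) hn
  set κ : ℂ := 2 ^ n.choose 2 * (n.choose 2).factorial with hκ
  have hκ0 : κ ≠ 0 := by
    rw [hκ]; exact mul_ne_zero (pow_ne_zero _ two_ne_zero) (by exact_mod_cast Nat.factorial_ne_zero _)
  refine ⟨(C κ⁻¹ : MvPolynomial (Fin n) ℂ) • P, hP.smul _, ?_⟩
  have e : (C κ⁻¹ : MvPolynomial (Fin n) ℂ) • P - C (vdm (X : Fin n → MvPolynomial (Fin n) ℂ)) * vdm X =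
      C (C κ⁻¹) * (P - C (2 ^ n.choose 2 * (n.choose 2).factorial *
        vdm (X : Fin n → MvPolynomial (Fin n) ℂ)) * vdm X) := by
    have h1 : 2 ^ n.choose 2 * ((n.choose 2).factorial : MvPolynomial (Fin n) ℂ) *
        vdm (X : Fin n → MvPolynomial (Fin n) ℂ) = C κ * vdm X := by
      rw [hκ, map_mul, map_pow, map_ofNat, map_natCast]
    rw [h1, mul_sub, smul_eq_C_mul, ← mul_assoc (C (C κ⁻¹)), ← map_mul C (C κ⁻¹), ← mul_assoc,
      ← map_mul, inv_mul_cancel₀ hκ0, map_one, one_mul]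
  rw [e]
  exact (totalDegree_C_mul_le _ le_rfl).trans_lt hd

/-- The numerator `∏_{i<j} x_{ij} ∏_{i<j} ξ_{ij} + ⋯` of the Baker-Akhiezer function, as a
polynomial in `ξ` whose coefficients are polynomials in `x`. -/
def baNum (n : ℕ) (hn : 2 ≤ n) : MvPolynomial (Fin n) (MvPolynomial (Fin n) ℂ) :=
  (exists_bakerAkhiezer_numerator hn).choose

variable (hn : 2 ≤ n)

theorem quasiInvariant_baNum : QuasiInvariant X (baNum n hn) :=
  (exists_bakerAkhiezer_numerator hn).choose_spec.1

theorem baNum_leading : (baNum n hn - C (vdm (X : Fin n → MvPolynomial (Fin n) ℂ)) * vdm X).totalDegree < n.choose 2 :=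
  (exists_bakerAkhiezer_numerator hn).choose_spec.2

/-- The polynomial factor of the monic Baker-Akhiezer function at `x`. -/
def ba (x : Fin n → ℂ) : MvPolynomial (Fin n) ℂ :=
  C (vdm x)⁻¹ * MvPolynomial.map (eval x) (baNum n hn)

theorem map_baNum {x : Fin n → ℂ} (hx : x ∈ regular n) :
    MvPolynomial.map (eval x) (baNum n hn) = C (vdm x) * ba hn x := by
  rw [ba, ← mul_assoc, ← map_mul, mul_inv_cancel₀ ((vdm_ne_zero_iff x).2 hx), map_one, one_mul]

theorem isBakerAkhiezer_ba {x : Fin n → ℂ} (hx : x ∈ regular n) :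
    IsBakerAkhiezer x (ba hn x) := by
  have hx0 := (vdm_ne_zero_iff x).2 hx
  constructor
  · rw [ba, ← smul_eq_C_mul]
    have := (quasiInvariant_baNum hn).map (eval x)
    simp only [eval_X] at this
    exact this.smul _
  · have e : ba hn x - vdm X = C (vdm x)⁻¹ *
        MvPolynomial.map (eval x) (baNum n hn - C (vdm (X : Fin n → MvPolynomial (Fin n) ℂ)) * vdm X) := by
      rw [map_sub, map_mul, map_C, map_vdm (eval x), map_vdm (MvPolynomial.map (eval x)), mul_sub,
        ← ba]
      simp only [eval_X, map_X]
      rw [← mul_assoc, ← map_mul, inv_mul_cancel₀ hx0, map_one, one_mul]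
    rw [e]
    exact (totalDegree_C_mul_le _ (totalDegree_map_eval_le _ _)).trans_lt (baNum_leading hn)

theorem smul_mem_regular {c : ℂ} (hc : c ≠ 0) {x : Fin n → ℂ} (hx : x ∈ regular n) :
    c • x ∈ regular n := fun _ _ h => hx (mul_left_cancel₀ hc h)

theorem add_const_mem_regular (c : ℂ) {x : Fin n → ℂ} (hx : x ∈ regular n) :
    (fun k => x k + c) ∈ regular n := fun _ _ h => hx (add_right_cancel h)

theorem ba_smul {c : ℂ} (hc : c ≠ 0) {x : Fin n → ℂ} (hx : x ∈ regular n) :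
    ba hn (c • x) = C ((c ^ n.choose 2)⁻¹) * affineSubst c 0 (ba hn x) :=
  (isBakerAkhiezer_ba hn (smul_mem_regular hc hx)).unique (smul_mem_regular hc hx)
    ((isBakerAkhiezer_ba hn hx).affineSubst hc 0)

theorem affineSubst_ba (d : ℂ) {x : Fin n → ℂ} (hx : x ∈ regular n) :
    affineSubst 1 d (ba hn x) = ba hn x := by
  have h := (isBakerAkhiezer_ba hn hx).affineSubst one_ne_zero d
  rw [one_smul, one_pow, inv_one, map_one, one_mul] at h
  exact h.unique hx (isBakerAkhiezer_ba hn hx)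

/-- Quasi-invariance involves only the differences of the spectral parameter. -/
theorem ba_add_const (c : ℂ) {x : Fin n → ℂ} (hx : x ∈ regular n) :
    ba hn (fun k => x k + c) = ba hn x := by
  have h := isBakerAkhiezer_ba hn (add_const_mem_regular c hx)
  exact (h.congr (b := x) (fun i j => by ring)).unique hx (isBakerAkhiezer_ba hn hx)

theorem vdm_smul {R : Type*} [CommRing R] (c : R) (v : Fin n → R) :
    vdm (c • v) = c ^ n.choose 2 * vdm v := by
  simp only [vdm_eq, Pi.smul_apply, smul_eq_mul, ← mul_sub]
  rw [Finset.prod_mul_distrib, Finset.prod_const, card_pairs]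

theorem vdm_add_const {R : Type*} [CommRing R] (c : R) (v : Fin n → R) :
    vdm (fun k => v k + c) = vdm v := by
  simp [vdm_eq]

/-- By `ba_smul`, scaling x by c multiplies the coefficient at m by c^|m|, so degree in x equals
degree in ξ; the duality depends on this balance. Testing c = 2 suffices, as distinct powers of 2
differ. -/
theorem isHomogeneous_coeff_baNum (m : Fin n →₀ ℕ) :
    (coeff m (baNum n hn)).IsHomogeneous m.degree := by
  have h : affineSubst 2 0 (coeff m (baNum n hn)) = C (2 ^ m.degree) * coeff m (baNum n hn) := by
    rw [← sub_eq_zero]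
    apply eq_zero_of_eval_regular
    intro x hx
    have h2 : (2 : ℂ) ≠ 0 := two_ne_zero
    have h1 := congrArg (coeff m) (map_baNum hn (smul_mem_regular h2 hx))
    rw [ba_smul hn h2 hx, vdm_smul, ← mul_assoc, ← map_mul, mul_comm (2 ^ _ : ℂ), mul_assoc,
      mul_inv_cancel₀ (pow_ne_zero _ h2), mul_one, coeff_C_mul, coeff_affineSubst_zero, coeff_map,
      mul_left_comm, ← coeff_C_mul, ← map_baNum hn hx, coeff_map] at h1
    rw [map_sub, eval_affineSubst, map_mul, eval_C, ← h1, sub_eq_zero]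
    congr 2
    ext k; simp
  intro u hu
  have h1 := congrArg (coeff u) h
  rw [coeff_affineSubst_zero, coeff_C_mul] at h1
  have h2 := mul_right_cancel₀ hu h1
  have h3 : (2 : ℕ) ^ u.degree = 2 ^ m.degree := by exact_mod_cast h2
  rw [show (Finsupp.weight 1) u = u.degree from 
    (DFunLike.congr_fun Finsupp.degree_eq_weight_one u).symm]
  exact Nat.pow_right_injective le_rfl h3

end BakerAkhiezer

/-! ### Partial derivatives of analytic functions -/

section PartialD
variable {n : ℕ} {U : Set (Fin n → ℂ)} {f g : (Fin n → ℂ) → ℂ} {x : Fin n → ℂ}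

theorem isOpen_regular (n : ℕ) : IsOpen (regular n) := by
  have : regular n = {x | vdm x ≠ 0} := by
    ext x; exact (vdm_ne_zero_iff x).symm
  rw [this]
  refine isOpen_ne_fun ?_ continuous_const
  unfold vdm
  fun_prop

theorem partialD_eq_fderiv (i : Fin n) (hf : DifferentiableAt ℂ f x) :
    partialD i f x = fderiv ℂ f x (Pi.single i 1) := hf.lineDeriv_eq_fderiv

theorem partialD_eq_of_hasFDerivAt (i : Fin n) {f' : (Fin n → ℂ) →L[ℂ] ℂ}
    (hf : HasFDerivAt f f' x) : partialD i f x = f' (Pi.single i 1) := by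
  rw [partialD_eq_fderiv i hf.differentiableAt, hf.fderiv]

theorem partialD_congr (hU : IsOpen U) (h : Set.EqOn f g U) (i : Fin n) :
    Set.EqOn (partialD i f) (partialD i g) U := fun _ hx =>
  (h.eventuallyEq_of_mem (hU.mem_nhds hx)).lineDeriv_eq

theorem analyticOnNhd_partialD (hU : IsOpen U) (hf : AnalyticOnNhd ℂ f U) (i : Fin n) :
    AnalyticOnNhd ℂ (partialD i f) U := by
  have h : AnalyticOnNhd ℂ (fun x => fderiv ℂ f x (Pi.single i 1)) U := fun x hx =>
    (ContinuousLinearMap.apply ℂ ℂ (Pi.single i 1 : Fin n → ℂ)).analyticAt _ |>.comp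
      (hf.fderiv x hx)
  exact h.congr hU fun x hx => (partialD_eq_fderiv i (hf x hx).differentiableAt).symm

theorem partialD_mul (i : Fin n) (hf : DifferentiableAt ℂ f x) (hg : DifferentiableAt ℂ g x) :
    partialD i (fun y => f y * g y) x = partialD i f x * g x + f x * partialD i g x := by
  rw [partialD_eq_of_hasFDerivAt i (hf.hasFDerivAt.fun_mul hg.hasFDerivAt), partialD_eq_fderiv i hf,
    partialD_eq_fderiv i hg]
  simp; ring

theorem partialD_add (i : Fin n) (hf : DifferentiableAt ℂ f x) (hg : DifferentiableAt ℂ g x) :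
    partialD i (fun y => f y + g y) x = partialD i f x + partialD i g x := by
  rw [partialD_eq_of_hasFDerivAt i (hf.hasFDerivAt.fun_add hg.hasFDerivAt), partialD_eq_fderiv i hf,
    partialD_eq_fderiv i hg]
  simp

theorem partialD_sum {ι : Type*} (i : Fin n) (s : Finset ι) {F : ι → (Fin n → ℂ) → ℂ}
    (hF : ∀ k ∈ s, DifferentiableAt ℂ (F k) x) :
    partialD i (fun y => ∑ k ∈ s, F k y) x = ∑ k ∈ s, partialD i (F k) x := by
  rw [partialD_eq_of_hasFDerivAt i (HasFDerivAt.fun_sum fun k hk => (hF k hk).hasFDerivAt)]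
  rw [_root_.sum_apply]
  exact Finset.sum_congr rfl fun k hk => (partialD_eq_fderiv i (hF k hk)).symm

theorem partialD_const (i : Fin n) (c : ℂ) (x : Fin n → ℂ) : partialD i (fun _ => c) x = 0 := by
  rw [partialD_eq_of_hasFDerivAt i (hasFDerivAt_const c x)]; simp

theorem partialD_const_mul (i : Fin n) (c : ℂ) (hf : DifferentiableAt ℂ f x) :
    partialD i (fun y => c * f y) x = c * partialD i f x := by
  rw [partialD_mul i (differentiableAt_const c) hf, partialD_const, zero_mul, zero_add]

theorem partialD_comm (hU : IsOpen U) (hf : AnalyticOnNhd ℂ f U) (i j : Fin n) :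
    Set.EqOn (partialD i (partialD j f)) (partialD j (partialD i f)) U := by
  intro x hx
  have key : ∀ i j : Fin n, partialD i (partialD j f) x =
      fderiv ℂ (fderiv ℂ f) x (Pi.single i 1) (Pi.single j 1) := by
    intro i j
    have e : Set.EqOn (partialD j f) (fun y => fderiv ℂ f y (Pi.single j 1)) U :=
      fun y hy => partialD_eq_fderiv j (hf y hy).differentiableAt
    rw [partialD_congr hU e i hx]
    have hd : HasFDerivAt (fderiv ℂ f) (fderiv ℂ (fderiv ℂ f) x) x :=
      (hf.fderiv x hx).differentiableAt.hasFDerivAt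
    have hd2 := hd.clm_apply (hasFDerivAt_const (Pi.single j (1 : ℂ) : Fin n → ℂ) x)
    rw [partialD_eq_of_hasFDerivAt i hd2]
    simp
  rw [key, key]
  exact (hf x hx).contDiffAt.isSymmSndFDerivAt_of_omega _ _

end PartialD

/-! ### Iterated partial derivatives -/

section MultiPartialD
variable {n : ℕ} {U : Set (Fin n → ℂ)} {f g : (Fin n → ℂ) → ℂ}

theorem iterate_partialD_congr (hU : IsOpen U) (h : Set.EqOn f g U) (i : Fin n) (k : ℕ) :
    Set.EqOn ((partialD i)^[k] f) ((partialD i)^[k] g) U := by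
  induction k with
  | zero => exact h
  | succ k ih =>
    rw [Function.iterate_succ_apply', Function.iterate_succ_apply']
    exact partialD_congr hU ih i

theorem analyticOnNhd_iterate_partialD (hU : IsOpen U) (hf : AnalyticOnNhd ℂ f U) (i : Fin n)
    (k : ℕ) : AnalyticOnNhd ℂ ((partialD i)^[k] f) U := by
  induction k with
  | zero => exact hf
  | succ k ih =>
    rw [Function.iterate_succ_apply']
    exact analyticOnNhd_partialD hU ih i

theorem partialD_iterate_comm (hU : IsOpen U) (hf : AnalyticOnNhd ℂ f U) (i j : Fin n)
    (k : ℕ) : Set.EqOn (partialD i ((partialD j)^[k] f)) ((partialD j)^[k] (partialD i f)) U := by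
  induction k with
  | zero => exact fun _ _ => rfl
  | succ k ih =>
    rw [Function.iterate_succ_apply', Function.iterate_succ_apply']
    exact (partialD_comm hU (analyticOnNhd_iterate_partialD hU hf j k) i j).trans
      (partialD_congr hU ih j)

theorem iterate_partialD_sum {ι : Type*} (hU : IsOpen U) (s : Finset ι)
    {F : ι → (Fin n → ℂ) → ℂ} (hF : ∀ l ∈ s, AnalyticOnNhd ℂ (F l) U) (i : Fin n) (k : ℕ) :
    Set.EqOn ((partialD i)^[k] fun y => ∑ l ∈ s, F l y)
      (fun y => ∑ l ∈ s, (partialD i)^[k] (F l) y) U := by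
  induction k with
  | zero => exact fun _ _ => rfl
  | succ k ih =>
    simp only [Function.iterate_succ_apply']
    refine (partialD_congr hU ih i).trans fun x hx => ?_
    exact partialD_sum i s fun l hl =>
      (analyticOnNhd_iterate_partialD hU (hF l hl) i k x hx).differentiableAt

theorem analyticOnNhd_multiPartialD (hU : IsOpen U) (hf : AnalyticOnNhd ℂ f U)
    (α : Fin n →₀ ℕ) : AnalyticOnNhd ℂ (multiPartialD α f) U := by
  unfold multiPartialD
  induction List.finRange n with
  | nil => exact hf
  | cons k l ih => exact analyticOnNhd_iterate_partialD hU ih k _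

theorem partialD_multiPartialD (hU : IsOpen U) (hf : AnalyticOnNhd ℂ f U) (i : Fin n)
    (α : Fin n →₀ ℕ) :
    Set.EqOn (partialD i (multiPartialD α f)) (multiPartialD α (partialD i f)) U := by
  unfold multiPartialD
  suffices h : AnalyticOnNhd ℂ ((List.finRange n).foldr (fun i g => (partialD i)^[α i] g) f) U ∧
      Set.EqOn (partialD i ((List.finRange n).foldr (fun i g => (partialD i)^[α i] g) f))
        ((List.finRange n).foldr (fun i g => (partialD i)^[α i] g) (partialD i f)) U from h.2
  induction List.finRange n with
  | nil => exact ⟨hf, fun _ _ => rfl⟩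
  | cons k l ih =>
    exact ⟨analyticOnNhd_iterate_partialD hU ih.1 k _,
      (partialD_iterate_comm hU ih.1 i k (α k)).trans (iterate_partialD_congr hU ih.2 k _)⟩

/-- `multiPartialD` takes the variables in a fixed order, so the extra derivative has to be commuted
inwards past the others. The induction runs over duplicate-free lists, in which i is met at most
once. -/
theorem multiPartialD_add_single (hU : IsOpen U) (hf : AnalyticOnNhd ℂ f U) (i : Fin n)
    (α : Fin n →₀ ℕ) :
    Set.EqOn (multiPartialD (α + Finsupp.single i 1) f) (multiPartialD α (partialD i f)) U := by
  have key : ∀ l : List (Fin n), l.Nodup →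
      (i ∉ l → Set.EqOn (l.foldr (fun j g => (partialD j)^[(α + Finsupp.single i 1 : Fin n →₀ ℕ) j] g) f)
        (l.foldr (fun j g => (partialD j)^[α j] g) f) U) ∧
      (i ∈ l → Set.EqOn (l.foldr (fun j g => (partialD j)^[(α + Finsupp.single i 1 : Fin n →₀ ℕ) j] g) f)
        (l.foldr (fun j g => (partialD j)^[α j] g) (partialD i f)) U) ∧
      Set.EqOn (partialD i (l.foldr (fun i g => (partialD i)^[α i] g) f))
        (l.foldr (fun i g => (partialD i)^[α i] g) (partialD i f)) U ∧
      AnalyticOnNhd ℂ (l.foldr (fun i g => (partialD i)^[α i] g) f) U := by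
    intro l hl
    induction l with
    | nil => exact ⟨fun _ _ _ => rfl, by simp, fun _ _ => rfl, hf⟩
    | cons k l ih =>
      rw [List.nodup_cons] at hl
      obtain ⟨ih1, ih2, ih3, ih4⟩ := ih hl.2
      simp only [List.foldr_cons]
      refine ⟨?_, ?_, ?_, analyticOnNhd_iterate_partialD hU ih4 k _⟩
      · intro hi
        rw [List.mem_cons, not_or] at hi
        have e : (α + Finsupp.single i 1 : Fin n →₀ ℕ) k = α k := by simp [Ne.symm hi.1]
        rw [e]
        exact iterate_partialD_congr hU (ih1 hi.2) k _
      · intro hi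
        by_cases hk : i = k
        · subst hk
          have e : (α + Finsupp.single i 1 : Fin n →₀ ℕ) i = α i + 1 := by simp
          rw [e, Function.iterate_succ_apply]
          exact iterate_partialD_congr hU ((partialD_congr hU (ih1 hl.1) i).trans ih3) i _
        · have e : (α + Finsupp.single i 1 : Fin n →₀ ℕ) k = α k := by simp [hk]
          rw [e]
          exact iterate_partialD_congr hU (ih2 ((List.mem_cons.1 hi).resolve_left hk)) k _
      · exact (partialD_iterate_comm hU ih4 i k (α k)).trans (iterate_partialD_congr hU ih3 k _)
  exact (key _ (List.nodup_finRange n)).2.1 (List.mem_finRange i)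

theorem multiPartialD_sum {ι : Type*} (hU : IsOpen U) (s : Finset ι)
    {F : ι → (Fin n → ℂ) → ℂ} (hF : ∀ l ∈ s, AnalyticOnNhd ℂ (F l) U) (α : Fin n →₀ ℕ) :
    Set.EqOn (multiPartialD α fun y => ∑ l ∈ s, F l y)
      (fun y => ∑ l ∈ s, multiPartialD α (F l) y) U := by
  unfold multiPartialD
  suffices h : ∀ L : List (Fin n), (∀ l ∈ s,
      AnalyticOnNhd ℂ (L.foldr (fun i g => (partialD i)^[α i] g) (F l)) U) ∧
      Set.EqOn (L.foldr (fun i g => (partialD i)^[α i] g) fun y => ∑ l ∈ s, F l y)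
      (fun y => ∑ l ∈ s, L.foldr (fun i g => (partialD i)^[α i] g) (F l) y) U from (h _).2
  intro L
  induction L with
  | nil => exact ⟨hF, fun _ _ => rfl⟩
  | cons k L ih =>
    refine ⟨fun l hl => analyticOnNhd_iterate_partialD hU (ih.1 l hl) k _, ?_⟩
    exact (iterate_partialD_congr hU ih.2 k _).trans (iterate_partialD_sum hU s ih.1 k _)

theorem multiPartialD_zero : multiPartialD 0 f = f := by
  unfold multiPartialD
  induction List.finRange n with
  | nil => rfl
  | cons _ _ _ => simp

theorem multiPartialD_congr (hU : IsOpen U) (h : Set.EqOn f g U) (α : Fin n →₀ ℕ) :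
    Set.EqOn (multiPartialD α f) (multiPartialD α g) U := by
  unfold multiPartialD
  induction List.finRange n with
  | nil => exact h
  | cons k l ih => exact iterate_partialD_congr hU ih k _

end MultiPartialD

/-! ### Differential operators through their symbols -/

section Jet
variable {n : ℕ} {U : Set (Fin n → ℂ)} {f g : (Fin n → ℂ) → ℂ} {x : Fin n → ℂ}

/-- The constant coefficient operator with symbol `Q`, applied to `f` and evaluated at `x`. -/
def jet (f : (Fin n → ℂ) → ℂ) (x : Fin n → ℂ) : MvPolynomial (Fin n) ℂ →ₗ[ℂ] ℂ :=
  (basisMonomials (Fin n) ℂ).constr ℂ fun α => multiPartialD α f x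

theorem jet_monomial (f : (Fin n → ℂ) → ℂ) (x : Fin n → ℂ) (α : Fin n →₀ ℕ) (c : ℂ) :
    jet f x (monomial α c) = c * multiPartialD α f x := by
  have h : monomial α c = c • basisMonomials (Fin n) ℂ α := by
    rw [coe_basisMonomials, smul_monomial, smul_eq_mul, mul_one]
  rw [h, map_smul, jet, Module.Basis.constr_basis, smul_eq_mul]

theorem jet_X_mul (hU : IsOpen U) (hf : AnalyticOnNhd ℂ f U) (hx : x ∈ U) (k : Fin n)
    (Q : MvPolynomial (Fin n) ℂ) : jet f x (X k * Q) = jet (partialD k f) x Q := by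
  induction Q using MvPolynomial.induction_on' with
  | add p q hp hq => rw [mul_add, map_add, map_add, hp, hq]
  | monomial α c =>
    rw [X, monomial_mul, one_mul, add_comm, jet_monomial, jet_monomial,
      multiPartialD_add_single hU hf k α hx]

theorem jet_congr (hU : IsOpen U) (h : Set.EqOn f g U) (hx : x ∈ U)
    (Q : MvPolynomial (Fin n) ℂ) : jet f x Q = jet g x Q := by
  induction Q using MvPolynomial.induction_on' with
  | add p q hp hq => rw [map_add, map_add, hp, hq]
  | monomial α c => rw [jet_monomial, jet_monomial, multiPartialD_congr hU h α hx]

theorem jet_sum {ι : Type*} (hU : IsOpen U) (s : Finset ι) {F : ι → (Fin n → ℂ) → ℂ}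
    (hF : ∀ l ∈ s, AnalyticOnNhd ℂ (F l) U) (hx : x ∈ U) (Q : MvPolynomial (Fin n) ℂ) :
    jet (fun y => ∑ l ∈ s, F l y) x Q = ∑ l ∈ s, jet (F l) x Q := by
  induction Q using MvPolynomial.induction_on' with
  | add p q hp hq => simp only [map_add, hp, hq, Finset.sum_add_distrib]
  | monomial α c =>
    simp only [jet_monomial]
    rw [multiPartialD_sum hU s hF α hx, Finset.mul_sum]

theorem jet_C_mul (a : ℂ) (Q : MvPolynomial (Fin n) ℂ) : jet f x (C a * Q) = a * jet f x Q := by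
  rw [← smul_eq_C_mul, map_smul, smul_eq_mul]

theorem jet_one (f : (Fin n → ℂ) → ℂ) (x : Fin n → ℂ) : jet f x 1 = f x := by
  rw [show (1 : MvPolynomial (Fin n) ℂ) = monomial 0 1 from rfl, jet_monomial, multiPartialD_zero,
    one_mul]

theorem jet_add (hU : IsOpen U) (hf : AnalyticOnNhd ℂ f U) (hg : AnalyticOnNhd ℂ g U) (hx : x ∈ U)
    (Q : MvPolynomial (Fin n) ℂ) : jet (fun y => f y + g y) x Q = jet f x Q + jet g x Q := by
  have h := jet_sum hU univ (F := ![f, g]) (fun l _ => by fin_cases l <;> assumption) hx Q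
  simpa [Fin.sum_univ_two] using h

theorem jet_const_mul (hU : IsOpen U) (a : ℂ) (hf : AnalyticOnNhd ℂ f U) (hx : x ∈ U)
    (Q : MvPolynomial (Fin n) ℂ) : jet (fun y => a * f y) x Q = a * jet f x Q := by
  induction Q using MvPolynomial.induction_on generalizing f with
  | C b =>
    rw [← mul_one (C b), jet_C_mul, jet_C_mul, jet_one, jet_one]
    ring
  | add p q hp hq => rw [map_add, map_add, hp hf, hq hf, mul_add]
  | mul_X p k hp =>
    rw [mul_comm p, jet_X_mul hU (analyticOnNhd_const.mul hf) hx, jet_X_mul hU hf hx,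
      ← hp (analyticOnNhd_partialD hU hf k)]
    exact jet_congr hU (fun y hy => partialD_const_mul k a (hf y hy).differentiableAt) hx _

/-- The polynomial `∑_{α ∈ T} c_α(x) X^α`. -/
def symbolPoly (T : Finset (Fin n →₀ ℕ)) (c : (Fin n →₀ ℕ) → (Fin n → ℂ) → ℂ)
    (x : Fin n → ℂ) : MvPolynomial (Fin n) ℂ := ∑ α ∈ T, monomial α (c α x)

variable {T : Finset (Fin n →₀ ℕ)} {c : (Fin n →₀ ℕ) → (Fin n → ℂ) → ℂ}

theorem symbolPoly_map (φ : MvPolynomial (Fin n) ℂ →ₗ[ℂ] ℂ) (y : Fin n → ℂ) :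
    φ (symbolPoly T c y) = ∑ α ∈ T, φ (monomial α 1) * c α y := by
  rw [symbolPoly, map_sum]
  refine Finset.sum_congr rfl fun α _ => ?_
  rw [mul_comm, ← smul_eq_mul, ← map_smul, smul_monomial, smul_eq_mul, mul_one]

theorem analyticOnNhd_symbolPoly (hc : ∀ α ∈ T, AnalyticOnNhd ℂ (c α) U)
    (φ : MvPolynomial (Fin n) ℂ →ₗ[ℂ] ℂ) :
    AnalyticOnNhd ℂ (fun y => φ (symbolPoly T c y)) U := by
  simp only [symbolPoly_map]
  exact Finset.analyticOnNhd_fun_sum _ fun α hα => analyticOnNhd_const.mul (hc α hα)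

theorem partialD_symbolPoly (hc : ∀ α ∈ T, AnalyticOnNhd ℂ (c α) U) (hx : x ∈ U)
    (φ : MvPolynomial (Fin n) ℂ →ₗ[ℂ] ℂ) (k : Fin n) :
    partialD k (fun y => φ (symbolPoly T c y)) x =
      φ (symbolPoly T (fun α => partialD k (c α)) x) := by
  simp only [symbolPoly_map]
  rw [partialD_sum k T fun α hα =>
    ((hc α hα x hx).differentiableAt.const_mul (φ (monomial α 1)))]
  exact Finset.sum_congr rfl fun α hα =>
    partialD_const_mul k _ (hc α hα x hx).differentiableAt

theorem jet_symbolPoly (f : (Fin n → ℂ) → ℂ) (y : Fin n → ℂ) :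
    jet f y (symbolPoly T c y) = ∑ α ∈ T, c α y * multiPartialD α f y := by
  rw [symbolPoly, map_sum]
  exact Finset.sum_congr rfl fun α _ => jet_monomial _ _ _ _

theorem analyticOnNhd_jet (hU : IsOpen U) (hf : AnalyticOnNhd ℂ f U)
    (hc : ∀ α ∈ T, AnalyticOnNhd ℂ (c α) U) :
    AnalyticOnNhd ℂ (fun y => jet f y (symbolPoly T c y)) U := by
  simp only [jet_symbolPoly]
  exact Finset.analyticOnNhd_fun_sum _ fun α hα =>
    (hc α hα).mul (analyticOnNhd_multiPartialD hU hf α)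

theorem partialD_jet (hU : IsOpen U) (hf : AnalyticOnNhd ℂ f U)
    (hc : ∀ α ∈ T, AnalyticOnNhd ℂ (c α) U) (hx : x ∈ U) (k : Fin n) :
    partialD k (fun y => jet f y (symbolPoly T c y)) x =
      jet f x (symbolPoly T (fun α => partialD k (c α)) x) +
        jet (partialD k f) x (symbolPoly T c x) := by
  simp only [jet_symbolPoly]
  rw [partialD_sum k T fun α hα => ((hc α hα x hx).differentiableAt.fun_mul
    (analyticOnNhd_multiPartialD hU hf α x hx).differentiableAt), ← Finset.sum_add_distrib]
  refine Finset.sum_congr rfl fun α hα => ?_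
  rw [partialD_mul k (hc α hα x hx).differentiableAt
    (analyticOnNhd_multiPartialD hU hf α x hx).differentiableAt,
    partialD_multiPartialD hU hf k α hx]

/-- The full symbol of `Δ̃ D - D Δ`, where `D = ∑_{α ∈ T} c_α ∂^α`. -/
def defect (T : Finset (Fin n →₀ ℕ)) (c : (Fin n →₀ ℕ) → (Fin n → ℂ) → ℂ)
    (x : Fin n → ℂ) : MvPolynomial (Fin n) ℂ :=
  ∑ k, (C 2 * (X k * symbolPoly T (fun α => partialD k (c α)) x) +
    symbolPoly T (fun α => partialD k (partialD k (c α))) x) - C (potential x) * symbolPoly T c x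

/-- By the Leibniz rule, ∂_k² applied to c_α ∂^α f gives c_α ∂^α ∂_k² f, which sums to D Δ f, plus
terms with differentiated coefficients. Intertwining thus follows once `defect` vanishes. -/
theorem laplacianTilde_jet (hU : IsOpen U) (hf : AnalyticOnNhd ℂ f U)
    (hc : ∀ α ∈ T, AnalyticOnNhd ℂ (c α) U) (hx : x ∈ U) :
    laplacianTilde (fun y => jet f y (symbolPoly T c y)) x =
      jet (laplacian f) x (symbolPoly T c x) + jet f x (defect T c x) := by
  have hk : ∀ k, partialD k (partialD k (fun y => jet f y (symbolPoly T c y))) x =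
      jet f x (symbolPoly T (fun α => partialD k (partialD k (c α))) x) +
      2 * jet (partialD k f) x (symbolPoly T (fun α => partialD k (c α)) x) +
      jet (partialD k (partialD k f)) x (symbolPoly T c x) := by
    intro k
    have e : Set.EqOn (partialD k (fun y => jet f y (symbolPoly T c y)))
        (fun y => jet f y (symbolPoly T (fun α => partialD k (c α)) y) +
          jet (partialD k f) y (symbolPoly T c y)) U := fun y hy => partialD_jet hU hf hc hy k
    have hc' : ∀ α ∈ T, AnalyticOnNhd ℂ (partialD k (c α)) U := fun α hα =>
      analyticOnNhd_partialD hU (hc α hα) k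
    have hf' := analyticOnNhd_partialD hU hf k
    rw [partialD_congr hU e k hx, partialD_add k
      (analyticOnNhd_jet hU hf hc' x hx).differentiableAt
      (analyticOnNhd_jet hU hf' hc x hx).differentiableAt, partialD_jet hU hf hc' hx,
      partialD_jet hU hf' hc hx]
    ring
  have hl : jet (laplacian f) x (symbolPoly T c x) =
      ∑ k, jet (partialD k (partialD k f)) x (symbolPoly T c x) :=
    jet_sum hU univ (fun k _ => analyticOnNhd_partialD hU (analyticOnNhd_partialD hU hf k) k) hx _
  rw [laplacianTilde, laplacian, Finset.sum_congr rfl fun k _ => hk k, hl, defect, map_sub,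
    map_sum, jet_C_mul]
  simp only [map_add, jet_C_mul, jet_X_mul hU hf hx, Finset.sum_add_distrib]
  ring

end Jet

/-! ### Action on exponentials -/

section Exponential
variable {n : ℕ}

theorem hasFDerivAt_linear (ξ x : Fin n → ℂ) :
    HasFDerivAt (fun y : Fin n → ℂ => ∑ k, ξ k * y k)
      (∑ k, ξ k • ContinuousLinearMap.proj (R := ℂ) (φ := fun _ : Fin n => ℂ) k) x :=
  HasFDerivAt.fun_sum fun k _ => ((hasFDerivAt_apply k x).const_mul (ξ k))

theorem analyticOnNhd_exp_linear (ξ : Fin n → ℂ) (U : Set (Fin n → ℂ)) :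
    AnalyticOnNhd ℂ (fun y : Fin n → ℂ => Complex.exp (∑ k, ξ k * y k)) U := fun x _ =>
  AnalyticAt.cexp (Finset.analyticAt_fun_sum _ fun k _ => analyticAt_const.mul
    ((ContinuousLinearMap.proj (R := ℂ) (φ := fun _ : Fin n => ℂ) k).analyticAt x))

theorem partialD_exp_linear (ξ : Fin n → ℂ) (i : Fin n) :
    partialD i (fun y : Fin n → ℂ => Complex.exp (∑ k, ξ k * y k)) =
      fun y => ξ i * Complex.exp (∑ k, ξ k * y k) := by
  ext x
  rw [partialD_eq_of_hasFDerivAt i (hasFDerivAt_linear ξ x).cexp]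
  simp [Pi.single_apply, _root_.sum_apply, mul_comm]

/-- Exponentials are joint eigenfunctions of all ∂_k, so a symbol can be read off from its action on
them. The uniqueness proof extracts the vanishing of the defect in this way. -/
theorem jet_exp_linear (ξ x : Fin n → ℂ) (Q : MvPolynomial (Fin n) ℂ) :
    jet (fun y : Fin n → ℂ => Complex.exp (∑ k, ξ k * y k)) x Q =
      eval ξ Q * Complex.exp (∑ k, ξ k * x k) := by
  induction Q using MvPolynomial.induction_on with
  | C b =>
    rw [← mul_one (C b), jet_C_mul, jet_one, mul_one, eval_C]
  | add p q hp hq => rw [map_add, map_add, hp, hq, add_mul]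
  | mul_X p k hp =>
    rw [mul_comm p, jet_X_mul isOpen_univ (analyticOnNhd_exp_linear ξ _) (Set.mem_univ x),
      partialD_exp_linear, jet_const_mul isOpen_univ _ (analyticOnNhd_exp_linear ξ _)
      (Set.mem_univ x), hp, map_mul, eval_X, mul_assoc]

end Exponential

/-! ### Graded parts and the subleading term -/

section Graded
variable {n : ℕ} {A : Type*} [CommRing A]

theorem homogeneousComponent_X_mul (d : ℕ) (k : Fin n) (F : MvPolynomial (Fin n) A) :
    homogeneousComponent (d + 1) (X k * F) = X k * homogeneousComponent d F := by
  induction F using MvPolynomial.induction_on' with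
  | add p q hp hq => rw [mul_add, map_add, map_add, hp, hq, mul_add]
  | monomial α c =>
    rw [X, monomial_mul, one_mul, homogeneousComponent_of_mem (isHomogeneous_monomial c rfl),
      homogeneousComponent_of_mem (isHomogeneous_monomial c rfl)]
    have e : (Finsupp.single k 1 + α).degree = α.degree + 1 := by simp [add_comm]
    rw [e]
    by_cases h : d = α.degree
    · simp [h, monomial_mul]
    · simp [h]

theorem totalDegree_le_of_homogeneousComponent_eq_zero {d : ℕ} {P : MvPolynomial (Fin n) A}
    (h : P.totalDegree ≤ d + 1) (h0 : homogeneousComponent (d + 1) P = 0) :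
    P.totalDegree ≤ d := by
  rw [totalDegree_le_iff_coeff] at h ⊢
  intro m hm
  by_cases hm' : m.degree = d + 1
  · have := congrArg (coeff m) h0
    rwa [coeff_homogeneousComponent, if_pos hm', coeff_zero] at this
  · exact h m (by omega)

theorem totalDegree_X_mul_le {d : ℕ} (k : Fin n) {P : MvPolynomial (Fin n) A}
    (h : P.totalDegree ≤ d) : (X k * P).totalDegree ≤ d + 1 := by
  refine (totalDegree_mul _ _).trans ?_
  have := (isHomogeneous_X A k).totalDegree_le
  omega

theorem X_sub_X_dvd_of_eval {i j : Fin n} {F : MvPolynomial (Fin n) ℂ}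
    (h : ∀ ξ : Fin n → ℂ, ξ i = ξ j → eval ξ F = 0) : X i - X j ∣ F := by
  rw [X_sub_X_dvd_iff]
  apply MvPolynomial.funext
  intro ξ
  rw [wall, eval_rename, map_zero]
  apply h
  by_cases hij : j = i
  · rw [hij]
  · simp [hij]

theorem eval_eq_zero_of_X_sub_X_dvd {i j : Fin n} {F : MvPolynomial (Fin n) A}
    (h : X i - X j ∣ F) {ξ : Fin n → A} (hξ : ξ i = ξ j) : eval ξ F = 0 := by
  obtain ⟨q, rfl⟩ := h
  simp [hξ]

/-- On the wall only the derivative of the vanishing linear factor survives, and it contributes 1 -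
(-1) = 2. -/
theorem wall_pderiv_vdm (p : Fin n × Fin n) (hp : p ∈ pairs n) :
    wall p.1 p.2 (pderiv p.1 (vdm X) - pderiv p.2 (vdm X) : MvPolynomial (Fin n) A) =
      2 * wall p.1 p.2 (vdmErase X p) := by
  have hne := (mem_pairs.1 hp).ne
  rw [← mul_vdmErase X hp]
  simp only [Derivation.leibniz, map_sub, pderiv_X_self, pderiv_X_of_ne hne,
    pderiv_X_of_ne hne.symm, smul_eq_mul, map_add, map_mul, wall_eq_wall p.1 p.2]
  simp
  ring

/-- In degree K = N - 1, quasi-invariance on the wall of p = (i, j) reads (a_i - a_j) B_K + 2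
`vdmErase X p` = 0, and the other `vdmErase X q` vanish there. So the difference of the two sides
vanishes on all walls and is a multiple of vdm, yet has degree K < N. -/
theorem IsBakerAkhiezer.homogeneousComponent_pred {a : Fin n → ℂ} (ha : Function.Injective a)
    {B : MvPolynomial (Fin n) ℂ} (hB : IsBakerAkhiezer a B) {K : ℕ} (hK : n.choose 2 = K + 1) :
    homogeneousComponent K B = -∑ p ∈ pairs n, C (2 * (a p.1 - a p.2)⁻¹) * vdmErase X p := by
  have hE : ∀ p ∈ pairs n, (vdmErase X p : MvPolynomial (Fin n) ℂ).IsHomogeneous K := by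
    intro p hp
    have := isHomogeneous_vdmErase (A := ℂ) hp
    rwa [hK, Nat.add_sub_cancel] at this
  rw [← sub_eq_zero, sub_neg_eq_add]
  set M := homogeneousComponent K B + ∑ p ∈ pairs n, C (2 * (a p.1 - a p.2)⁻¹) * vdmErase X p
    with hM
  have hMh : M.IsHomogeneous K := (homogeneousComponent_isHomogeneous _ _).add
    (IsHomogeneous.sum _ _ _ fun p hp => (hE p hp).C_mul _)
  have hR := hB.leading
  set R := B - vdm X with hRdef
  have hBR : B = vdm X + R := by rw [hRdef]; ring
  have hcB : homogeneousComponent K B = homogeneousComponent K R := by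
    rw [hBR, map_add, homogeneousComponent_of_mem isHomogeneous_vdm, if_neg (by omega), zero_add]
  have hdvd : vdm X ∣ M := by
    refine vdm_X_dvd fun p hp => ?_
    have h0 : a p.1 - a p.2 ≠ 0 := sub_ne_zero.2 fun e => (mem_pairs.1 hp).ne (ha e)
    have h1 := (X_sub_X_dvd_iff _ _ _).1 (hB.quasiInvariant p.1 p.2)
    have hv : wall p.1 p.2 (vdm X : MvPolynomial (Fin n) ℂ) = 0 :=
      (X_sub_X_dvd_iff _ _ _).1 ⟨_, (mul_vdmErase X hp).symm⟩
    rw [twistSub_eq, hBR, map_add, map_add (pderiv p.1), map_add (pderiv p.2), add_sub_add_comm,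
      map_add, wall_pderiv_vdm p hp,
      map_mul, map_add, hv, zero_add] at h1
    have h2 := congrArg (homogeneousComponent K) h1
    have hCw : ∀ c : ℂ, wall p.1 p.2 (C c : MvPolynomial (Fin n) ℂ) = C c := fun c => by simp [wall]
    have hw : ∀ F : MvPolynomial (Fin n) ℂ, homogeneousComponent K (wall p.1 p.2 F) =
        wall p.1 p.2 (homogeneousComponent K F) := fun F => by
      rw [wall, rename_homogeneousComponent]
    rw [map_zero, map_add, map_add, hw, map_sub (homogeneousComponent K),
      homogeneousComponent_pderiv_eq_zero _ (by omega),
      homogeneousComponent_pderiv_eq_zero _ (by omega), hCw, homogeneousComponent_C_mul, hw,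
      show (2 : MvPolynomial (Fin n) ℂ) = C 2 from (map_ofNat C 2).symm, homogeneousComponent_C_mul, hw,
      homogeneousComponent_eq_self (hE p hp), sub_zero, map_zero, add_zero] at h2
    rw [X_sub_X_dvd_iff, hM, map_add, map_sum, Finset.sum_eq_single p]
    · rw [hcB, map_mul, hCw]
      have h3 : (C (a p.1 - a p.2)⁻¹ : MvPolynomial (Fin n) ℂ) * C (a p.1 - a p.2) = 1 := by
        rw [← map_mul, inv_mul_cancel₀ h0, map_one]
      rw [map_mul]
      linear_combination C (a p.1 - a p.2)⁻¹ * h2 - wall p.1 p.2 (homogeneousComponent K R) * h3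
    · intro q hq hqp
      rw [map_mul, (X_sub_X_dvd_iff _ _ _).1 (X_sub_X_dvd_vdmErase hp hqp.symm), mul_zero]
    · exact fun h => absurd hp h
  by_contra hM0
  obtain ⟨Q, hQ⟩ := hdvd
  have hQ0 : Q ≠ 0 := by rintro rfl; exact hM0 (by rw [hQ, mul_zero])
  have h1 := hMh.totalDegree hM0
  rw [hQ, totalDegree_mul_of_isDomain vdm_X_ne_zero hQ0,
    isHomogeneous_vdm.totalDegree vdm_X_ne_zero] at h1
  omega

end Graded

/-! ### The intertwining relation -/

section Defect
variable {n : ℕ} {T : Finset (Fin n →₀ ℕ)} {c : (Fin n →₀ ℕ) → (Fin n → ℂ) → ℂ}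
  {x : Fin n → ℂ}

theorem partialD_apply_sub_apply (i j k : Fin n) (x : Fin n → ℂ) :
    partialD k (fun y : Fin n → ℂ => y i - y j) x =
      Pi.single (M := fun _ => ℂ) i 1 k - Pi.single (M := fun _ => ℂ) j 1 k := by
  rw [partialD_eq_of_hasFDerivAt k ((hasFDerivAt_apply i x).fun_sub (hasFDerivAt_apply j x))]
  simp [Pi.single_apply, eq_comm]

/-- The wall condition on B_x(ξ) exp(∑ x_k ξ_k) is linear in ξ-jets and holds for all x, so it
survives differential operators in x. Multiplication by ∑ ξ_k² also preserves it, since the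
derivative of this sum along e_i - e_j is 2(ξ_i - ξ_j). -/
theorem quasiInvariant_defect (hc : ∀ α ∈ T, AnalyticOnNhd ℂ (c α) (regular n))
    (hq : ∀ y ∈ regular n, QuasiInvariant y (symbolPoly T c y)) (hx : x ∈ regular n) :
    QuasiInvariant x (defect T c x) := by
  intro i j
  refine X_sub_X_dvd_of_eval fun ξ hξ => ?_
  -- At a wall point ξ, φ₀ is the value and φ₁ the derivative along e_i - e_j. Quasi-invariance
  -- becomes φ₁ + (y_i - y_j) φ₀ = 0 for all regular y, which may be differentiated in y.
  set φ₀ : MvPolynomial (Fin n) ℂ →ₗ[ℂ] ℂ := (aeval ξ).toLinearMap with hφ₀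
  set φ₁ : MvPolynomial (Fin n) ℂ →ₗ[ℂ] ℂ :=
    φ₀ ∘ₗ ((pderiv i).toLinearMap - (pderiv j).toLinearMap) with hφ₁
  have hev : ∀ y F, eval ξ (twistSub y i j F) = φ₁ F + (y i - y j) * φ₀ F := by
    intro y F
    simp [hφ₀, hφ₁, twistSub_eq]
  have hX0 : ∀ k F, φ₀ (X k * F) = ξ k * φ₀ F := by intro k F; simp [hφ₀]
  have hX1 : ∀ k F, φ₁ (X k * F) = ξ k * φ₁ F +
      (Pi.single (M := fun _ => ℂ) i 1 k - Pi.single (M := fun _ => ℂ) j 1 k) * φ₀ F := by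
    intro k F
    simp only [hφ₁, LinearMap.comp_apply, LinearMap.sub_apply, Derivation.coeFn_coe,
      Derivation.leibniz, pderiv_X, smul_eq_mul, hφ₀, AlgHom.toLinearMap_apply,
      map_sub, map_add, map_mul, aeval_X, Pi.single_apply]
    split_ifs <;> simp <;> ring
  have hC0 : ∀ b F, φ₀ (C b * F) = b * φ₀ F := fun b F => by
    rw [← smul_eq_C_mul, map_smul, smul_eq_mul]
  have hC1 : ∀ b F, φ₁ (C b * F) = b * φ₁ F := fun b F => by
    rw [← smul_eq_C_mul, map_smul, smul_eq_mul]
  have hU := isOpen_regular n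
  have hpd : ∀ (c : (Fin n →₀ ℕ) → (Fin n → ℂ) → ℂ),
      (∀ α ∈ T, AnalyticOnNhd ℂ (c α) (regular n)) → ∀ k, ∀ y ∈ regular n,
      partialD k (fun y => φ₁ (symbolPoly T c y) + (y i - y j) * φ₀ (symbolPoly T c y)) y =
        φ₁ (symbolPoly T (fun α => partialD k (c α)) y) +
        ((Pi.single (M := fun _ => ℂ) i 1 k - Pi.single (M := fun _ => ℂ) j 1 k) *
          φ₀ (symbolPoly T c y) +
        (y i - y j) * φ₀ (symbolPoly T (fun α => partialD k (c α)) y)) := by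
    intro c hc k y hy
    have d0 := (analyticOnNhd_symbolPoly hc φ₀ y hy).differentiableAt
    have d1 := (analyticOnNhd_symbolPoly hc φ₁ y hy).differentiableAt
    have d2 : DifferentiableAt ℂ (fun y : Fin n → ℂ => y i - y j) y :=
      ((hasFDerivAt_apply i y).fun_sub (hasFDerivAt_apply j y)).differentiableAt
    rw [partialD_add k d1 (d2.fun_mul d0), partialD_mul k d2 d0, partialD_symbolPoly hc hy,
      partialD_symbolPoly hc hy, partialD_apply_sub_apply]
  have h0 : ∀ y ∈ regular n, φ₁ (symbolPoly T c y) + (y i - y j) * φ₀ (symbolPoly T c y) = 0 :=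
    fun y hy => by rw [← hev]; exact eval_eq_zero_of_X_sub_X_dvd (hq y hy i j) hξ
  have h1 : ∀ k, ∀ y ∈ regular n, φ₁ (symbolPoly T (fun α => partialD k (c α)) y) +
        (y i - y j) * φ₀ (symbolPoly T (fun α => partialD k (c α)) y) =
        -((Pi.single (M := fun _ => ℂ) i 1 k - Pi.single (M := fun _ => ℂ) j 1 k) *
          φ₀ (symbolPoly T c y)) := by
    intro k y hy
    have := partialD_congr hU (g := fun _ => 0) h0 k hy
    rw [hpd c hc k y hy, partialD_const] at this
    linear_combination this
  have h2 : ∀ k, ∀ y ∈ regular n, φ₁ (symbolPoly T (fun α => partialD k (partialD k (c α))) y) +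
        (y i - y j) * φ₀ (symbolPoly T (fun α => partialD k (partialD k (c α))) y) =
        -(2 * (Pi.single (M := fun _ => ℂ) i 1 k - Pi.single (M := fun _ => ℂ) j 1 k) *
          φ₀ (symbolPoly T (fun α => partialD k (c α)) y)) := by
    intro k y hy
    have := partialD_congr hU (h1 k) k hy
    rw [hpd _ (fun α hα => analyticOnNhd_partialD hU (hc α hα) k) k y hy] at this
    simp only [← neg_mul] at this
    rw [partialD_const_mul k _ (analyticOnNhd_symbolPoly hc φ₀ y hy).differentiableAt,
      partialD_symbolPoly hc hy] at this
    linear_combination this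
  rw [hev, defect]
  simp only [map_sub, map_sum, map_add, hC0, hC1, hX0, hX1]
  rw [Finset.sum_add_distrib, Finset.sum_add_distrib]
  have e2 := Finset.sum_congr (s₁ := (univ : Finset (Fin n))) rfl fun k _ => h2 k x hx
  -- The sum reduces to a multiple of ξ_i - ξ_j, which is zero on the wall.
  have e1 : ∑ k, 2 * ξ k * (φ₁ (symbolPoly T (fun α => partialD k (c α)) x) +
        (x i - x j) * φ₀ (symbolPoly T (fun α => partialD k (c α)) x)) = 0 := by
    simp only [h1 _ x hx, Pi.single_apply]
    simp only [mul_neg, Finset.sum_neg_distrib, sub_mul, mul_sub, ite_mul, zero_mul, one_mul,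
      mul_ite, mul_zero, Finset.sum_sub_distrib, Finset.sum_ite_eq', Finset.mem_univ, if_true, hξ,
      sub_self, neg_zero]
  rw [Finset.sum_add_distrib, ← Finset.mul_sum, Finset.sum_neg_distrib] at e2
  simp only [mul_add, Finset.sum_add_distrib] at e1 ⊢
  have e3 : ∑ k, 2 * (Pi.single (M := fun _ => ℂ) i 1 k - Pi.single (M := fun _ => ℂ) j 1 k) *
      φ₀ (symbolPoly T (fun α => partialD k (c α)) x) = ∑ k, 2 * ((Pi.single (M := fun _ => ℂ) i 1 k
        - Pi.single (M := fun _ => ℂ) j 1 k) *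
      φ₀ (symbolPoly T (fun α => partialD k (c α)) x)) :=
    Finset.sum_congr rfl fun k _ => by ring
  have e4 : ∑ k, 2 * ξ k * ((x i - x j) * φ₀ (symbolPoly T (fun α => partialD k (c α)) x)) =
      (x i - x j) * ∑ k, 2 * (ξ k * φ₀ (symbolPoly T (fun α => partialD k (c α)) x)) := by
    rw [Finset.mul_sum]; exact Finset.sum_congr rfl fun k _ => by ring
  have e5 : ∑ k, 2 * ξ k * φ₁ (symbolPoly T (fun α => partialD k (c α)) x) =
      ∑ k, 2 * (ξ k * φ₁ (symbolPoly T (fun α => partialD k (c α)) x)) :=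
    Finset.sum_congr rfl fun k _ => by ring
  rw [e3] at e2
  rw [e4, e5] at e1
  linear_combination e1 + e2 - potential x * h0 x hx

theorem potential_eq (x : Fin n → ℂ) :
    potential x = ∑ p ∈ pairs n, 4 * ((x p.1 - x p.2)⁻¹) ^ 2 := by
  rw [potential, sum_Ioi_eq_sum_pairs (fun i j => 4 / (x i - x j) ^ 2)]
  exact Finset.sum_congr rfl fun p _ => by rw [div_eq_mul_inv, inv_pow]

theorem coeff_symbolPoly_partialD (hc : ∀ α ∈ T, AnalyticOnNhd ℂ (c α) (regular n))
    (hx : x ∈ regular n) (k : Fin n) (m : Fin n →₀ ℕ) :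
    coeff m (symbolPoly T (fun α => partialD k (c α)) x) =
      partialD k (fun y => coeff m (symbolPoly T c y)) x :=
  (partialD_symbolPoly hc hx (lcoeff ℂ m) k).symm

/-- By rigidity only the degree N part has to vanish. There the subleading term -2/(x_i - x_j) ·
`vdmErase`, differentiated and paired with 2 ∑ X_k, yields 4/(x_i - x_j)² · vdm for each pair, which
is the potential times the leading form. -/
theorem defect_eq_zero (hn : 2 ≤ n) (hc : ∀ α ∈ T, AnalyticOnNhd ℂ (c α) (regular n))
    (hq : ∀ y ∈ regular n, IsBakerAkhiezer y (symbolPoly T c y)) (hx : x ∈ regular n) :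
    defect T c x = 0 := by
  refine (quasiInvariant_defect hc (fun y hy => (hq y hy).quasiInvariant) hx).eq_zero hx ?_
  have hU := isOpen_regular n
  obtain ⟨K, hK⟩ : ∃ K, n.choose 2 = K + 1 :=
    ⟨n.choose 2 - 1, by have := Nat.choose_pos hn; omega⟩
  have hconst : ∀ m : Fin n →₀ ℕ, K < m.degree → ∀ y ∈ regular n,
      coeff m (symbolPoly T c y) = coeff m (vdm X : MvPolynomial (Fin n) ℂ) := by
    intro m hm y hy
    have h := (hq y hy).leading
    rw [hK, Nat.lt_succ_iff, totalDegree_le_iff_coeff] at h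
    have := h m hm
    rwa [coeff_sub, sub_eq_zero] at this
  have hd1 : ∀ k, ∀ y ∈ regular n,
      (symbolPoly T (fun α => partialD k (c α)) y).totalDegree ≤ K := by
    intro k y hy
    rw [totalDegree_le_iff_coeff]
    intro m hm
    rw [coeff_symbolPoly_partialD hc hy, partialD_congr hU (hconst m hm) k hy, partialD_const]
  have hd2 : ∀ k, (symbolPoly T (fun α => partialD k (partialD k (c α))) x).totalDegree ≤ K := by
    intro k
    rw [totalDegree_le_iff_coeff]
    intro m hm
    rw [coeff_symbolPoly_partialD (fun α hα => analyticOnNhd_partialD hU (hc α hα) k) hx,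
      partialD_congr hU (g := fun _ => 0)
        (fun y hy => totalDegree_le_iff_coeff.1 (hd1 k y hy) m hm) k hx, partialD_const]
  have hd0 : (symbolPoly T c x).totalDegree ≤ K + 1 := by
    rw [totalDegree_le_iff_coeff]
    intro m hm
    rw [hconst m (by omega) x hx]
    exact totalDegree_le_iff_coeff.1 (hK ▸ isHomogeneous_vdm.totalDegree_le) m hm
  have htop : homogeneousComponent (K + 1) (symbolPoly T c x) = vdm X := by
    ext m
    rw [coeff_homogeneousComponent]
    split_ifs with hm
    · exact hconst m (by omega) x hx
    · exact (isHomogeneous_vdm.coeff_eq_zero (by omega)).symm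
  have hsub : ∀ k, homogeneousComponent K (symbolPoly T (fun α => partialD k (c α)) x) =
      ∑ p ∈ pairs n, C (2 * ((x p.1 - x p.2)⁻¹) ^ 2 * (Pi.single (M := fun _ => ℂ) p.1 1 k -
        Pi.single (M := fun _ => ℂ) p.2 1 k)) * vdmErase X p := by
    intro k
    have hE : ∀ p ∈ pairs n, (vdmErase X p : MvPolynomial (Fin n) ℂ).IsHomogeneous K := by
      intro p hp
      have := isHomogeneous_vdmErase (A := ℂ) hp
      rwa [hK, Nat.add_sub_cancel] at this
    ext m
    rw [coeff_homogeneousComponent]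
    split_ifs with hm
    · have e : Set.EqOn (fun y => coeff m (symbolPoly T c y))
          (fun y => ∑ p ∈ pairs n,
            (-2 * coeff m (vdmErase X p : MvPolynomial (Fin n) ℂ)) * (y p.1 - y p.2)⁻¹)
          (regular n) := by
        intro y hy
        have := congrArg (coeff m) ((hq y hy).homogeneousComponent_pred hy hK)
        rw [coeff_homogeneousComponent, if_pos hm, coeff_neg, coeff_sum] at this
        simp only [this, coeff_C_mul]
        rw [← Finset.sum_neg_distrib]
        exact Finset.sum_congr rfl fun p _ => by ring
      have hinv : ∀ p ∈ pairs n, HasFDerivAt (fun y : Fin n → ℂ => (y p.1 - y p.2)⁻¹)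
          (-((x p.1 - x p.2) ^ 2)⁻¹ • (ContinuousLinearMap.proj (R := ℂ) (φ := fun _ : Fin n => ℂ) p.1
            - ContinuousLinearMap.proj (R := ℂ) (φ := fun _ : Fin n => ℂ) p.2)) x := by
        intro p hp
        have h0 : x p.1 - x p.2 ≠ 0 := sub_ne_zero.2 fun e => (mem_pairs.1 hp).ne (hx e)
        exact (hasDerivAt_inv h0).comp_hasFDerivAt x
          ((hasFDerivAt_apply p.1 x).fun_sub (hasFDerivAt_apply p.2 x))
      rw [coeff_symbolPoly_partialD hc hx, partialD_congr hU e k hx,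
        partialD_sum k _ fun p hp => (hinv p hp).differentiableAt.const_mul _, coeff_sum]
      refine Finset.sum_congr rfl fun p hp => ?_
      rw [partialD_const_mul k _ (hinv p hp).differentiableAt,
        partialD_eq_of_hasFDerivAt k (hinv p hp), coeff_C_mul]
      simp [Pi.single_apply, eq_comm]
      ring
    · symm
      rw [coeff_sum]
      refine Finset.sum_eq_zero fun p hp => ?_
      rw [coeff_C_mul, (hE p hp).coeff_eq_zero hm, mul_zero]
  rw [hK, Nat.lt_succ_iff]
  apply totalDegree_le_of_homogeneousComponent_eq_zero
  · refine totalDegree_sub_le (totalDegree_sum_le fun k _ => totalDegree_add_le ?_ ?_) ?_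
    · exact totalDegree_C_mul_le _ (totalDegree_X_mul_le k (hd1 k x hx))
    · exact (hd2 k).trans (Nat.le_succ _)
    · exact totalDegree_C_mul_le _ hd0
  · rw [defect, map_sub, map_sum, homogeneousComponent_C_mul, htop]
    have e : ∀ k, homogeneousComponent (K + 1)
        (C 2 * (X k * symbolPoly T (fun α => partialD k (c α)) x) +
          symbolPoly T (fun α => partialD k (partialD k (c α))) x) =
        ∑ p ∈ pairs n, C (4 * ((x p.1 - x p.2)⁻¹) ^ 2) * (X k * (C (Pi.single (M := fun _ => ℂ) p.1 1 k) -
        C (Pi.single (M := fun _ => ℂ) p.2 1 k)) * vdmErase X p) := by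
      intro k
      rw [map_add, homogeneousComponent_eq_zero _ _ (Nat.lt_succ_of_le (hd2 k)), add_zero,
        homogeneousComponent_C_mul, homogeneousComponent_X_mul, hsub k, Finset.mul_sum,
        Finset.mul_sum]
      refine Finset.sum_congr rfl fun p _ => ?_
      rw [show (4 : ℂ) = 2 * 2 by norm_num]
      simp only [map_mul, map_sub]
      ring
    rw [Finset.sum_congr rfl fun k _ => e k, Finset.sum_comm, potential_eq, map_sum,
      Finset.sum_mul, ← Finset.sum_sub_distrib]
    refine Finset.sum_eq_zero fun p hp => ?_
    rw [← Finset.mul_sum, ← Finset.sum_mul, sub_eq_zero, ← mul_vdmErase X hp]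
    congr 2
    simp [mul_sub, Pi.single_apply, apply_ite (C : ℂ →+* MvPolynomial (Fin n) ℂ)]

end Defect

/-! ### Values of rational functions -/

section EvalRat
variable {n : ℕ}

/-- The denominator of a rational function. -/
def denom (a : RatField n) : MvPolynomial (Fin n) ℂ :=
  (IsFractionRing.den (MvPolynomial (Fin n) ℂ) a : MvPolynomial (Fin n) ℂ)

theorem denom_ne_zero (a : RatField n) : denom a ≠ 0 :=
  nonZeroDivisors.ne_zero (IsFractionRing.den (MvPolynomial (Fin n) ℂ) a).2

theorem algebraMap_denom_mul (a : RatField n) :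
    algebraMap (MvPolynomial (Fin n) ℂ) (RatField n)
      (IsFractionRing.num (MvPolynomial (Fin n) ℂ) a) =
      algebraMap (MvPolynomial (Fin n) ℂ) (RatField n) (denom a) * a := by
  have h := IsFractionRing.mk'_num_den' (MvPolynomial (Fin n) ℂ) a
  have h0 : algebraMap (MvPolynomial (Fin n) ℂ) (RatField n) (denom a) ≠ 0 := by
    rw [Ne, IsFractionRing.to_map_eq_zero_iff]; exact denom_ne_zero a
  rw [mul_comm]; exact (div_eq_iff h0).1 h

theorem eval_num_mul {a : RatField n} {p q : MvPolynomial (Fin n) ℂ}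
    (h : algebraMap _ (RatField n) q * a = algebraMap _ (RatField n) p) (x : Fin n → ℂ) :
    eval x (IsFractionRing.num (MvPolynomial (Fin n) ℂ) a) * eval x q =
      eval x p * eval x (denom a) := by
  rw [← map_mul, ← map_mul]
  congr 1
  apply IsFractionRing.injective (MvPolynomial (Fin n) ℂ) (RatField n)
  rw [map_mul, map_mul, ← h, algebraMap_denom_mul]
  ring

/-- Numerator and denominator of the reduced fraction are coprime. So a rational function is regular
wherever some fraction representing it has nonzero denominator. -/
theorem denom_dvd {a : RatField n} {p q : MvPolynomial (Fin n) ℂ}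
    (h : algebraMap _ (RatField n) q * a = algebraMap _ (RatField n) p) : denom a ∣ q := by
  have e : IsFractionRing.num (MvPolynomial (Fin n) ℂ) a * q = p * denom a := by
    apply IsFractionRing.injective (MvPolynomial (Fin n) ℂ) (RatField n)
    rw [map_mul, map_mul, ← h, algebraMap_denom_mul]
    ring
  have hrel : IsRelPrime (denom a) (IsFractionRing.num (MvPolynomial (Fin n) ℂ) a) :=
    (IsFractionRing.num_den_reduced (MvPolynomial (Fin n) ℂ) a).symm
  exact hrel.dvd_of_dvd_mul_left ⟨p, by rw [e, mul_comm]⟩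

theorem evalRat_eq {a : RatField n} {p q : MvPolynomial (Fin n) ℂ}
    (h : algebraMap _ (RatField n) q * a = algebraMap _ (RatField n) p) {x : Fin n → ℂ}
    (hx : eval x q ≠ 0) : evalRat a x = eval x p / eval x q := by
  have hd : eval x (denom a) ≠ 0 := by
    obtain ⟨r, hr⟩ := denom_dvd h
    intro h0
    rw [hr, map_mul, h0, zero_mul] at hx
    exact hx rfl
  exact (div_eq_div_iff hd hx).2 (eval_num_mul h x)

theorem analyticOnNhd_eval (p : MvPolynomial (Fin n) ℂ) (U : Set (Fin n → ℂ)) :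
    AnalyticOnNhd ℂ (fun x => eval x p) U := by
  intro x _
  induction p using MvPolynomial.induction_on with
  | C a => simpa using analyticAt_const
  | add p q hp hq => simpa using hp.fun_add hq
  | mul_X p k hp =>
    simpa using hp.fun_mul ((ContinuousLinearMap.proj (R := ℂ) (φ := fun _ : Fin n => ℂ) k).analyticAt x)

theorem analyticOnNhd_evalRat {a : RatField n} {U : Set (Fin n → ℂ)}
    (hU : ∀ x ∈ U, eval x (denom a) ≠ 0) : AnalyticOnNhd ℂ (evalRat a) U := fun x hx =>
  (analyticOnNhd_eval _ U x hx).div (analyticOnNhd_eval _ U x hx) (hU x hx)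

end EvalRat

/-! ### Construction of the intertwiner -/

section Intertwiner
variable {n : ℕ}

/-- The coefficient functions of a differential operator. -/
def DiffOp.coeffFun (D : DiffOp n) (α : Fin n →₀ ℕ) : (Fin n → ℂ) → ℂ := evalRat (coeff α D)

/-- The symbol at `x` as a polynomial. -/
def DiffOp.polyAt (D : DiffOp n) (x : Fin n → ℂ) : MvPolynomial (Fin n) ℂ :=
  symbolPoly D.support D.coeffFun x

theorem DiffOp.act_eq_jet (D : DiffOp n) (f : (Fin n → ℂ) → ℂ) (x : Fin n → ℂ) :
    D.act f x = jet f x (D.polyAt x) := (jet_symbolPoly _ _).symm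

theorem DiffOp.symbol_eq_eval (D : DiffOp n) (x ξ : Fin n → ℂ) :
    D.symbol x ξ = eval ξ (D.polyAt x) := by
  rw [DiffOp.polyAt, symbolPoly, map_sum]
  refine Finset.sum_congr rfl fun α _ => ?_
  rw [eval_monomial, Finsupp.prod_fintype _ _ (by simp)]
  rfl

theorem evalRat_zero (x : Fin n → ℂ) : evalRat (0 : RatField n) x = 0 := by
  rw [evalRat, IsFractionRing.num_zero, map_zero, zero_div]

theorem coeff_symbolPoly {T : Finset (Fin n →₀ ℕ)} {c : (Fin n →₀ ℕ) → (Fin n → ℂ) → ℂ}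
    (x : Fin n → ℂ) (α : Fin n →₀ ℕ) :
    coeff α (symbolPoly T c x) = if α ∈ T then c α x else 0 := by
  classical
  rw [symbolPoly, coeff_sum]
  simp [coeff_monomial]

theorem DiffOp.coeff_polyAt (D : DiffOp n) (x : Fin n → ℂ) (α : Fin n →₀ ℕ) :
    coeff α (D.polyAt x) = evalRat (coeff α D) x := by
  rw [DiffOp.polyAt, coeff_symbolPoly]
  split_ifs with h
  · rfl
  · rw [notMem_support_iff.1 h, evalRat_zero]

variable (hn : 2 ≤ n)

/-- The difference product as a rational function. -/
def vdmRat (n : ℕ) : RatField n := algebraMap (MvPolynomial (Fin n) ℂ) (RatField n) (vdm X)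

theorem vdmRat_ne_zero : vdmRat n ≠ 0 := by
  rw [vdmRat, Ne, IsFractionRing.to_map_eq_zero_iff]; exact vdm_X_ne_zero

/-- The Chalykh-Veselov intertwiner. -/
def intertwiner : DiffOp n :=
  C (vdmRat n)⁻¹ * MvPolynomial.map (algebraMap (MvPolynomial (Fin n) ℂ) (RatField n)) (baNum n hn)

theorem vdmRat_mul_coeff_intertwiner (α : Fin n →₀ ℕ) :
    algebraMap (MvPolynomial (Fin n) ℂ) (RatField n) (vdm X) * coeff α (intertwiner hn) =
      algebraMap (MvPolynomial (Fin n) ℂ) (RatField n) (coeff α (baNum n hn)) := by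
  rw [intertwiner, coeff_C_mul, coeff_map, ← mul_assoc]
  rw [show algebraMap (MvPolynomial (Fin n) ℂ) (RatField n) (vdm X) = vdmRat n from rfl,
    mul_inv_cancel₀ vdmRat_ne_zero, one_mul]

theorem eval_vdm (x : Fin n → ℂ) : eval x (vdm X) = vdm x := by
  rw [map_vdm]; simp

theorem evalRat_coeff_intertwiner {x : Fin n → ℂ} (hx : x ∈ regular n) (α : Fin n →₀ ℕ) :
    evalRat (coeff α (intertwiner hn)) x = coeff α (ba hn x) := by
  have h0 := (vdm_ne_zero_iff x).2 hx
  rw [evalRat_eq (vdmRat_mul_coeff_intertwiner hn α) (by rwa [eval_vdm]), eval_vdm, ba, coeff_C_mul,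
    coeff_map, div_eq_inv_mul]

theorem polyAt_intertwiner {x : Fin n → ℂ} (hx : x ∈ regular n) :
    (intertwiner hn).polyAt x = ba hn x := by
  ext α
  rw [DiffOp.coeff_polyAt, evalRat_coeff_intertwiner hn hx]

theorem eval_denom_coeff_intertwiner {x : Fin n → ℂ} (hx : x ∈ regular n) (α : Fin n →₀ ℕ) :
    eval x (denom (coeff α (intertwiner hn))) ≠ 0 := by
  obtain ⟨r, hr⟩ := denom_dvd (vdmRat_mul_coeff_intertwiner hn α)
  have h0 := (vdm_ne_zero_iff x).2 hx
  rw [← eval_vdm, hr, map_mul] at h0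
  exact left_ne_zero_of_mul h0

theorem analyticOnNhd_coeffFun_intertwiner (α : Fin n →₀ ℕ) :
    AnalyticOnNhd ℂ ((intertwiner hn).coeffFun α) (regular n) :=
  analyticOnNhd_evalRat fun _ hx => eval_denom_coeff_intertwiner hn hx α

theorem defect_intertwiner {x : Fin n → ℂ} (hx : x ∈ regular n) :
    defect (intertwiner hn).support (intertwiner hn).coeffFun x = 0 :=
  defect_eq_zero hn (fun α _ => analyticOnNhd_coeffFun_intertwiner hn α)
    (fun y hy => by
      have := isBakerAkhiezer_ba hn hy
      rwa [← polyAt_intertwiner hn hy] at this) hx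

theorem intertwiner_intertwines {f : (Fin n → ℂ) → ℂ} (hf : AnalyticOnNhd ℂ f (regular n))
    {x : Fin n → ℂ} (hx : x ∈ regular n) :
    (intertwiner hn).act (laplacian f) x = laplacianTilde ((intertwiner hn).act f) x := by
  have h := laplacianTilde_jet (isOpen_regular n) hf
    (fun α (_ : α ∈ (intertwiner hn).support) => analyticOnNhd_coeffFun_intertwiner hn α) hx
  rw [defect_intertwiner hn hx, map_zero, add_zero] at h
  rw [DiffOp.act_eq_jet]
  have e : (intertwiner hn).act f = fun y => jet f y (symbolPoly (intertwiner hn).support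
      (intertwiner hn).coeffFun y) := funext fun y => DiffOp.act_eq_jet _ _ _
  rw [e, h]
  rfl

theorem intertwiner_leading : ((intertwiner hn) - vdm X).totalDegree < n.choose 2 := by
  have e : intertwiner hn - vdm X = C (vdmRat n)⁻¹ *
      MvPolynomial.map (algebraMap (MvPolynomial (Fin n) ℂ) (RatField n))
        (baNum n hn - C (vdm (X : Fin n → MvPolynomial (Fin n) ℂ)) * vdm X) := by
    rw [map_sub, map_mul, map_C,
      map_vdm (MvPolynomial.map (algebraMap (MvPolynomial (Fin n) ℂ) (RatField n))), mul_sub, ← intertwiner,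
      ← mul_assoc, ← map_mul]
    simp only [map_X]
    rw [show algebraMap (MvPolynomial (Fin n) ℂ) (RatField n) (vdm X) = vdmRat n from rfl,
      inv_mul_cancel₀ vdmRat_ne_zero, map_one, one_mul]
  rw [e]
  exact (totalDegree_C_mul_le _ (totalDegree_map_eval_le _ _)).trans_lt (baNum_leading hn)

theorem intertwiner_homogeneous {t : ℂ} (ht : t ≠ 0) {x : Fin n → ℂ} (hx : x ∈ regular n)
    (ξ : Fin n → ℂ) : (intertwiner hn).symbol (t • x) (t⁻¹ • ξ) =
      (t ^ n.choose 2)⁻¹ * (intertwiner hn).symbol x ξ := by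
  rw [DiffOp.symbol_eq_eval, DiffOp.symbol_eq_eval, polyAt_intertwiner hn hx,
    polyAt_intertwiner hn (smul_mem_regular ht hx), ba_smul hn ht hx, map_mul, eval_C,
    eval_affineSubst]
  congr 3
  ext k
  simp [ht]

/-- The base point used to express translation invariant polynomials through differences. -/
def base : Fin n := ⟨0, by omega⟩

/-- The substitution `X_k ↦ X_k - X_0`. -/
def subBase (R : Type*) [CommRing R] :
    MvPolynomial (Fin n) R →ₐ[R] MvPolynomial (Fin n) R := aeval fun k => X k - X (base hn)

theorem eval_subBase {R : Type*} [CommRing R] (ξ : Fin n → R) (p : MvPolynomial (Fin n) R) :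
    eval ξ (subBase hn R p) = eval (fun k => ξ k + -ξ (base hn)) p := by
  rw [subBase]
  induction p using MvPolynomial.induction_on with
  | C a => simp
  | add p q hp hq => simp only [map_add, hp, hq]
  | mul_X p k hp =>
    rw [map_mul, map_mul, hp, aeval_X, map_sub, eval_X, eval_X, map_mul, eval_X, sub_eq_add_neg]

theorem map_subBase {R S : Type*} [CommRing R] [CommRing S] (φ : R →+* S)
    (P : MvPolynomial (Fin n) R) :
    MvPolynomial.map φ (subBase hn R P) = subBase hn S (MvPolynomial.map φ P) := by
  rw [subBase, subBase]
  induction P using MvPolynomial.induction_on with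
  | C a => simp
  | add p q hp hq => simp only [map_add, hp, hq]
  | mul_X p k hp => simp only [map_mul, hp, aeval_X, map_sub, map_X]

/-- Translation invariance of B_x in ξ, used with the shift -ξ_0, writes B_x through the differences
ξ_k - ξ_0. -/
theorem subBase_ba {x : Fin n → ℂ} (hx : x ∈ regular n) :
    subBase hn ℂ (ba hn x) = ba hn x := by
  apply MvPolynomial.funext
  intro ξ
  have h := congrArg (eval ξ) (affineSubst_ba hn (-ξ (base hn)) hx)
  rw [eval_affineSubst] at h
  rw [eval_subBase, ← h]
  simp only [one_mul]

theorem eq_of_map_eval_regular {P Q : MvPolynomial (Fin n) (MvPolynomial (Fin n) ℂ)}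
    (h : ∀ x ∈ regular n, MvPolynomial.map (eval x) P = MvPolynomial.map (eval x) Q) : P = Q := by
  ext1 α
  rw [← sub_eq_zero]
  apply eq_zero_of_eval_regular
  intro x hx
  have := congrArg (coeff α) (h x hx)
  rw [coeff_map, coeff_map] at this
  rw [map_sub, this, sub_self]

theorem subBase_baNum : subBase hn (MvPolynomial (Fin n) ℂ) (baNum n hn) = baNum n hn := by
  apply eq_of_map_eval_regular
  intro x hx
  rw [map_subBase, map_baNum hn hx, map_mul, subBase_ba hn hx]
  simp [subBase]

/-- The same for the variable x: both vdm x and B_x are unchanged when x is translated by a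
constant. -/
theorem subBase_coeff_baNum (α : Fin n →₀ ℕ) :
    subBase hn ℂ (coeff α (baNum n hn)) = coeff α (baNum n hn) := by
  rw [← sub_eq_zero]
  apply eq_zero_of_eval_regular
  intro x hx
  have hm : MvPolynomial.map (eval fun k => x k + -x (base hn)) (baNum n hn) =
      MvPolynomial.map (eval x) (baNum n hn) := by
    rw [map_baNum hn hx, map_baNum hn (add_const_mem_regular _ hx), vdm_add_const,
      ba_add_const hn _ hx]
  have := congrArg (coeff α) hm
  rw [coeff_map, coeff_map] at this
  rw [map_sub, eval_subBase, this, sub_self]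

theorem aeval_mem_subalgebra {R S : Type*} [CommRing R] [CommRing S] [Algebra R S]
    (B : Subalgebra R S) {g : Fin n → S} (hg : ∀ k, g k ∈ B) (p : MvPolynomial (Fin n) R) :
    aeval g p ∈ B := by
  induction p using MvPolynomial.induction_on with
  | C a => rw [aeval_C]; exact B.algebraMap_mem a
  | add p q hp hq => rw [map_add]; exact B.add_mem hp hq
  | mul_X p k hp => rw [map_mul, aeval_X]; exact B.mul_mem hp (hg k)

theorem X_sub_X_mem_diffField (i j : Fin n) :
    algebraMap (MvPolynomial (Fin n) ℂ) (RatField n) (X i - X j) ∈ diffField n :=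
  IntermediateField.subset_adjoin _ _ ⟨i, j, rfl⟩

theorem vdmRat_mem_diffField : vdmRat n ∈ diffField n := by
  rw [vdmRat, vdm, map_prod]
  refine prod_mem fun i _ => ?_
  rw [map_prod]
  exact prod_mem fun j _ => X_sub_X_mem_diffField i j

theorem coeff_intertwiner_mem_diffField (α : Fin n →₀ ℕ) :
    coeff α (intertwiner hn) ∈ diffField n := by
  rw [intertwiner, coeff_C_mul, coeff_map]
  refine (diffField n).mul_mem ((diffField n).inv_mem vdmRat_mem_diffField) ?_
  rw [← subBase_coeff_baNum hn α, subBase]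
  have e : ∀ p : MvPolynomial (Fin n) ℂ, algebraMap (MvPolynomial (Fin n) ℂ) (RatField n)
      (aeval (fun k => (X k - X (base hn) : MvPolynomial (Fin n) ℂ)) p) =
      aeval (fun k => algebraMap (MvPolynomial (Fin n) ℂ) (RatField n) (X k - X (base hn))) p := by
    intro p
    induction p using MvPolynomial.induction_on with
    | C a =>
      rw [aeval_C, aeval_C, ← IsScalarTower.algebraMap_apply]
    | add p q hp hq => simp only [map_add, hp, hq]
    | mul_X p k hp => rw [map_mul, map_mul, map_mul, hp, aeval_X, aeval_X]
  rw [e]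
  exact aeval_mem_subalgebra (diffField n).toSubalgebra (fun k => X_sub_X_mem_diffField _ _) _

theorem subBase_intertwiner : subBase hn (RatField n) (intertwiner hn) = intertwiner hn := by
  rw [intertwiner, map_mul, ← map_subBase, subBase_baNum]
  simp [subBase]

theorem intertwiner_mem_adjoin : intertwiner hn ∈ Algebra.adjoin (diffField n)
    {P : DiffOp n | ∃ i j : Fin n, P = X i - X j} := by
  set S := Algebra.adjoin (diffField n) {P : DiffOp n | ∃ i j : Fin n, P = X i - X j}
  rw [← subBase_intertwiner hn, subBase, aeval_def, eval₂_eq]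
  refine sum_mem fun α _ => mul_mem ?_ (prod_mem fun k _ => pow_mem ?_ _)
  · exact S.algebraMap_mem ⟨_, coeff_intertwiner_mem_diffField hn α⟩
  · exact Algebra.subset_adjoin ⟨k, base hn, rfl⟩

theorem isChalykhVeselov_intertwiner : IsChalykhVeselov (intertwiner hn) where
  mem_adjoin := intertwiner_mem_adjoin hn
  intertwines _ hf _ hx := intertwiner_intertwines hn hf hx
  leading := intertwiner_leading hn
  homogeneous _ ht _ hx ξ := intertwiner_homogeneous hn ht hx ξ

end Intertwiner

/-! ### Uniqueness: functions homogeneous and constant along a direction -/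

section Ray
variable {n : ℕ}

/-- A function which is constant along the direction `ξ` and homogeneous of negative degree
vanishes near `ξ`. -/
theorem eq_zero_of_euler {x₀ : Fin n → ℂ} {r : ℝ} {h : (Fin n → ℂ) → ℂ}
    (hh : AnalyticOnNhd ℂ h (Metric.ball x₀ r)) {m : ℕ} (hm : m ≠ 0) {ξ x : Fin n → ℂ}
    (hξ : ξ ∈ Metric.ball x₀ r) (hx : x ∈ Metric.ball x₀ r)
    (h1 : ∀ y ∈ Metric.ball x₀ r, ∑ k, ξ k * partialD k h y = 0)
    (h2 : ∀ y ∈ Metric.ball x₀ r, ∑ k, y k * partialD k h y = -(m : ℂ) * h y) : h x = 0 := by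
  -- On the segment from ξ to x one has s γ' = γ - ξ, so s · d/ds h(γ s) = -m h(γ s) by the two
  -- hypotheses. Hence s^m h(γ s) is constant; it is 0 at s = 0 and h x at s = 1.
  set γ : ℂ → (Fin n → ℂ) := fun s => ξ + s • (x - ξ) with hγ
  have hmem : ∀ s : ℝ, s ∈ Set.Icc (0 : ℝ) 1 → γ s ∈ Metric.ball x₀ r := by
    intro s hs
    have := (convex_ball x₀ r).add_smul_sub_mem hξ hx hs
    convert! this using 1
  have hderiv : ∀ s : ℝ, s ∈ Set.Icc (0 : ℝ) 1 →
      HasDerivAt (fun s : ℝ => (s : ℂ) ^ m * h (γ s)) 0 s := by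
    intro s hs
    have hγs := hmem s hs
    have hg : HasDerivAt γ (x - ξ) (s : ℂ) := by
      have h := ((hasDerivAt_id (s : ℂ)).smul_const (x - ξ)).const_add ξ
      rw [one_smul] at h
      exact h
    have hd := (hh _ hγs).differentiableAt.hasFDerivAt
    have hc := hd.comp_hasDerivAt (s : ℂ) hg
    have hp := (hasDerivAt_pow m (s : ℂ)).mul hc
    have e : fderiv ℂ h (γ s) (x - ξ) = ∑ k, (x k - ξ k) * partialD k h (γ s) := by
      conv_lhs => rw [← Finset.univ_sum_single (x - ξ), map_sum]
      refine Finset.sum_congr rfl fun k _ => ?_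
      rw [partialD_eq_fderiv k (hh _ hγs).differentiableAt, ← smul_eq_mul, ← map_smul]
      congr 1
      ext l
      by_cases hl : l = k
      · subst hl; simp
      · simp [hl]
    have e2 : (s : ℂ) * ∑ k, (x k - ξ k) * partialD k h (γ s) = -(m : ℂ) * h (γ s) := by
      rw [← h2 _ hγs, ← sub_zero (∑ k, (γ s) k * _), ← h1 _ hγs, Finset.mul_sum,
        ← Finset.sum_sub_distrib]
      refine Finset.sum_congr rfl fun k _ => ?_
      simp only [hγ, Pi.add_apply, Pi.smul_apply, Pi.sub_apply, smul_eq_mul]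
      ring
    have hfin := hp.comp_ofReal
    have e3 : (m : ℂ) * (s : ℂ) ^ (m - 1) * (h ∘ γ) s + (s : ℂ) ^ m * (fderiv ℂ h (γ s)) (x - ξ)
        = 0 := by
      rw [e]
      obtain ⟨l, rfl⟩ := Nat.exists_eq_succ_of_ne_zero hm
      rw [Nat.succ_sub_one, pow_succ, mul_assoc ((s : ℂ) ^ l), e2]
      simp only [Function.comp_apply]
      ring
    rw [e3] at hfin
    exact hfin
  have := constant_of_has_deriv_right_zero
    (fun s hs => (hderiv s hs).continuousAt.continuousWithinAt)
    (fun s hs => (hderiv s ⟨hs.1, hs.2.le⟩).hasDerivWithinAt) 1 (by simp)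
  simpa [hγ, hm] using this

theorem eq_zero_of_eval_ball {F : MvPolynomial (Fin n) ℂ} {x₀ : Fin n → ℂ} {r : ℝ} (hr : 0 < r)
    (h : ∀ x ∈ Metric.ball x₀ r, eval x F = 0) : F = 0 := by
  refine funext_set (fun i => Metric.ball (x₀ i) r) (fun i => ?_) fun x hx => ?_
  · exact infinite_of_mem_nhds (x₀ i) (Metric.ball_mem_nhds _ hr)
  · rw [map_zero]
    refine h x ?_
    rw [ball_pi _ hr]
    exact hx

end Ray

/-! ### Uniqueness: homogeneous solutions of low order vanish -/

section Homogeneous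
variable {n : ℕ} {T : Finset (Fin n →₀ ℕ)} {c : (Fin n →₀ ℕ) → (Fin n → ℂ) → ℂ}
  {U : Set (Fin n → ℂ)}

/-- A homogeneous solution of order less than `N` of the intertwining equation vanishes. -/
theorem coeff_eq_zero_of_defect_eq_zero (hU : IsOpen U) {N : ℕ}
    (hc : ∀ α ∈ T, AnalyticOnNhd ℂ (c α) U) (hdef : ∀ x ∈ U, defect T c x = 0)
    (hdeg : ∀ x ∈ U, ∀ α : Fin n →₀ ℕ, N ≤ α.degree → coeff α (symbolPoly T c x) = 0)
    (heuler : ∀ x ∈ U, ∀ α : Fin n →₀ ℕ,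
      ∑ k, x k * partialD k (fun y => coeff α (symbolPoly T c y)) x =
        ((α.degree : ℂ) - N) * coeff α (symbolPoly T c x)) :
    ∀ x ∈ U, symbolPoly T c x = 0 := by
  have hcoeff : ∀ (c : (Fin n →₀ ℕ) → (Fin n → ℂ) → ℂ), (∀ α ∈ T, AnalyticOnNhd ℂ (c α) U) →
      ∀ x ∈ U, ∀ k α, coeff α (symbolPoly T (fun α => partialD k (c α)) x) =
        partialD k (fun y => coeff α (symbolPoly T c y)) x := fun c hc x hx k α =>
    (partialD_symbolPoly hc hx (lcoeff ℂ α) k).symm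
  -- Descending induction on the order: step j treats the coefficients of degree at least N - j.
  suffices h : ∀ j, ∀ x ∈ U, ∀ α : Fin n →₀ ℕ, N ≤ α.degree + j →
      coeff α (symbolPoly T c x) = 0 by
    intro x hx
    ext α
    rw [coeff_zero]
    exact h N x hx α (Nat.le_add_left _ _)
  intro j
  induction j with
  | zero => exact fun x hx α hα => hdeg x hx α hα
  | succ j ih =>
    intro x₀ hx₀ α hα
    by_cases hα' : N ≤ α.degree + j
    · exact ih x₀ hx₀ α hα'
    set d := α.degree with hd
    have hN : N = d + (j + 1) := by omega
    have hz : ∀ x ∈ U, ∀ β : Fin n →₀ ℕ, d < β.degree → coeff β (symbolPoly T c x) = 0 :=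
      fun x hx β hβ => ih x hx β (by omega)
    have hz1 : ∀ k, ∀ x ∈ U, ∀ β : Fin n →₀ ℕ, d < β.degree →
        coeff β (symbolPoly T (fun α => partialD k (c α)) x) = 0 := by
      intro k x hx β hβ
      rw [hcoeff c hc x hx, partialD_congr hU (g := fun _ => 0) (fun y hy => hz y hy β hβ) k hx,
        partialD_const]
    have hz2 : ∀ k, ∀ x ∈ U, ∀ β : Fin n →₀ ℕ, d < β.degree →
        coeff β (symbolPoly T (fun α => partialD k (partialD k (c α))) x) = 0 := by
      intro k x hx β hβ
      rw [hcoeff _ (fun α hα => analyticOnNhd_partialD hU (hc α hα) k) x hx,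
        partialD_congr hU (g := fun _ => 0) (fun y hy => hz1 k y hy β hβ) k hx, partialD_const]
    have hhc : ∀ F : MvPolynomial (Fin n) ℂ, (∀ β : Fin n →₀ ℕ, d < β.degree → coeff β F = 0) →
        homogeneousComponent (d + 1) F = 0 := fun F hF =>
      homogeneousComponent_eq_zero _ _ (Nat.lt_succ_of_le (totalDegree_le_iff_coeff.2 hF))
    -- With all higher coefficients gone, degree d + 1 of the defect consists only of 2 ∑ X_k ∂_k of
    -- the degree d part: its value at ξ is constant in x along ξ.
    have htr : ∀ x ∈ U, ∑ k, X k * homogeneousComponent d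
        (symbolPoly T (fun α => partialD k (c α)) x) = 0 := by
      intro x hx
      have h := congrArg (homogeneousComponent (d + 1)) (hdef x hx)
      rw [defect, map_sub, map_sum, homogeneousComponent_C_mul, hhc _ (hz x hx), mul_zero,
        sub_zero, map_zero] at h
      simp only [map_add, homogeneousComponent_C_mul, homogeneousComponent_X_mul,
        hhc _ (hz2 _ x hx), add_zero] at h
      rw [← Finset.mul_sum] at h
      refine (mul_eq_zero.1 h).resolve_left ?_
      rw [C_eq_zero]; exact two_ne_zero
    obtain ⟨r, hr, hball⟩ := Metric.isOpen_iff.1 hU x₀ hx₀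
    have hzero : homogeneousComponent d (symbolPoly T c x₀) = 0 := by
      -- Taking ξ in a ball around x₀ inside U keeps the segment from ξ to x₀ inside U; a polynomial
      -- vanishing on that ball is zero.
      refine eq_zero_of_eval_ball hr (x₀ := x₀) fun ξ hξ => ?_
      set φ : MvPolynomial (Fin n) ℂ →ₗ[ℂ] ℂ := (aeval ξ).toLinearMap ∘ₗ homogeneousComponent d
        with hφ
      have hφe : ∀ F, φ F = eval ξ (homogeneousComponent d F) := fun F => by
        simp [hφ]
      rw [← hφe]
      have hcb : ∀ α ∈ T, AnalyticOnNhd ℂ (c α) (Metric.ball x₀ r) := fun α hα =>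
        (hc α hα).mono hball
      refine eq_zero_of_euler (h := fun y => φ (symbolPoly T c y)) (m := j + 1)
        (analyticOnNhd_symbolPoly hcb φ) (Nat.succ_ne_zero j) hξ (Metric.mem_ball_self hr) ?_ ?_
      · intro y hy
        have := congrArg (eval ξ) (htr y (hball hy))
        rw [map_sum, map_zero] at this
        rw [← this]
        refine Finset.sum_congr rfl fun k _ => ?_
        rw [partialD_symbolPoly hcb hy, hφe, map_mul, eval_X]
      · intro y hy
        have hpoly : ∑ k, C (y k) * homogeneousComponent d
            (symbolPoly T (fun α => partialD k (c α)) y) =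
            C (-((j + 1 : ℕ) : ℂ)) * homogeneousComponent d (symbolPoly T c y) := by
          ext β
          rw [coeff_sum, coeff_C_mul]
          simp only [coeff_C_mul, coeff_homogeneousComponent]
          split_ifs with hβ
          · simp only [hcoeff c hc y (hball hy)]
            rw [heuler y (hball hy) β, hβ, hN]
            push_cast; ring
          · simp
        have := congrArg (eval ξ) hpoly
        rw [map_sum, map_mul, eval_C, ← hφe] at this
        rw [← this]
        refine Finset.sum_congr rfl fun k _ => ?_
        rw [partialD_symbolPoly hcb hy, hφe, map_mul, eval_C]
    have := congrArg (coeff α) hzero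
    rwa [coeff_homogeneousComponent, if_pos rfl, coeff_zero] at this

end Homogeneous

/-! ### Uniqueness of the intertwiner -/

section Unique
variable {n : ℕ}

theorem laplacianTilde_sub {U : Set (Fin n → ℂ)} (hU : IsOpen U) {f g : (Fin n → ℂ) → ℂ}
    (hf : AnalyticOnNhd ℂ f U) (hg : AnalyticOnNhd ℂ g U) {x : Fin n → ℂ} (hx : x ∈ U) :
    laplacianTilde (fun y => f y - g y) x = laplacianTilde f x - laplacianTilde g x := by
  have hs : ∀ {f g : (Fin n → ℂ) → ℂ}, AnalyticOnNhd ℂ f U → AnalyticOnNhd ℂ g U → ∀ k,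
      Set.EqOn (partialD k (fun y => f y - g y)) (fun y => partialD k f y - partialD k g y) U := by
    intro f g hf hg k y hy
    have hf' := (hf y hy).differentiableAt
    have hg' := (hg y hy).differentiableAt
    rw [partialD_eq_of_hasFDerivAt k (hf'.hasFDerivAt.fun_sub hg'.hasFDerivAt)]
    simp only [_root_.sub_apply, partialD_eq_fderiv k hf', partialD_eq_fderiv k hg']
  have e : ∀ k, partialD k (partialD k (fun y => f y - g y)) x =
      partialD k (partialD k f) x - partialD k (partialD k g) x := fun k => by
    rw [partialD_congr hU (hs hf hg k) k hx,
      hs (analyticOnNhd_partialD hU hf k) (analyticOnNhd_partialD hU hg k) k hx]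
  simp only [laplacianTilde, laplacian, e, Finset.sum_sub_distrib]
  ring

theorem eval_denom_zero (x : Fin n → ℂ) : eval x (denom (0 : RatField n)) ≠ 0 := by
  have : denom (0 : RatField n) ∣ 1 := denom_dvd (p := 0) (by simp)
  obtain ⟨r, hr⟩ := this
  intro h
  have := congrArg (eval x) hr
  rw [map_mul, h, zero_mul, map_one] at this
  exact one_ne_zero this

/-- The common denominator of the coefficients, times the difference product. -/
def DiffOp.commonDenom (D : DiffOp n) : MvPolynomial (Fin n) ℂ :=
  vdm X * ∏ α ∈ D.support, denom (coeff α D)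

/-- The points of `regular n` at which all coefficients of `D` are regular. -/
def DiffOp.regularSet (D : DiffOp n) : Set (Fin n → ℂ) := {x | eval x D.commonDenom ≠ 0}

theorem DiffOp.isOpen_regularSet (D : DiffOp n) : IsOpen D.regularSet :=
  isOpen_ne_fun (MvPolynomial.continuous_eval _) continuous_const

theorem DiffOp.mem_regularSet {D : DiffOp n} {x : Fin n → ℂ} (hx : x ∈ D.regularSet) :
    x ∈ regular n ∧ ∀ α, eval x (denom (coeff α D)) ≠ 0 := by
  have h : eval x D.commonDenom ≠ 0 := hx
  rw [DiffOp.commonDenom, map_mul, eval_vdm, map_prod] at h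
  refine ⟨(vdm_ne_zero_iff x).1 (left_ne_zero_of_mul h), fun α => ?_⟩
  by_cases hα : α ∈ D.support
  · exact Finset.prod_ne_zero_iff.1 (right_ne_zero_of_mul h) α hα
  · rw [notMem_support_iff.1 hα]; exact eval_denom_zero x

theorem DiffOp.commonDenom_ne_zero (D : DiffOp n) : D.commonDenom ≠ 0 :=
  mul_ne_zero vdm_X_ne_zero (Finset.prod_ne_zero_iff.2 fun _ _ => denom_ne_zero _)

theorem eq_of_evalRat_eq {D : DiffOp n} {a b : RatField n}
    (h : ∀ x ∈ D.regularSet, eval x (denom a) ≠ 0 ∧ eval x (denom b) ≠ 0 ∧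
      evalRat a x = evalRat b x) : a = b := by
  set N := IsFractionRing.num (MvPolynomial (Fin n) ℂ) a * denom b -
    IsFractionRing.num (MvPolynomial (Fin n) ℂ) b * denom a with hN
  have h0 : D.commonDenom * N = 0 := by
    apply MvPolynomial.funext
    intro x
    rw [map_mul, map_zero]
    by_cases hx : eval x D.commonDenom = 0
    · rw [hx, zero_mul]
    · obtain ⟨h1, h2, h3⟩ := h x hx
      have := (div_eq_div_iff h1 h2).1 h3
      rw [hN, map_sub, map_mul, map_mul, this, sub_self, mul_zero]
  have hN0 := (mul_eq_zero.1 h0).resolve_left D.commonDenom_ne_zero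
  rw [hN, sub_eq_zero] at hN0
  have e := congrArg (algebraMap (MvPolynomial (Fin n) ℂ) (RatField n)) hN0
  rw [map_mul, map_mul, algebraMap_denom_mul, algebraMap_denom_mul] at e
  have hne : ∀ a : RatField n, algebraMap (MvPolynomial (Fin n) ℂ) (RatField n) (denom a) ≠ 0 :=
    fun a => by rw [Ne, IsFractionRing.to_map_eq_zero_iff]; exact denom_ne_zero a
  apply mul_left_cancel₀ (mul_ne_zero (hne a) (hne b))
  linear_combination e

theorem DiffOp.polyAt_smul {D : DiffOp n} (hD : IsChalykhVeselov D) {t : ℂ} (ht : t ≠ 0)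
    {x : Fin n → ℂ} (hx : x ∈ regular n) (α : Fin n →₀ ℕ) :
    t ^ n.choose 2 * coeff α (D.polyAt (t • x)) = t ^ α.degree * coeff α (D.polyAt x) := by
  have h : affineSubst t⁻¹ 0 (D.polyAt (t • x)) = C (t ^ n.choose 2)⁻¹ * D.polyAt x := by
    apply MvPolynomial.funext
    intro ξ
    have := hD.homogeneous t ht x hx ξ
    rw [DiffOp.symbol_eq_eval, DiffOp.symbol_eq_eval] at this
    rw [eval_affineSubst, map_mul, eval_C, ← this]
    congr 2
    ext k
    simp
  have h1 := congrArg (coeff α) h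
  rw [coeff_affineSubst_zero, coeff_C_mul, inv_pow] at h1
  have h2 : t ^ α.degree ≠ 0 := pow_ne_zero _ ht
  have h3 : t ^ n.choose 2 ≠ 0 := pow_ne_zero _ ht
  field_simp at h1
  linear_combination h1

/-- A competing D could have poles off the hyperplanes, so the comparison takes place on
`regularSet`, the complement of a proper hypersurface; equality of the coefficients there determines
them as rational functions. -/
theorem IsChalykhVeselov.eq_intertwiner (hn : 2 ≤ n) {D : DiffOp n} (hD : IsChalykhVeselov D) :
    D = intertwiner hn := by
  set D₀ := intertwiner hn with hD₀
  have hCV₀ : IsChalykhVeselov D₀ := isChalykhVeselov_intertwiner hn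
  set U := D.regularSet with hUdef
  have hU : IsOpen U := D.isOpen_regularSet
  have hreg : U ⊆ regular n := fun x hx => (DiffOp.mem_regularSet hx).1
  set T := D.support ∪ D₀.support with hT
  set c : (Fin n →₀ ℕ) → (Fin n → ℂ) → ℂ := fun α x => D.coeffFun α x - D₀.coeffFun α x with hcdef
  have hcD : ∀ α, AnalyticOnNhd ℂ (D.coeffFun α) U := fun α =>
    analyticOnNhd_evalRat fun x hx => (DiffOp.mem_regularSet hx).2 α
  have hcD₀ : ∀ α, AnalyticOnNhd ℂ (D₀.coeffFun α) U := fun α =>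
    (analyticOnNhd_coeffFun_intertwiner hn α).mono hreg
  have hc : ∀ α ∈ T, AnalyticOnNhd ℂ (c α) U := fun α _ => (hcD α).sub (hcD₀ α)
  have hpoly : ∀ x, symbolPoly T c x = D.polyAt x - D₀.polyAt x := by
    intro x
    ext α
    rw [coeff_sub, DiffOp.coeff_polyAt, DiffOp.coeff_polyAt, coeff_symbolPoly]
    split_ifs with h
    · rfl
    · rw [hT, Finset.mem_union, not_or] at h
      rw [notMem_support_iff.1 h.1, notMem_support_iff.1 h.2, sub_self]
  have hact : ∀ (D : DiffOp n) f, D.act f = fun y => jet f y (D.polyAt y) := fun D f =>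
    funext fun y => D.act_eq_jet f y
  have hact_an : ∀ D : DiffOp n, (∀ α, AnalyticOnNhd ℂ (D.coeffFun α) U) → ∀ f,
      AnalyticOnNhd ℂ f U → AnalyticOnNhd ℂ (D.act f) U := by
    intro D hD f hf
    rw [hact]
    exact analyticOnNhd_jet hU hf fun α _ => hD α
  have hdef : ∀ x ∈ U, defect T c x = 0 := by
    intro x hx
    apply MvPolynomial.funext
    intro ξ
    set f : (Fin n → ℂ) → ℂ := fun y => Complex.exp (∑ k, ξ k * y k) with hf
    have hfU : AnalyticOnNhd ℂ f U := analyticOnNhd_exp_linear ξ U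
    have h := laplacianTilde_jet hU hfU hc hx
    have e : (fun y => jet f y (symbolPoly T c y)) = fun y => D.act f y - D₀.act f y := by
      ext y
      rw [hpoly, map_sub, hact, hact]
    rw [e, laplacianTilde_sub hU (hact_an D hcD f hfU) (hact_an D₀ hcD₀ f hfU) hx,
      ← hD.intertwines f (analyticOnNhd_exp_linear ξ _) x (hreg hx),
      ← hCV₀.intertwines f (analyticOnNhd_exp_linear ξ _) x (hreg hx), hpoly, map_sub,
      DiffOp.act_eq_jet, DiffOp.act_eq_jet, jet_exp_linear] at h
    have h' : eval ξ (defect T c x) * Complex.exp (∑ k, ξ k * x k) = 0 := by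
      linear_combination -h
    rw [map_zero]
    exact (mul_eq_zero.1 h').resolve_right (Complex.exp_ne_zero _)
  have hdeg : ∀ x ∈ U, ∀ α : Fin n →₀ ℕ, n.choose 2 ≤ α.degree →
      coeff α (symbolPoly T c x) = 0 := by
    intro x _ α hα
    have key : ∀ D : DiffOp n, IsChalykhVeselov D → coeff α D = coeff α (vdm X : DiffOp n) := by
      intro D hD
      have h := coeff_eq_zero_of_totalDegree_lt (lt_of_lt_of_le hD.leading
        (hα.trans_eq (Finsupp.degree_apply α)))
      rwa [coeff_sub, sub_eq_zero] at h
    rw [hpoly, coeff_sub, DiffOp.coeff_polyAt, DiffOp.coeff_polyAt, key D hD, key D₀ hCV₀, sub_self]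
  -- Euler's relation is the scaling identity of the coefficients differentiated in t at t = 1.
  have heuler : ∀ x ∈ U, ∀ α : Fin n →₀ ℕ,
      ∑ k, x k * partialD k (fun y => coeff α (symbolPoly T c y)) x =
        ((α.degree : ℂ) - (n.choose 2 : ℕ)) * coeff α (symbolPoly T c x) := by
    intro x hx α
    set g : (Fin n → ℂ) → ℂ := fun y => coeff α (symbolPoly T c y) with hg
    have hgan : AnalyticOnNhd ℂ g U := analyticOnNhd_symbolPoly hc (lcoeff ℂ α)
    have hgs : ∀ t : ℂ, t ≠ 0 → t ^ n.choose 2 * g (t • x) = t ^ α.degree * g x := by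
      intro t ht
      simp only [hg, hpoly, coeff_sub, mul_sub]
      rw [DiffOp.polyAt_smul hD ht (hreg hx), DiffOp.polyAt_smul hCV₀ ht (hreg hx)]
    have hd : HasFDerivAt g (fderiv ℂ g x) x := (hgan x hx).differentiableAt.hasFDerivAt
    have hγ : HasDerivAt (fun t : ℂ => t • x) x 1 := by
      simpa using (hasDerivAt_id (1 : ℂ)).smul_const x
    have hd' : HasFDerivAt g (fderiv ℂ g x) ((1 : ℂ) • x) := by rwa [one_smul]
    have hl := (hasDerivAt_pow (n.choose 2) (1 : ℂ)).mul (hd'.comp_hasDerivAt (1 : ℂ) hγ)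
    have hr := (hasDerivAt_pow α.degree (1 : ℂ)).mul_const (g x)
    have heq : (fun t : ℂ => t ^ n.choose 2) * (g ∘ fun t : ℂ => t • x) =ᶠ[nhds 1]
        fun t => t ^ α.degree * g x := by
      filter_upwards [isOpen_ne.mem_nhds (one_ne_zero (α := ℂ))] with t ht
      exact hgs t ht
    have huniq := (hl.congr_of_eventuallyEq heq.symm).unique hr
    have e : fderiv ℂ g x x = ∑ k, x k * partialD k g x := by
      conv_lhs => rw [← Finset.univ_sum_single x, map_sum]
      refine Finset.sum_congr rfl fun k _ => ?_
      rw [Finset.univ_sum_single, partialD_eq_fderiv k (hgan x hx).differentiableAt,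
        ← smul_eq_mul, ← map_smul]
      congr 1
      ext l
      by_cases hl : l = k
      · subst hl; simp
      · simp [hl]
    rw [e] at huniq
    simp only [one_pow, mul_one, Function.comp_apply, one_smul, one_mul] at huniq
    linear_combination huniq
  have hzero := coeff_eq_zero_of_defect_eq_zero hU hc hdef hdeg heuler
  ext1 α
  refine eq_of_evalRat_eq (D := D) fun x hx => ⟨(DiffOp.mem_regularSet hx).2 α,
    eval_denom_coeff_intertwiner hn (hreg hx) α, ?_⟩
  have h := hzero x hx
  rw [hpoly, sub_eq_zero] at h
  rw [← DiffOp.coeff_polyAt, ← DiffOp.coeff_polyAt, h]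

end Unique

/-! ### Vandermonde identities -/

section Vandermonde
variable {n : ℕ} {x : Fin n → ℂ}

/-- The mixed products cancel when summed over the cyclic rotations of (l, m, k). Since the inverse
of zero is zero, diagonal terms contribute nothing. -/
theorem sum_inv_sub_mul_inv_sub (hx : x ∈ regular n) :
    ∑ l, (∑ m, (x l - x m)⁻¹) ^ 2 = ∑ l, ∑ m, ((x l - x m)⁻¹) ^ 2 := by
  set t : Fin n → Fin n → Fin n → ℂ := fun l m k =>
    if m = k then 0 else (x l - x m)⁻¹ * (x l - x k)⁻¹ with ht
  have hsplit : ∀ l, (∑ m, (x l - x m)⁻¹) ^ 2 =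
      ∑ m, ∑ k, t l m k + ∑ m, ((x l - x m)⁻¹) ^ 2 := by
    intro l
    rw [pow_two, Finset.sum_mul_sum, ← Finset.sum_add_distrib]
    refine Finset.sum_congr rfl fun m _ => ?_
    have : ((x l - x m)⁻¹) ^ 2 = ∑ k, if m = k then (x l - x m)⁻¹ * (x l - x k)⁻¹ else 0 := by
      rw [Finset.sum_ite_eq, if_pos (mem_univ _), pow_two]
    rw [this, ← Finset.sum_add_distrib]
    refine Finset.sum_congr rfl fun k _ => ?_
    simp only [ht]
    split_ifs <;> ring
  have hcyc : ∀ l m k, t l m k + t m k l + t k l m = 0 := by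
    intro l m k
    simp only [ht]
    by_cases h1 : m = k
    · subst h1; simp
    by_cases h2 : k = l
    · subst h2; simp
    by_cases h3 : l = m
    · subst h3; simp
    rw [if_neg h1, if_neg h2, if_neg h3]
    have e1 : x m - x k ≠ 0 := sub_ne_zero.2 fun e => h1 (hx e)
    have e2 : x k - x l ≠ 0 := sub_ne_zero.2 fun e => h2 (hx e)
    have e3 : x l - x m ≠ 0 := sub_ne_zero.2 fun e => h3 (hx e)
    have e1' : x k - x m ≠ 0 := sub_ne_zero.2 fun e => h1 (hx e).symm
    have e2' : x l - x k ≠ 0 := sub_ne_zero.2 fun e => h2 (hx e).symm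
    have e3' : x m - x l ≠ 0 := sub_ne_zero.2 fun e => h3 (hx e).symm
    rw [← neg_sub (x m) (x k), ← neg_sub (x k) (x l), ← neg_sub (x l) (x m)]
    field_simp
    ring
  have h2 : ∑ l, ∑ m, ∑ k, t m k l = ∑ l, ∑ m, ∑ k, t l m k := by
    rw [Finset.sum_comm]
    exact Finset.sum_congr rfl fun _ _ => Finset.sum_comm
  have h3 : ∑ l, ∑ m, ∑ k, t k l m = ∑ l, ∑ m, ∑ k, t m k l := by
    have h4 : ∑ l, ∑ m, ∑ k, t k l m = ∑ l, ∑ k, ∑ m, t k l m :=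
      Finset.sum_congr rfl fun _ _ => Finset.sum_comm
    rw [h4, Finset.sum_comm, h2]
  have hz : ∑ l, ∑ m, ∑ k, (t l m k + t m k l + t k l m) = 0 :=
    Finset.sum_eq_zero fun l _ => Finset.sum_eq_zero fun m _ => Finset.sum_eq_zero fun k _ =>
      hcyc l m k
  simp only [Finset.sum_add_distrib] at hz
  rw [h3, h2] at hz
  rw [Finset.sum_congr rfl fun l _ => hsplit l, Finset.sum_add_distrib]
  linear_combination hz / 3

theorem eval_pderiv_vdm (hx : x ∈ regular n) (k : Fin n) :
    eval x (pderiv k (vdm X)) = vdm x * ∑ m, (x k - x m)⁻¹ := by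
  have h1 : ∀ s ⊆ pairs n, eval x (pderiv k (∏ p ∈ s, (X p.1 - X p.2))) =
      (∏ p ∈ s, (x p.1 - x p.2)) * ∑ p ∈ s, (Pi.single (M := fun _ => ℂ) p.1 1 k -
        Pi.single (M := fun _ => ℂ) p.2 1 k) * (x p.1 - x p.2)⁻¹ := by
    intro s hs
    induction s using Finset.induction_on with
    | empty => simp
    | insert p s hp ih =>
      rw [Finset.insert_subset_iff] at hs
      have h0 : x p.1 - x p.2 ≠ 0 := sub_ne_zero.2 fun e => (mem_pairs.1 hs.1).ne (hx e)
      rw [Finset.prod_insert hp, Derivation.leibniz, Finset.prod_insert hp, Finset.sum_insert hp,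
        map_add, smul_eq_mul, smul_eq_mul, map_mul, map_mul, ih hs.2]
      have e1 : eval x (pderiv k (X p.1 - X p.2 : MvPolynomial (Fin n) ℂ)) =
          Pi.single (M := fun _ => ℂ) p.1 1 k - Pi.single (M := fun _ => ℂ) p.2 1 k := by
        have e2 : ∀ l : Fin n, eval x (pderiv k (X l : MvPolynomial (Fin n) ℂ)) =
            Pi.single (M := fun _ => ℂ) l 1 k := by
          intro l
          by_cases h : k = l
          · subst h; simp
          · rw [pderiv_X_of_ne (Ne.symm h), Pi.single_eq_of_ne h, map_zero]
        rw [map_sub, map_sub, e2, e2]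
      rw [e1]
      simp only [map_prod, map_sub, eval_X]
      field_simp
      ring
  have h2 := h1 (pairs n) subset_rfl
  rw [← vdm_eq, ← vdm_eq] at h2
  rw [h2]
  congr 1
  have h3 := sum_sum_eq_two_mul_sum_pairs (fun i j => (Pi.single (M := fun _ => ℂ) i 1 k -
    Pi.single (M := fun _ => ℂ) j 1 k) * (x i - x j)⁻¹)
    (fun i j => by rw [← neg_sub (x i), inv_neg]; ring) (fun i => by simp)
  have h4 : ∑ i, ∑ j, (Pi.single (M := fun _ => ℂ) i 1 k -
      Pi.single (M := fun _ => ℂ) j 1 k) * (x i - x j)⁻¹ = 2 * ∑ m, (x k - x m)⁻¹ := by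
    simp only [sub_mul, Finset.sum_sub_distrib, Pi.single_apply, ite_mul, one_mul, zero_mul]
    rw [Finset.sum_comm]
    simp only [Finset.sum_ite_eq, mem_univ, if_true]
    rw [two_mul, sub_eq_add_neg, ← Finset.sum_neg_distrib]
    congr 1
    exact Finset.sum_congr rfl fun m _ => by rw [← inv_neg, neg_sub]
  exact mul_left_cancel₀ (two_ne_zero (α := ℂ)) (h3.symm.trans h4)

theorem partialD_eval (k : Fin n) (p : MvPolynomial (Fin n) ℂ) (x : Fin n → ℂ) :
    partialD k (fun y => eval y p) x = eval x (pderiv k p) := by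
  have hd : ∀ q : MvPolynomial (Fin n) ℂ, DifferentiableAt ℂ (fun y => eval y q) x := fun q =>
    (analyticOnNhd_eval q Set.univ x (Set.mem_univ x)).differentiableAt
  induction p using MvPolynomial.induction_on with
  | C a => simpa using partialD_const k a x
  | add p q hp hq =>
    simp only [map_add]
    rw [partialD_add k (hd p) (hd q), hp, hq]
  | mul_X p l hp =>
    simp only [map_mul, Derivation.leibniz, map_add, smul_eq_mul]
    rw [partialD_mul k (hd p) (hd (X l)), hp]
    have : partialD k (fun y => eval y (X l : MvPolynomial (Fin n) ℂ)) x =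
        eval x (pderiv k (X l : MvPolynomial (Fin n) ℂ)) := by
      simp only [eval_X]
      rw [partialD_eq_of_hasFDerivAt k (hasFDerivAt_apply l x), pderiv_X]
      simp only [ContinuousLinearMap.proj_apply, Pi.single_apply]
      by_cases h : k = l
      · subst h; simp
      · simp [Ne.symm h]
    rw [this]
    ring

/-- The Vandermonde product is harmonic: second derivatives give the square of the logarithmic
derivative minus a sum of inverse squares, and these agree after summation over k. -/
theorem sum_eval_pderiv_pderiv_vdm (hx : x ∈ regular n) :
    ∑ k, eval x (pderiv k (pderiv k (vdm X))) = 0 := by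
  have key : ∀ k, eval x (pderiv k (pderiv k (vdm X))) =
      vdm x * ((∑ m, (x k - x m)⁻¹) ^ 2 - ∑ m, ((x k - x m)⁻¹) ^ 2) := by
    intro k
    rw [← partialD_eval]
    have e : Set.EqOn (fun y => eval y (pderiv k (vdm X)))
        (fun y => eval y (vdm X) * ∑ m, (y k - y m)⁻¹) (regular n) := fun y hy => by
      simp only [eval_pderiv_vdm hy, eval_vdm]
    have hm : ∀ m, HasFDerivAt (fun y : Fin n → ℂ => (y k - y m)⁻¹)
        (-((x k - x m)⁻¹) ^ 2 • (ContinuousLinearMap.proj (R := ℂ) (φ := fun _ : Fin n => ℂ) k -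
          ContinuousLinearMap.proj (R := ℂ) (φ := fun _ : Fin n => ℂ) m)) x := by
      intro m
      by_cases hkm : m = k
      · subst hkm
        simpa using hasFDerivAt_const (0 : ℂ) x
      · have h0 : x k - x m ≠ 0 := sub_ne_zero.2 fun e => hkm (hx e).symm
        rw [inv_pow]
        exact (hasDerivAt_inv h0).comp_hasFDerivAt (f := fun y : Fin n → ℂ => y k - y m) x
          ((hasFDerivAt_apply k x).sub (hasFDerivAt_apply m x))
    rw [partialD_congr (isOpen_regular n) e k hx, partialD_mul k
      (analyticOnNhd_eval _ Set.univ x (Set.mem_univ x)).differentiableAt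
      (DifferentiableAt.fun_sum fun m _ => (hm m).differentiableAt), partialD_eval,
      eval_pderiv_vdm hx, eval_vdm, partialD_sum k univ fun m _ => (hm m).differentiableAt,
      Finset.sum_congr rfl fun m _ => partialD_eq_of_hasFDerivAt k (hm m)]
    have : ∀ m, (-((x k - x m)⁻¹) ^ 2 •
        (ContinuousLinearMap.proj (R := ℂ) (φ := fun _ : Fin n => ℂ) k -
          ContinuousLinearMap.proj (R := ℂ) (φ := fun _ : Fin n => ℂ) m)) (Pi.single k 1) =
        -((x k - x m)⁻¹) ^ 2 := by
      intro m
      by_cases hkm : m = k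
      · subst hkm; simp
      · simp [hkm]
    rw [Finset.sum_congr rfl fun m _ => this m, Finset.sum_neg_distrib]
    ring
  rw [Finset.sum_congr rfl fun k _ => key k, ← Finset.mul_sum, Finset.sum_sub_distrib,
    sum_inv_sub_mul_inv_sub hx, sub_self, mul_zero]

/-- Together with harmonicity, this makes conjugation by vdm remove the potential from the
Calogero-Moser equation. -/
theorem two_mul_sum_eval_pderiv_vdm_sq (hx : x ∈ regular n) :
    2 * ∑ k, eval x (pderiv k (vdm X)) ^ 2 = potential x * vdm x ^ 2 := by
  have h := sum_sum_eq_two_mul_sum_pairs (fun i j => ((x i - x j)⁻¹) ^ 2)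
    (fun i j => by rw [← neg_sub (x i), inv_neg, neg_sq]) (fun i => by simp)
  have hu : potential x = 4 * ∑ p ∈ pairs n, ((x p.1 - x p.2)⁻¹) ^ 2 := by
    rw [potential, sum_Ioi_eq_sum_pairs (fun i j => 4 / (x i - x j) ^ 2), Finset.mul_sum]
    exact Finset.sum_congr rfl fun p _ => by rw [div_eq_mul_inv, inv_pow]
  simp only [eval_pderiv_vdm hx, mul_pow]
  rw [← Finset.mul_sum, sum_inv_sub_mul_inv_sub hx, h, hu]
  ring

end Vandermonde

/-! ### Bispectral duality -/

section Duality
variable {n : ℕ} (hn : 2 ≤ n)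

/-- The numerator of the Baker-Akhiezer function as a polynomial in `x`, at the spectral
parameter `ξ`. -/
def baDual (ξ : Fin n → ℂ) : MvPolynomial (Fin n) ℂ := eval (fun k => C (ξ k)) (baNum n hn)

theorem eval_eval_C (ξ x : Fin n → ℂ) (Q : MvPolynomial (Fin n) (MvPolynomial (Fin n) ℂ)) :
    eval x (eval (fun k => C (ξ k)) Q) = eval ξ (MvPolynomial.map (eval x) Q) := by
  induction Q using MvPolynomial.induction_on with
  | C a => simp
  | add p q hp hq => simp only [map_add, hp, hq]
  | mul_X p k hp => simp only [map_mul, hp, eval_X, eval_C, map_X]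

theorem eval_baDual (ξ : Fin n → ℂ) {x : Fin n → ℂ} (hx : x ∈ regular n) :
    eval x (baDual hn ξ) = vdm x * eval ξ (ba hn x) := by
  rw [baDual, eval_eval_C, map_baNum hn hx, map_mul, eval_C]

theorem sum_eval_pderiv_vdm_mul {x : Fin n → ℂ} (hx : x ∈ regular n) (G : Fin n → ℂ) :
    ∑ k, eval x (pderiv k (vdm X)) * G k = ∑ p ∈ pairs n, vdmErase x p * (G p.1 - G p.2) := by
  have h := sum_sum_eq_two_mul_sum_pairs (fun i j => (x i - x j)⁻¹ * (G i - G j))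
    (fun i j => by rw [← neg_sub (x i), inv_neg]; ring) (fun i => by simp)
  have h2 : ∑ i, ∑ j, (x i - x j)⁻¹ * (G i - G j) = 2 * ∑ i, (∑ j, (x i - x j)⁻¹) * G i := by
    simp only [mul_sub, Finset.sum_sub_distrib]
    rw [Finset.sum_comm (f := fun i j => (x i - x j)⁻¹ * G j), two_mul, sub_eq_add_neg,
      ← Finset.sum_neg_distrib]
    simp only [Finset.sum_mul, ← Finset.sum_neg_distrib]
    congr 1
    refine Finset.sum_congr rfl fun i _ => Finset.sum_congr rfl fun j _ => ?_
    rw [← neg_mul, ← inv_neg, neg_sub]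
  have h3 := mul_left_cancel₀ (two_ne_zero (α := ℂ)) (h2.symm.trans h)
  simp only [eval_pderiv_vdm hx, mul_assoc]
  rw [← Finset.mul_sum, h3, Finset.mul_sum]
  refine Finset.sum_congr rfl fun p hp => ?_
  have h0 : x p.1 - x p.2 ≠ 0 := sub_ne_zero.2 fun e => (mem_pairs.1 hp).ne (hx e)
  rw [← mul_vdmErase x hp]
  field_simp

/-- Off the hyperplanes `baDual` is vdm · S, where S solves the equation in x expressing that the
defect is zero. Substituting S and clearing denominators cancels the potential and leaves
first-order terms only. -/
theorem eval_baDual_equation (ξ : Fin n → ℂ) {x : Fin n → ℂ} (hx : x ∈ regular n) :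
    vdm x * ∑ k, (eval x (pderiv k (pderiv k (baDual hn ξ))) +
      2 * ξ k * eval x (pderiv k (baDual hn ξ))) =
    2 * ∑ k, eval x (pderiv k (vdm X)) *
      (eval x (pderiv k (baDual hn ξ)) + ξ k * eval x (baDual hn ξ)) := by
  set φ : MvPolynomial (Fin n) ℂ →ₗ[ℂ] ℂ := (aeval ξ).toLinearMap with hφ
  set T := (intertwiner hn).support
  set c := (intertwiner hn).coeffFun
  have hc : ∀ α ∈ T, AnalyticOnNhd ℂ (c α) (regular n) := fun α _ =>
    analyticOnNhd_coeffFun_intertwiner hn α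
  have hc' : ∀ k, ∀ α ∈ T, AnalyticOnNhd ℂ (partialD k (c α)) (regular n) := fun k α hα =>
    analyticOnNhd_partialD (isOpen_regular n) (hc α hα) k
  set S : (Fin n → ℂ) → ℂ := fun y => φ (symbolPoly T c y) with hS
  have hSa : AnalyticOnNhd ℂ S (regular n) := analyticOnNhd_symbolPoly hc φ
  have hSd : ∀ k, AnalyticOnNhd ℂ (partialD k S) (regular n) := fun k =>
    analyticOnNhd_partialD (isOpen_regular n) hSa k
  have hPS : Set.EqOn (fun y => eval y (baDual hn ξ)) (fun y => eval y (vdm X) * S y) (regular n) := by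
    intro y hy
    simp only [eval_baDual hn ξ hy, eval_vdm, ← polyAt_intertwiner hn hy]
    rfl
  have hev : ∀ q : MvPolynomial (Fin n) ℂ, ∀ y : Fin n → ℂ,
      DifferentiableAt ℂ (fun y => eval y q) y := fun q y =>
    (analyticOnNhd_eval q Set.univ y (Set.mem_univ y)).differentiableAt
  have h1 : ∀ k, Set.EqOn (fun y => eval y (pderiv k (baDual hn ξ)))
      (fun y => eval y (pderiv k (vdm X)) * S y + eval y (vdm X) * partialD k S y)
      (regular n) := by
    intro k y hy
    have := partialD_congr (isOpen_regular n) hPS k hy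
    rwa [partialD_eval, partialD_mul k (hev _ y) (hSa y hy).differentiableAt, partialD_eval] at this
  have h2 : ∀ k, eval x (pderiv k (pderiv k (baDual hn ξ))) =
      eval x (pderiv k (pderiv k (vdm X))) * S x + 2 * eval x (pderiv k (vdm X)) * partialD k S x +
        eval x (vdm X) * partialD k (partialD k S) x := by
    intro k
    have := partialD_congr (isOpen_regular n) (h1 k) k hx
    have hS1 := (hSa x hx).differentiableAt
    have hS2 := (hSd k x hx).differentiableAt
    rw [partialD_eval, partialD_add k ((hev _ x).fun_mul hS1) ((hev _ x).fun_mul hS2),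
      partialD_mul k (hev _ x) hS1, partialD_mul k (hev _ x) hS2, partialD_eval, partialD_eval] at this
    rw [this]; ring
  have hdef : ∑ k, (2 * (ξ k * partialD k S x) + partialD k (partialD k S) x) =
      potential x * S x := by
    have h := congrArg φ (defect_intertwiner hn hx)
    have e1 : ∀ k, φ (symbolPoly T (fun α => partialD k (c α)) x) = partialD k S x := fun k =>
      (partialD_symbolPoly hc hx φ k).symm
    have e2 : ∀ k, φ (symbolPoly T (fun α => partialD k (partialD k (c α))) x) =
        partialD k (partialD k S) x := by
      intro k
      rw [← partialD_symbolPoly (hc' k) hx φ k]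
      exact (partialD_congr (isOpen_regular n)
        (fun y hy => partialD_symbolPoly hc hy φ k) k hx).symm
    rw [defect, map_zero, map_sub, map_sum, sub_eq_zero] at h
    have hX : ∀ k F, φ (X k * F) = ξ k * φ F := by intro k F; simp [hφ]
    have hC : ∀ b F, φ (C b * F) = b * φ F := by intro b F; simp [hφ]
    simp only [map_add, hX, hC, T, c, e1, e2] at h
    exact h
  have hxx : vdm x ≠ 0 := (vdm_ne_zero_iff x).2 hx
  have hP : eval x (baDual hn ξ) = vdm x * S x := by rw [← eval_vdm]; exact hPS hx
  have h1' := fun k => h1 k hx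
  simp only [eval_vdm] at h1' h2
  have hL := sum_eval_pderiv_pderiv_vdm hx
  have hG := two_mul_sum_eval_pderiv_vdm_sq hx
  simp only [h2, h1', hP]
  rw [← sub_eq_zero]
  have : ∀ k, vdm x * (eval x (pderiv k (pderiv k (vdm X))) * S x +
      2 * eval x (pderiv k (vdm X)) * partialD k S x + vdm x * partialD k (partialD k S) x +
      2 * ξ k * (eval x (pderiv k (vdm X)) * S x + vdm x * partialD k S x)) -
      2 * (eval x (pderiv k (vdm X)) * (eval x (pderiv k (vdm X)) * S x + vdm x * partialD k S x +
        ξ k * (vdm x * S x))) =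
      vdm x * S x * eval x (pderiv k (pderiv k (vdm X))) +
      vdm x ^ 2 * (2 * (ξ k * partialD k S x) + partialD k (partialD k S) x) -
      2 * S x * eval x (pderiv k (vdm X)) ^ 2 := fun k => by ring
  rw [Finset.mul_sum, Finset.mul_sum, ← Finset.sum_sub_distrib,
    Finset.sum_congr rfl fun k _ => this k, Finset.sum_sub_distrib, Finset.sum_add_distrib,
    ← Finset.mul_sum, ← Finset.mul_sum, ← Finset.mul_sum, hL, hdef]
  linear_combination -S x * hG

/-- The conjugated equation reads vdm · (polynomial) = 2 ∑_p vdmErase_p · twistSub_p. Modulo the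
linear factor of a fixed p, the left side and all other summands vanish; since that factor is prime
and does not divide `vdmErase X p`, it divides the twisted derivative. -/
theorem quasiInvariant_baDual (ξ : Fin n → ℂ) : QuasiInvariant ξ (baDual hn ξ) := by
  have key : vdm X * ∑ k, (pderiv k (pderiv k (baDual hn ξ)) +
      C (2 * ξ k) * pderiv k (baDual hn ξ)) =
      2 * ∑ p ∈ pairs n, vdmErase X p * twistSub ξ p.1 p.2 (baDual hn ξ) := by
    rw [← sub_eq_zero]
    apply eq_zero_of_eval_regular
    intro x hx
    have h := eval_baDual_equation hn ξ hx
    rw [sum_eval_pderiv_vdm_mul hx] at h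
    rw [map_sub, sub_eq_zero, map_mul, eval_vdm, map_sum]
    simp only [map_add, map_mul, eval_C] at h ⊢
    rw [h, map_sum, map_ofNat]
    congr 1
    refine Finset.sum_congr rfl fun p _ => ?_
    rw [twistSub_eq]
    simp only [vdmErase, map_prod, map_sub, map_add, map_mul, eval_X, eval_C]
    ring
  refine .of_pairs fun p hp => ?_
  have hd : (X p.1 - X p.2 : MvPolynomial (Fin n) ℂ) ∣ vdm X := ⟨_, (mul_vdmErase X hp).symm⟩
  have h2 : (X p.1 - X p.2 : MvPolynomial (Fin n) ℂ) ∣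
      2 * (vdmErase X p * twistSub ξ p.1 p.2 (baDual hn ξ)) := by
    have hsum := hd.mul_right (∑ k, (pderiv k (pderiv k (baDual hn ξ)) +
      C (2 * ξ k) * pderiv k (baDual hn ξ)))
    rw [key, ← Finset.add_sum_erase _ _ hp, mul_add] at hsum
    refine (dvd_add_left (Dvd.dvd.mul_left (Finset.dvd_sum fun q hq => ?_) _)).1 hsum
    exact (X_sub_X_dvd_vdmErase hp (Finset.ne_of_mem_erase hq).symm).mul_right _
  have hprime := prime_X_sub_X (A := ℂ) (mem_pairs.1 hp).ne
  refine ((hprime.dvd_or_dvd ?_).resolve_left (not_X_sub_X_dvd_vdmErase hp))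
  refine (IsUnit.dvd_mul_left (u := (C 2 : MvPolynomial (Fin n) ℂ)) ?_).1 h2
  exact (isUnit_iff_ne_zero.2 two_ne_zero).map C

/-- Coefficients of ξ-degree < N have x-degree < N as well, so degree N in x comes only from the
product of the two difference products. -/
theorem baDual_leading (ξ : Fin n → ℂ) :
    (baDual hn ξ - C (vdm ξ) * vdm X).totalDegree < n.choose 2 := by
  set W := baNum n hn - C (vdm (X : Fin n → MvPolynomial (Fin n) ℂ)) * vdm X with hW
  have e : baDual hn ξ - C (vdm ξ) * vdm X = eval (fun k => C (ξ k)) W := by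
    have h1 : eval (fun k => C (ξ k)) (vdm X) = (C (vdm ξ) : MvPolynomial (Fin n) ℂ) := by
      rw [map_vdm (eval fun k => (C (ξ k) : MvPolynomial (Fin n) ℂ)),
        map_vdm (C : ℂ →+* MvPolynomial (Fin n) ℂ)]
      simp only [eval_X]
    rw [hW, map_sub, map_mul, eval_C, h1, ← baDual, mul_comm (vdm X)]
  have hlead := baNum_leading hn
  rw [← hW] at hlead
  have hdeg : ∀ α ∈ W.support, (coeff α W).totalDegree ≤ n.choose 2 - 1 := by
    intro α hα
    have hα2 : α.degree < n.choose 2 := by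
      refine lt_of_le_of_lt ?_ hlead
      by_contra h
      exact (mem_support_iff.1 hα) (coeff_eq_zero_of_totalDegree_lt (by
        rw [not_le] at h; exact h))
    have e2 : coeff α W = coeff α (baNum n hn) := by
      rw [hW, coeff_sub, coeff_C_mul, (isHomogeneous_vdm (n := n)).coeff_eq_zero, mul_zero, sub_zero]
      exact hα2.ne
    rw [e2]
    exact (isHomogeneous_coeff_baNum hn α).totalDegree_le.trans (by omega)
  have hpos : 0 < n.choose 2 := (Nat.zero_le _).trans_lt hlead
  rw [e, eval_eq]
  refine Nat.lt_of_le_pred hpos (totalDegree_sum_le fun α hα => ?_)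
  have e3 : ∏ i ∈ α.support, (C (ξ i) : MvPolynomial (Fin n) ℂ) ^ α i =
      C (∏ i ∈ α.support, ξ i ^ α i) := by simp [map_prod]
  rw [e3, mul_comm]
  exact totalDegree_C_mul_le _ (hdeg α hα)

theorem baDual_eq {ξ : Fin n → ℂ} (hξ : ξ ∈ regular n) :
    baDual hn ξ = C (vdm ξ) * ba hn ξ := by
  rw [← sub_eq_zero, ← smul_eq_C_mul]
  refine ((quasiInvariant_baDual hn ξ).sub
    ((isBakerAkhiezer_ba hn hξ).quasiInvariant.smul (vdm ξ))).eq_zero hξ ?_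
  have e : baDual hn ξ - vdm ξ • ba hn ξ = (baDual hn ξ - C (vdm ξ) * vdm X) -
      C (vdm ξ) * (ba hn ξ - vdm X) := by rw [smul_eq_C_mul]; ring
  rw [e]
  exact (totalDegree_sub _ _).trans_lt (max_lt (baDual_leading hn ξ)
    ((totalDegree_C_mul_le _ le_rfl).trans_lt (isBakerAkhiezer_ba hn hξ).leading))

/-- The bispectral symmetry of the Baker-Akhiezer function. -/
theorem vdm_mul_eval_ba_comm {x ξ : Fin n → ℂ} (hx : x ∈ regular n) (hξ : ξ ∈ regular n) :
    vdm x * eval ξ (ba hn x) = vdm ξ * eval x (ba hn ξ) := by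
  rw [← eval_baDual hn ξ hx, baDual_eq hn hξ, map_mul, eval_C]

end Duality

/-! ### The Airy function -/

section Airy

/-- The series `∑ a_k s^(3k+d) / (3k+d)!`. -/
def triSeries (a : ℕ → ℂ) (d : ℕ) (s : ℂ) : ℂ :=
  ∑' k : ℕ, a k * s ^ (3 * k + d) / ((3 * k + d).factorial : ℂ)

/-- At most factorial growth, which makes `triSeries` converge everywhere. -/
def FactorialBound (a : ℕ → ℂ) : Prop :=
  ∃ C M : ℝ, 0 ≤ C ∧ 0 ≤ M ∧ ∀ k, ‖a k‖ ≤ C * M ^ k * (k.factorial : ℝ)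

variable {a : ℕ → ℂ}

theorem FactorialBound.shift (ha : FactorialBound a) : FactorialBound fun k => a (k + 1) := by
  obtain ⟨C, M, hC, hM, h⟩ := ha
  refine ⟨C * M, 2 * M, by positivity, by positivity, fun k => (h (k + 1)).trans ?_⟩
  have h1 : ((k + 1 : ℕ) : ℝ) ≤ 2 ^ k := by
    exact_mod_cast Nat.lt_two_pow_self
  rw [Nat.factorial_succ, Nat.cast_mul, mul_pow, pow_succ]
  calc C * (M ^ k * M) * (((k + 1 : ℕ) : ℝ) * (k.factorial : ℝ))
      ≤ C * (M ^ k * M) * (2 ^ k * (k.factorial : ℝ)) := by gcongr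
    _ = _ := by ring

/-- Since (k!)² ≤ (3k + d)!, one k! absorbs the growth of a and the other leaves an exponential
series. -/
theorem FactorialBound.exists_summable (ha : FactorialBound a) (d : ℕ) {R : ℝ} (hR : 0 ≤ R) :
    ∃ u : ℕ → ℝ, Summable u ∧ ∀ k (s : ℂ), ‖s‖ ≤ R →
      ‖a k * s ^ (3 * k + d) / ((3 * k + d).factorial : ℂ)‖ ≤ u k := by
  obtain ⟨C, M, hC, hM, h⟩ := ha
  refine ⟨fun k => C * R ^ d * ((M * R ^ 3) ^ k / (k.factorial : ℝ)),
    (Real.summable_pow_div_factorial _).mul_left _, fun k s hs => ?_⟩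
  have hf : (k.factorial : ℝ) * k.factorial ≤ ((3 * k + d).factorial : ℝ) := by
    have h1 := Nat.le_of_dvd (Nat.factorial_pos _) (Nat.factorial_mul_factorial_dvd_factorial_add k k)
    exact_mod_cast h1.trans (Nat.factorial_le (by omega))
  have hk : (0 : ℝ) < k.factorial := by exact_mod_cast Nat.factorial_pos k
  rw [norm_div, norm_mul, norm_pow, Complex.norm_natCast]
  calc ‖a k‖ * ‖s‖ ^ (3 * k + d) / ((3 * k + d).factorial : ℝ)
      ≤ (C * M ^ k * (k.factorial : ℝ)) * R ^ (3 * k + d) /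
          ((k.factorial : ℝ) * k.factorial) := by
        gcongr
        exact h k
    _ = _ := by
        simp only [pow_add, pow_mul, mul_pow]
        field_simp

theorem FactorialBound.summable (ha : FactorialBound a) (d : ℕ) (s : ℂ) :
    Summable fun k => a k * s ^ (3 * k + d) / ((3 * k + d).factorial : ℂ) := by
  obtain ⟨u, hu, h⟩ := ha.exists_summable d (norm_nonneg s)
  exact Summable.of_norm_bounded hu fun k => h k s le_rfl

theorem hasDerivAt_triSeries_succ (ha : FactorialBound a) (d : ℕ) (s : ℂ) :
    HasDerivAt (triSeries a (d + 1)) (triSeries a d s) s := by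
  obtain ⟨u, hu, h⟩ := ha.exists_summable d (R := ‖s‖ + 1) (by positivity)
  have hs : s ∈ Metric.ball (0 : ℂ) (‖s‖ + 1) := by simp
  refine hasDerivAt_tsum_of_isPreconnected (t := Metric.ball (0 : ℂ) (‖s‖ + 1)) hu
    Metric.isOpen_ball (convex_ball _ _).isPreconnected
    (g := fun k y => a k * y ^ (3 * k + (d + 1)) / ((3 * k + (d + 1)).factorial : ℂ))
    (g' := fun k y => a k * y ^ (3 * k + d) / ((3 * k + d).factorial : ℂ)) ?_
    (fun k y hy => h k y (by simpa using (Metric.mem_ball.1 hy).le)) hs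
    (ha.summable (d + 1) s) hs
  intro k y _
  have hd := ((hasDerivAt_pow (3 * k + (d + 1)) y).const_mul (a k)).div_const
    ((3 * k + (d + 1)).factorial : ℂ)
  convert! hd using 1
  rw [← add_assoc, Nat.factorial_succ, Nat.add_sub_cancel, Nat.cast_mul]
  have h1 : ((3 * k + d + 1 : ℕ) : ℂ) ≠ 0 := Nat.cast_ne_zero.2 (Nat.succ_ne_zero _)
  have h2 : ((3 * k + d).factorial : ℂ) ≠ 0 := Nat.cast_ne_zero.2 (Nat.factorial_ne_zero _)
  field_simp

theorem triSeries_zero_eq (ha : FactorialBound a) (s : ℂ) :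
    triSeries a 0 s = a 0 + triSeries (fun k => a (k + 1)) 3 s := by
  rw [triSeries, (ha.summable 0 s).tsum_eq_zero_add]
  simp only [mul_zero, add_zero, pow_zero, Nat.factorial_zero, Nat.cast_one, div_one, mul_one]
  rfl

theorem hasDerivAt_triSeries_zero (ha : FactorialBound a) (s : ℂ) :
    HasDerivAt (triSeries a 0) (triSeries (fun k => a (k + 1)) 2 s) s := by
  rw [funext (triSeries_zero_eq ha)]
  exact (hasDerivAt_triSeries_succ ha.shift 2 s).const_add _

/-- The factor 3k + d + 1 gained by a is exactly the one gained by the factorial, so the recurrence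
encodes Airy's equation. -/
theorem mul_triSeries (d : ℕ) (h : ∀ k, a (k + 1) = (3 * k + (d + 1) : ℂ) * a k) (s : ℂ) :
    triSeries (fun k => a (k + 1)) (d + 1) s = s * triSeries a d s := by
  rw [triSeries, triSeries, ← tsum_mul_left]
  refine tsum_congr fun k => ?_
  have h1 : ((3 * k + d + 1 : ℕ) : ℂ) ≠ 0 := Nat.cast_ne_zero.2 (Nat.succ_ne_zero _)
  have h2 : ((3 * k + d).factorial : ℂ) ≠ 0 := Nat.cast_ne_zero.2 (Nat.factorial_ne_zero _)
  have h3 : (3 * k + (d + 1) : ℂ) = ((3 * k + d + 1 : ℕ) : ℂ) := by push_cast; ring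
  rw [h, h3, ← add_assoc, Nat.factorial_succ, Nat.cast_mul, pow_succ]
  field_simp

theorem factorialBound_prod (e : ℕ) (he : e ≤ 3) :
    FactorialBound fun k => ∏ j ∈ range k, (3 * (j : ℂ) + e) := by
  refine ⟨1, 3, zero_le_one, by norm_num, fun k => ?_⟩
  induction k with
  | zero => simp
  | succ k ih =>
    have h1 : ‖3 * (k : ℂ) + e‖ ≤ 3 * ((k + 1 : ℕ) : ℝ) := by
      have : (3 * (k : ℂ) + e) = ((3 * k + e : ℕ) : ℂ) := by push_cast; ring
      rw [this, Complex.norm_natCast]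
      exact_mod_cast (by omega : 3 * k + e ≤ 3 * (k + 1))
    simp only [Finset.prod_range_succ, norm_mul, Nat.factorial_succ, Nat.cast_mul] at ih ⊢
    calc _ ≤ (1 * 3 ^ k * (k.factorial : ℝ)) * (3 * ((k + 1 : ℕ) : ℝ)) :=
          mul_le_mul ih h1 (norm_nonneg _) (by positivity)
      _ = _ := by ring

theorem airyAi_eq (s : ℂ) : airyAi s =
    (((3 : ℝ) ^ (-(2 / 3) : ℝ) / Real.Gamma (2 / 3) : ℝ) : ℂ) *
      triSeries (fun k => ∏ j ∈ range k, (3 * (j : ℂ) + (1 : ℕ))) 0 s -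
    (((3 : ℝ) ^ (-(1 / 3) : ℝ) / Real.Gamma (1 / 3) : ℝ) : ℂ) *
      triSeries (fun k => ∏ j ∈ range k, (3 * (j : ℂ) + (2 : ℕ))) 1 s := by
  simp only [airyAi, triSeries, add_zero, Nat.cast_one, Nat.cast_ofNat]

/-- The derivative of the Airy function. -/
def airyAiDeriv (s : ℂ) : ℂ :=
  (((3 : ℝ) ^ (-(2 / 3) : ℝ) / Real.Gamma (2 / 3) : ℝ) : ℂ) *
      triSeries (fun k => ∏ j ∈ range (k + 1), (3 * (j : ℂ) + (1 : ℕ))) 2 s -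
    (((3 : ℝ) ^ (-(1 / 3) : ℝ) / Real.Gamma (1 / 3) : ℝ) : ℂ) *
      triSeries (fun k => ∏ j ∈ range k, (3 * (j : ℂ) + (2 : ℕ))) 0 s

theorem hasDerivAt_airyAi (s : ℂ) : HasDerivAt airyAi (airyAiDeriv s) s := by
  rw [show airyAi = _ from funext airyAi_eq]
  exact ((hasDerivAt_triSeries_zero (factorialBound_prod 1 (by norm_num)) s).const_mul _).fun_sub
    ((hasDerivAt_triSeries_succ (factorialBound_prod 2 (by norm_num)) 0 s).const_mul _)

/-- The Airy equation. -/
theorem hasDerivAt_airyAiDeriv (s : ℂ) : HasDerivAt airyAiDeriv (s * airyAi s) s := by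
  have h1 := factorialBound_prod 1 (by norm_num)
  have h2 := factorialBound_prod 2 (by norm_num)
  have h := ((hasDerivAt_triSeries_succ h1.shift 1 s).const_mul
      (((3 : ℝ) ^ (-(2 / 3) : ℝ) / Real.Gamma (2 / 3) : ℝ) : ℂ)).fun_sub
    ((hasDerivAt_triSeries_zero h2 s).const_mul
      (((3 : ℝ) ^ (-(1 / 3) : ℝ) / Real.Gamma (1 / 3) : ℝ) : ℂ))
  rw [mul_triSeries (a := fun k => ∏ j ∈ range k, (3 * (j : ℂ) + (1 : ℕ))) 0
      (fun k => by rw [Finset.prod_range_succ]; push_cast; ring),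
    mul_triSeries (a := fun k => ∏ j ∈ range k, (3 * (j : ℂ) + (2 : ℕ))) 1
      (fun k => by rw [Finset.prod_range_succ]; push_cast; ring)] at h
  rw [airyAi_eq, mul_sub, mul_left_comm s, mul_left_comm s]
  exact h

theorem airyAi_zero_ne_zero : airyAi 0 ≠ 0 := by
  have h1 := triSeries_zero_eq (factorialBound_prod 1 (by norm_num)) 0
  have h2 : ∀ (a : ℕ → ℂ) (d : ℕ), triSeries a (d + 1) 0 = 0 := by
    intro a d
    simp [triSeries, ← add_assoc]
  rw [h2, add_zero, Finset.prod_range_zero] at h1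
  rw [airyAi_eq, h1, h2, mul_zero, sub_zero, mul_one, Complex.ofReal_ne_zero]
  have := Real.Gamma_pos_of_pos (show (0 : ℝ) < 2 / 3 by norm_num)
  positivity

end Airy

/-! ### Exponentials times functions of the coordinate sum -/

section PlaneWave
variable {n : ℕ} {ζ x : Fin n → ℂ} {h h' : ℂ → ℂ}

/-- An exponential times a function of the sum of the coordinates. -/
def wave (ζ : Fin n → ℂ) (h : ℂ → ℂ) (y : Fin n → ℂ) : ℂ :=
  Complex.exp (∑ k, ζ k * y k) * h (∑ k, y k)

theorem analyticOnNhd_wave (hh : Differentiable ℂ h) (U : Set (Fin n → ℂ)) :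
    AnalyticOnNhd ℂ (wave ζ h) U := by
  intro x hx
  refine (analyticOnNhd_exp_linear ζ U x hx).fun_mul ?_
  exact AnalyticAt.comp (f := fun y : Fin n → ℂ => ∑ k, y k) (hh.analyticAt _)
    (Finset.analyticAt_fun_sum _ fun k _ =>
      (ContinuousLinearMap.proj (R := ℂ) (φ := fun _ : Fin n => ℂ) k).analyticAt x)

theorem partialD_wave (hh : ∀ s, HasDerivAt h (h' s) s) (i : Fin n) :
    partialD i (wave ζ h) = wave ζ fun s => ζ i * h s + h' s := by
  ext x
  have hs : HasFDerivAt (fun y : Fin n → ℂ => ∑ k, y k)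
      (∑ k, ContinuousLinearMap.proj (R := ℂ) (φ := fun _ : Fin n => ℂ) k) x :=
    HasFDerivAt.fun_sum fun k _ => hasFDerivAt_apply k x
  have hc := (hh (∑ k, x k)).comp_hasFDerivAt x hs
  have hp := (hasFDerivAt_linear ζ x).cexp.fun_mul hc
  have := partialD_eq_of_hasFDerivAt i hp
  rw [show wave ζ h = fun y => Complex.exp (∑ k, ζ k * y k) * (h ∘ fun y => ∑ k, y k) y from rfl,
    this]
  simp [wave, Pi.single_apply, _root_.sum_apply]
  ring

/-- The operator ∂_i - ∂_j kills functions of ∑ y_k, so it only sees the exponential. Symbols in the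
differences therefore act on a wave as on a pure exponential. -/
theorem jet_wave_sub_mul (hh : Differentiable ℂ h) (i j : Fin n) (x : Fin n → ℂ)
    (R : MvPolynomial (Fin n) ℂ) :
    jet (wave ζ h) x ((X i - X j) * R) = (ζ i - ζ j) * jet (wave ζ h) x R := by
  have hx := Set.mem_univ x
  have ha := analyticOnNhd_wave (ζ := ζ) hh Set.univ
  have ha' := analyticOnNhd_wave (ζ := ζ) hh.deriv Set.univ
  have key : ∀ k, jet (wave ζ h) x (X k * R) =
      ζ k * jet (wave ζ h) x R + jet (wave ζ (deriv h)) x R := by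
    intro k
    rw [jet_X_mul isOpen_univ ha hx, partialD_wave (fun s => (hh s).hasDerivAt),
      ← jet_const_mul isOpen_univ (ζ k) ha hx,
      ← jet_add isOpen_univ (analyticOnNhd_const.mul ha) ha' hx]
    congr 2
    ext y
    simp only [wave]
    ring
  rw [sub_mul, map_sub, key, key]
  ring

theorem jet_wave_subBase (hn : 2 ≤ n) (hh : Differentiable ℂ h) (x : Fin n → ℂ)
    (Q R : MvPolynomial (Fin n) ℂ) :
    jet (wave ζ h) x (subBase hn ℂ Q * R) = eval ζ (subBase hn ℂ Q) * jet (wave ζ h) x R := by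
  induction Q using MvPolynomial.induction_on generalizing R with
  | C a => simp [subBase, jet_C_mul]
  | add p q hp hq => rw [map_add, add_mul, map_add, hp, hq, map_add, add_mul]
  | mul_X p k hp =>
    have e : subBase hn ℂ (X k) = X k - X (base hn) := by rw [subBase, aeval_X]
    rw [map_mul (subBase hn ℂ), mul_assoc, hp, e, jet_wave_sub_mul hh, map_mul (eval ζ),
      map_sub (eval ζ), eval_X, eval_X, mul_assoc]

theorem act_intertwiner_wave (hn : 2 ≤ n) (hh : Differentiable ℂ h) {x : Fin n → ℂ}
    (hx : x ∈ regular n) :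
    (intertwiner hn).act (wave ζ h) x = eval ζ (ba hn x) * wave ζ h x := by
  rw [DiffOp.act_eq_jet, polyAt_intertwiner hn hx]
  have := jet_wave_subBase (ζ := ζ) hn hh x (ba hn x) 1
  rwa [mul_one, subBase_ba hn hx, jet_one] at this

theorem analyticOnNhd_act_intertwiner (hn : 2 ≤ n) {f : (Fin n → ℂ) → ℂ}
    (hf : AnalyticOnNhd ℂ f (regular n)) :
    AnalyticOnNhd ℂ ((intertwiner hn).act f) (regular n) := by
  have := analyticOnNhd_jet (isOpen_regular n) hf
    (fun α (_ : α ∈ (intertwiner hn).support) => analyticOnNhd_coeffFun_intertwiner hn α)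
  rwa [show (intertwiner hn).act f = _ from funext fun y => DiffOp.act_eq_jet _ f y]

/-- The cross term 2 ∑ ζ_k h' drops out since ∑ ζ_k = 0, and n copies of h'' = c (s + σ) h add up to
(s + σ) h. -/
theorem laplacian_wave (hζ : ∑ k, ζ k = 0) {c σ : ℂ} (hh : ∀ s, HasDerivAt h (h' s) s)
    (hh' : ∀ s, HasDerivAt h' (c * (s + σ) * h s) s) (hc : n * c = 1) :
    laplacian (wave ζ h) = wave ζ fun s => (∑ k, ζ k ^ 2 + σ + s) * h s := by
  ext x
  have e : ∀ k, partialD k (partialD k (wave ζ h)) x =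
      ζ k ^ 2 * wave ζ h x + ζ k * (2 * wave ζ h' x) +
        c * (∑ k, x k + σ) * wave ζ h x := by
    intro k
    rw [partialD_wave hh, partialD_wave (fun s => ((hh s).const_mul (ζ k)).fun_add (hh' s))]
    simp only [wave]
    ring
  rw [laplacian, Finset.sum_congr rfl fun k _ => e k, Finset.sum_add_distrib,
    Finset.sum_add_distrib, ← Finset.sum_mul, ← Finset.sum_mul, hζ, Finset.sum_const, card_univ,
    Fintype.card_fin, nsmul_eq_mul]
  simp only [wave]
  linear_combination (∑ k, x k + σ) * (Complex.exp (∑ k, ζ k * x k) * h (∑ k, x k)) * hc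

end PlaneWave

/-! ### The eigenfunction and its symmetry -/

section Eigenfunction
variable {n : ℕ} (hn : 2 ≤ n) {x z : Fin n → ℂ}

/-- The coordinates relative to the barycenter. -/
def centered (z : Fin n → ℂ) (k : Fin n) : ℂ := z k + -(1 / (n : ℂ) * ∑ i, z i)

/-- The Airy factor of `psi` as a function of the sum of the coordinates. -/
def airyFactor (n : ℕ) (σ s : ℂ) : ℂ :=
  airyAi (((1 / (n : ℝ)) ^ (1 / 3 : ℝ) : ℝ) * (s + σ))

/-- The exponent 1/3 is chosen so that n second derivatives of the rescaled Airy function carry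
total factor 1. -/
theorem airyScale_pow_three (hn : 2 ≤ n) :
    (n : ℂ) * ((((1 / (n : ℝ)) ^ (1 / 3 : ℝ) : ℝ) : ℂ)) ^ 3 = 1 := by
  have h0 : (n : ℝ) ≠ 0 := by positivity
  rw [← Complex.ofReal_pow, ← Real.rpow_natCast, ← Real.rpow_mul (by positivity)]
  norm_num
  have h1 : (n : ℂ) ≠ 0 := by exact_mod_cast h0
  field_simp

theorem sum_centered (hn : 2 ≤ n) (z : Fin n → ℂ) : ∑ k, centered z k = 0 := by
  have h1 : (n : ℂ) ≠ 0 := Nat.cast_ne_zero.2 (by omega)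
  simp only [centered, Finset.sum_add_distrib, Finset.sum_const, card_univ, Fintype.card_fin,
    nsmul_eq_mul]
  field_simp
  ring

theorem psi_eq_wave (hn : 2 ≤ n) (y z : Fin n → ℂ) :
    psi y z = wave (centered z) (airyFactor n (∑ k, z k)) y := by
  have h1 : (n : ℂ) ≠ 0 := Nat.cast_ne_zero.2 (by omega)
  rw [psi, wave, airyFactor, Finset.sum_add_distrib]
  congr 2
  have h := sum_sum_eq_two_mul_sum_pairs (fun i j => (y i - y j) * (z i - z j))
    (fun i j => by ring) (fun i => by simp)
  have h2 : ∑ i, ∑ j, (y i - y j) * (z i - z j) =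
      2 * (n * ∑ i, y i * z i - (∑ i, y i) * ∑ i, z i) := by
    have e : ∀ i j, (y i - y j) * (z i - z j) = y i * z i - y i * z j - (y j * z i - y j * z j) :=
      fun i j => by ring
    simp only [e, Finset.sum_sub_distrib, ← Finset.mul_sum, ← Finset.sum_mul, Finset.sum_const,
      card_univ, Fintype.card_fin, nsmul_eq_mul]
    rw [Finset.sum_congr rfl fun i _ => mul_left_comm (y i) (n : ℂ) (z i), ← Finset.mul_sum]
    ring
  have h3 := mul_left_cancel₀ (two_ne_zero (α := ℂ)) (h.symm.trans h2)
  rw [sum_Ioi_eq_sum_pairs (fun i j => (y i - y j) * (z i - z j)), h3]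
  simp only [centered, add_mul, Finset.sum_add_distrib, ← Finset.mul_sum]
  rw [Finset.sum_congr rfl fun i _ => mul_comm (z i) (y i)]
  field_simp
  ring

theorem psi_comm (x z : Fin n → ℂ) : psi x z = psi z x := by
  simp only [psi, mul_comm (x _ - x _), add_comm (x _)]

theorem hasDerivAt_airyFactor (σ s : ℂ) : HasDerivAt (airyFactor n σ)
    ((((1 / (n : ℝ)) ^ (1 / 3 : ℝ) : ℝ) : ℂ) *
      airyAiDeriv (((1 / (n : ℝ)) ^ (1 / 3 : ℝ) : ℝ) * (s + σ))) s := by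
  have h := (((hasDerivAt_id s).add_const σ).const_mul
    ((((1 / (n : ℝ)) ^ (1 / 3 : ℝ) : ℝ) : ℂ)))
  rw [mul_one] at h
  rw [mul_comm]
  exact (hasDerivAt_airyAi _).comp s h

theorem hasDerivAt_deriv_airyFactor (σ s : ℂ) :
    HasDerivAt (fun s : ℂ => (((1 / (n : ℝ)) ^ (1 / 3 : ℝ) : ℝ) : ℂ) *
      airyAiDeriv (((1 / (n : ℝ)) ^ (1 / 3 : ℝ) : ℝ) * (s + σ)))
      ((((1 / (n : ℝ)) ^ (1 / 3 : ℝ) : ℝ) : ℂ) ^ 3 * (s + σ) * airyFactor n σ s) s := by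
  have h := (((hasDerivAt_id s).add_const σ).const_mul
    ((((1 / (n : ℝ)) ^ (1 / 3 : ℝ) : ℝ) : ℂ)))
  rw [mul_one] at h
  have h2 := ((hasDerivAt_airyAiDeriv _).comp s h).const_mul
    ((((1 / (n : ℝ)) ^ (1 / 3 : ℝ) : ℝ) : ℂ))
  convert! h2 using 1
  simp only [airyFactor, id_eq]
  ring

theorem differentiable_airyFactor (σ : ℂ) : Differentiable ℂ (airyFactor n σ) := fun s =>
  (hasDerivAt_airyFactor σ s).differentiableAt

theorem eigenvalue_eq (z : Fin n → ℂ) :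
    eigenvalue z = ∑ k, centered z k ^ 2 + ∑ k, z k := by
  by_cases hn : n = 0
  · subst hn; simp [eigenvalue]
  have h1 : (n : ℂ) ≠ 0 := Nat.cast_ne_zero.2 hn
  rw [eigenvalue, Finset.sum_add_distrib]
  congr 1
  refine Finset.sum_congr rfl fun j _ => ?_
  rw [Finset.sum_sub_distrib, Finset.sum_const, card_univ, Fintype.card_fin, nsmul_eq_mul, centered]
  field_simp
  ring

theorem eval_centered_ba (hx : x ∈ regular n) (z : Fin n → ℂ) :
    eval (centered z) (ba hn x) = eval z (ba hn x) := by
  have h := congrArg (eval z) (affineSubst_ba hn (-(1 / (n : ℂ) * ∑ i, z i)) hx)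
  rw [eval_affineSubst] at h
  rw [← h]
  congr 2
  ext k
  rw [centered, one_mul]

theorem act_intertwiner_psi (hx : x ∈ regular n) (z : Fin n → ℂ) :
    (intertwiner hn).act (fun y => psi y z) x = eval z (ba hn x) * psi x z := by
  rw [psi_eq_wave hn x z, ← eval_centered_ba hn hx,
    ← act_intertwiner_wave hn (differentiable_airyFactor _) hx]
  congr 1
  ext y
  exact psi_eq_wave hn y z

theorem analyticOnNhd_psi (hn : 2 ≤ n) (z : Fin n → ℂ) (U : Set (Fin n → ℂ)) :
    AnalyticOnNhd ℂ (fun y => psi y z) U := by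
  rw [funext fun y => psi_eq_wave hn y z]
  exact analyticOnNhd_wave (differentiable_airyFactor _) U

theorem analyticOnNhd_psiTilde (z : Fin n → ℂ) :
    AnalyticOnNhd ℂ (fun x => psiTilde (intertwiner hn) x z) (regular n) :=
  analyticOnNhd_const.mul (analyticOnNhd_act_intertwiner hn (analyticOnNhd_psi hn z _))

theorem psiTilde_eq (hx : x ∈ regular n) (z : Fin n → ℂ) :
    psiTilde (intertwiner hn) x z = (vdm z)⁻¹ * (eval z (ba hn x) * psi x z) := by
  rw [psiTilde, act_intertwiner_psi hn hx]
  congr 1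
  simp only [vdm, Finset.prod_inv_distrib]

theorem psiTilde_comm (hx : x ∈ regular n) (hz : z ∈ regular n) :
    psiTilde (intertwiner hn) x z = psiTilde (intertwiner hn) z x := by
  have hx0 := (vdm_ne_zero_iff x).2 hx
  have hz0 := (vdm_ne_zero_iff z).2 hz
  rw [psiTilde_eq hn hx, psiTilde_eq hn hz, psi_comm z x]
  field_simp
  linear_combination psi x z * vdm_mul_eval_ba_comm hn hx hz

/-- By the symmetry, z may serve as the base point of the nonzero polynomial B_z, which is nonzero
at some regular x. Translating x along (1, …, 1) does not change that value. -/
theorem exists_psiTilde_ne_zero (hz : z ∈ regular n) :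
    ∃ x ∈ regular n, psiTilde (intertwiner hn) x z ≠ 0 := by
  have hn0 : (n : ℂ) ≠ 0 := Nat.cast_ne_zero.2 (by omega)
  have hba : ba hn z ≠ 0 := by
    intro h0
    have h := (isBakerAkhiezer_ba hn hz).leading
    rw [h0, zero_sub, totalDegree_neg, isHomogeneous_vdm.totalDegree vdm_X_ne_zero] at h
    exact lt_irrefl _ h
  obtain ⟨x, hx, hxz⟩ : ∃ x ∈ regular n, eval x (ba hn z) ≠ 0 := by
    by_contra! h
    exact hba (eq_zero_of_eval_regular h)
  -- The shift for which the coordinates of x and z sum to zero, so that the Airy factor becomes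
  -- Ai(0) ≠ 0.
  set d : ℂ := -(1 / (n : ℂ) * ∑ i, (x i + z i)) with hd
  have hy : (fun k => x k + d) ∈ regular n := add_const_mem_regular d hx
  refine ⟨_, hy, ?_⟩
  rw [psiTilde_comm hn hy hz, psiTilde_eq hn hz]
  have h1 : eval (fun k => x k + d) (ba hn z) = eval x (ba hn z) := by
    have h := congrArg (eval x) (affineSubst_ba hn d hz)
    rw [eval_affineSubst] at h
    simpa only [one_mul] using h
  have h2 : ∑ k, (z k + (x k + d)) = 0 := by
    rw [Finset.sum_congr rfl fun k _ => show z k + (x k + d) = (x k + z k) + d by ring,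
      Finset.sum_add_distrib, Finset.sum_const, card_univ, Fintype.card_fin, nsmul_eq_mul, hd]
    field_simp
    ring
  rw [h1, psi, h2, mul_zero]
  exact mul_ne_zero (inv_ne_zero ((vdm_ne_zero_iff _).2 hy))
    (mul_ne_zero hxz (mul_ne_zero (Complex.exp_ne_zero _) airyAi_zero_ne_zero))

theorem laplacianTilde_const_mul (a : ℂ) {f : (Fin n → ℂ) → ℂ}
    (hf : AnalyticOnNhd ℂ f (regular n)) (hx : x ∈ regular n) :
    laplacianTilde (fun y => a * f y) x = a * laplacianTilde f x := by
  have hU := isOpen_regular n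
  have e : ∀ k, partialD k (partialD k fun y => a * f y) x = a * partialD k (partialD k f) x := by
    intro k
    rw [partialD_congr hU (fun y hy => partialD_const_mul k a (hf y hy).differentiableAt) k hx]
    exact partialD_const_mul k a (analyticOnNhd_partialD hU hf k x hx).differentiableAt
  simp only [laplacianTilde, laplacian, e, ← Finset.mul_sum]
  ring

theorem hamiltonianTilde_eq (f : (Fin n → ℂ) → ℂ) (x : Fin n → ℂ) :
    hamiltonianTilde f x = laplacianTilde f x - (∑ k, x k) * f x := by
  rw [hamiltonianTilde, laplacianTilde, laplacian, Finset.sum_sub_distrib, ← Finset.sum_mul]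
  ring

/-- Δ ψ is a wave with the same ζ and Airy factor multiplied by E + s, where s is the coordinate
sum. As D multiplies every such wave by the same B_x(ζ), the factor E + ∑ x_k passes through D, and
the linear potential removes ∑ x_k. -/
theorem hamiltonianTilde_psiTilde (hx : x ∈ regular n) (z : Fin n → ℂ) :
    hamiltonianTilde (fun y => psiTilde (intertwiner hn) y z) x =
      eigenvalue z * psiTilde (intertwiner hn) x z := by
  have hpsi := analyticOnNhd_psi hn z (regular n)
  set E := eigenvalue z with hE
  have hw : (fun y => psi y z) = wave (centered z) (airyFactor n (∑ k, z k)) :=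
    funext fun y => psi_eq_wave hn y z
  have hL : laplacian (fun y => psi y z) =
      wave (centered z) fun s => (E + s) * airyFactor n (∑ k, z k) s := by
    rw [hw, laplacian_wave (sum_centered hn z) (hasDerivAt_airyFactor _)
      (hasDerivAt_deriv_airyFactor _) (airyScale_pow_three hn), hE, eigenvalue_eq]
  have hd : Differentiable ℂ fun s => (E + s) * airyFactor n (∑ k, z k) s :=
    (differentiable_id.const_add E).fun_mul (differentiable_airyFactor _)
  have hA : laplacianTilde ((intertwiner hn).act fun y => psi y z) x =
      (E + ∑ k, x k) * (intertwiner hn).act (fun y => psi y z) x := by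
    rw [← intertwiner_intertwines hn hpsi hx, hL, act_intertwiner_wave hn hd hx,
      act_intertwiner_psi hn hx, eval_centered_ba hn hx, psi_eq_wave hn]
    simp only [wave]
    ring
  rw [hamiltonianTilde_eq]
  simp only [psiTilde]
  rw [laplacianTilde_const_mul _ (analyticOnNhd_act_intertwiner hn hpsi) hx, hA]
  ring

theorem isTriviallyBispectral_hamiltonianTilde (hn : 2 ≤ n) :
    IsTriviallyBispectral (hamiltonianTilde (n := n)) := by
  have hz : (fun i : Fin n => ((i : ℕ) : ℂ)) ∈ regular n := fun i j h =>
    Fin.ext (Nat.cast_injective h)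
  obtain ⟨x, hx, h⟩ := exists_psiTilde_ne_zero hn hz
  exact ⟨psiTilde (intertwiner hn), eigenvalue, ⟨x, hx, _, hz, h⟩,
    fun z _ => analyticOnNhd_psiTilde hn z, fun _ hx z _ => hamiltonianTilde_psiTilde hn hx z,
    fun _ hx _ hz => psiTilde_comm hn hx hz⟩

end Eigenfunction

end CalogeroAiry

end

theorem theorem5 (n : ℕ) (hn : 2 ≤ n) :
    (∃! D : CalogeroAiry.DiffOp n, CalogeroAiry.IsChalykhVeselov D) ∧
    (∀ D : CalogeroAiry.DiffOp n, CalogeroAiry.IsChalykhVeselov D →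
      (∀ z ∈ CalogeroAiry.regular n,
        AnalyticOnNhd ℂ (fun x => CalogeroAiry.psiTilde D x z) (CalogeroAiry.regular n)) ∧
      (∀ z ∈ CalogeroAiry.regular n, ∃ x ∈ CalogeroAiry.regular n,
        CalogeroAiry.psiTilde D x z ≠ 0) ∧
      (∀ x ∈ CalogeroAiry.regular n, ∀ z ∈ CalogeroAiry.regular n,
        CalogeroAiry.hamiltonianTilde (fun y => CalogeroAiry.psiTilde D y z) x =
          CalogeroAiry.eigenvalue z * CalogeroAiry.psiTilde D x z) ∧
      (∀ x ∈ CalogeroAiry.regular n, ∀ z ∈ CalogeroAiry.regular n,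
        CalogeroAiry.psiTilde D x z = CalogeroAiry.psiTilde D z x)) ∧
    CalogeroAiry.IsTriviallyBispectral (CalogeroAiry.hamiltonianTilde (n := n)) := by
  refine ⟨⟨CalogeroAiry.intertwiner hn, CalogeroAiry.isChalykhVeselov_intertwiner hn,
    fun D hD => hD.eq_intertwiner hn⟩, fun D hD => ?_,
    CalogeroAiry.isTriviallyBispectral_hamiltonianTilde hn⟩
  rw [hD.eq_intertwiner hn]
  exact ⟨fun z _ => CalogeroAiry.analyticOnNhd_psiTilde hn z,
    fun z hz => CalogeroAiry.exists_psiTilde_ne_zero hn hz,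
    fun x hx z _ => CalogeroAiry.hamiltonianTilde_psiTilde hn hx z,
    fun x hx z hz => CalogeroAiry.psiTilde_comm hn hx hz⟩
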